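/- Work in the piecewise linear category. Let $K\cup K_1\cup\dots\cup K_m$ ($m\ge 1$) be an oriented $(m+1)$-component link in the oriented sphere $S^3$ with $\mathrm{lk}(K,K_i)=0$ for all $i$. A Seifert surface of $K$ is a compact connected oriented surface embedded in $S^3$ with oriented boundary $K$. Two Seifert surfaces of $K$ disjoint from $K_i\cup K_j$ are called $S$-equivalent rel. $K_i\cup K_j$ if one is obtained from the other by a finite sequence of ambient isotopies fixing $K$, attachments of hollow orientable $1$-handles (two disjoint discs $D^2\times\partial I$ of the surface, which are the ends of a solid cylinder $D^2\times I$ that otherwise does not meet the surface, are replaced by $\partial D^2\times I$ so that the orientations match), and deletions of such handles, all in the complement of $K_i\cup K_j$. For a Seifert surface $F$ of $K$ disjoint from $K_1\cup\dots\cup K_m$ and a basis $\alpha=(a_1,\dots,a_n)$ of $H_1(F;\mathbb Z)$ let $M=(\mathrm{lk}(a_r^+,a_s))_{r,s}$ be the Seifert matrix, where $a_r^+$ is $a_r$ pushed off $F$ in the positive normal direction, and let $V(K_i)=(\mathrm{lk}(K_i,a_1),\dots,\mathrm{lk}(K_i,a_n))$. Put $$\lambda_F(K_i,K_j;\omega)=V(K_i)\bigl((1-\overline{\omega})M+(1-\omega)M^T\bigr)^{-1}V(K_j)^T$$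 for a root of unity $\omega\ne 1$ that is not a root of the Alexander polynomial $\det(tM-M^T)$ of $K$ (the matrix is then nonsingular), $$\lambda_F(K_i,K_j)(t)=V(K_i)\,(tM-M^T)^{-1}\,V(K_j)^T\in\mathbb Q(t),$$ and, for $p\ge 2$ and $1\le k,l\le p-1$, $$\lambda_F^{(k,l)}(K_i,K_j)=V_p^k(K_i)\,M_p^{-1}\,V_p^l(K_j)^T$$ whenever $M_p$ is nonsingular, where $M_p$ is the $(p-1)n\times(p-1)n$ block tridiagonal matrix with diagonal blocks $M+M^T$, blocks $-M^T$ directly above and $-M$ directly below the diagonal, and $V_p^k(K_i)$ is the vector of length $(p-1)n$ whose $k$-th block is $V(K_i)$ and whose other blocks are $0$. All three are $0$ if $F$ is a disc. Let $F$ and $F'$ be Seifert surfaces of $K$ that do not intersect $K_1\cup\dots\cup K_m$, and let $i,j\in\{1,\dots,m\}$, possibly $i=j$. If $F$ and $F'$ are $S$-equivalent rel. $K_i\cup K_j$, then, for any choice of bases of $H_1(F;\mathbb Z)$ and $H_1(F';\mathbb Z)$: 1. for every root of unity $\omega\neq1$ that is not a root of the Alexander polynomial of $K$ (computed from $F$),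 the matrices $(1-\overline{\omega})M+(1-\omega)M^T$ of $F$ and of $F'$ are nonsingular and $\lambda_F(K_i,K_j;\omega)=\lambda_{F'}(K_i,K_j;\omega)$; 2. $\lambda_F(K_i,K_j)(t)=\lambda_{F'}(K_i,K_j)(t)$; 3. for every $p\ge2$ such that the matrix $M_p$ of $F$ is nonsingular, the matrix $M_p$ of $F'$ is nonsingular and $\lambda_F^{(k,l)}(K_i,K_j)=\lambda_{F'}^{(k,l)}(K_i,K_j)$ for all $1\le k,l\le p-1$. -/

import Mathlib

/-!
Knots, links and Seifert surfaces in the piecewise linear category.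

The three-sphere is given by a triangulation `T`, i.e. an abstract simplicial complex on vertices
labelled by natural numbers which is a combinatorial 3-sphere.  Oriented knots are simplicial
1-cycles, oriented surfaces are simplicial 2-chains, and a subdivision of `T` may be chosen
whenever one is needed.
-/

open scoped Matrix

noncomputable section

namespace PLKnot

/-! ### Simplicial complexes, stellar subdivisions, balls and spheres -/

/-- Abstract simplicial complexes (nonempty faces, closed under passage to nonempty subsets). -/
abbrev Cx := PreAbstractSimplicialComplex ℕ

/-- The full simplex with vertices `0, …, n`. -/
def simplex (n : ℕ) : Cx where
  faces := {σ | σ.Nonempty ∧ σ ⊆ Finset.range (n + 1)}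
  isRelLowerSet_faces := fun _ h => ⟨h.1, fun _ hb hn => ⟨hn, Finset.Subset.trans hb h.2⟩⟩

/-- The boundary of the simplex with vertices `0, …, n + 1`; it is the standard `n`-sphere. -/
def simplexBoundary (n : ℕ) : Cx where
  faces := {σ | σ.Nonempty ∧ σ ⊂ Finset.range (n + 2)}
  isRelLowerSet_faces := fun _ h =>
    ⟨h.1, fun _ hb hn => ⟨hn, Finset.ssubset_of_subset_of_ssubset hb h.2⟩⟩

/-- The link of the vertex `v`. -/
def link (T : Cx) (v : ℕ) : Cx where
  faces := {σ | σ.Nonempty ∧ v ∉ σ ∧ insert v σ ∈ T.faces}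
  isRelLowerSet_faces := fun _ h => ⟨h.1, fun _ hb hn =>
    ⟨hn, fun hv => h.2.1 (hb hv), (T.isRelLowerSet_faces h.2.2).2
      (Finset.insert_subset_insert v hb) (Finset.insert_nonempty _ _)⟩⟩

/-- The stellar subdivision of `T` at the face `A` with new vertex `a`
(to be used for `A ∈ T` and `a` not a vertex of `T`): the faces `σ ⊇ A` are removed and replaced
by the cone with apex `a` over the faces of the star of `A` that do not contain `A`. -/
def starring (T : Cx) (A : Finset ℕ) (a : ℕ) : Cx where
  faces := {σ | σ.Nonempty ∧ ¬ A ⊆ σ.erase a ∧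
    ((a ∉ σ ∧ σ ∈ T.faces) ∨ (a ∈ σ ∧ σ.erase a ∪ A ∈ T.faces))}
  isRelLowerSet_faces := by
    rintro σ ⟨hσ, hA, h⟩
    refine ⟨hσ, fun τ hτ hn => ⟨hn, fun hs => hA (hs.trans (Finset.erase_subset_erase a hτ)), ?_⟩⟩
    rcases h with ⟨ha, hT⟩ | ⟨ha, hT⟩
    · exact Or.inl ⟨fun h => ha (hτ h), (T.isRelLowerSet_faces hT).2 hτ hn⟩
    · by_cases hb : a ∈ τ
      · refine Or.inr ⟨hb, (T.isRelLowerSet_faces hT).2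
          (Finset.union_subset_union (Finset.erase_subset_erase a hτ) subset_rfl) ?_⟩
        have hAne : A.Nonempty := by
          rw [Finset.nonempty_iff_ne_empty]
          rintro rfl
          exact hA (Finset.empty_subset _)
        exact hAne.mono Finset.subset_union_right
      · refine Or.inl ⟨hb, (T.isRelLowerSet_faces hT).2 ?_ hn⟩
        intro x hx
        exact Finset.mem_union_left _
          (Finset.mem_erase.2 ⟨fun h => hb (h ▸ hx), hτ hx⟩)

/-- `T'` is a stellar subdivision of `T` at one face. (Subdividing at a vertex renames it.) -/
def IsStarring (T T' : Cx) : Prop :=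
  ∃ A ∈ T.faces, ∃ a : ℕ, {a} ∉ T.faces ∧ T' = starring T A a

/-- Stellar equivalence, i.e. PL homeomorphism of finite complexes. -/
def StellarEquiv : Cx → Cx → Prop := Relation.EqvGen IsStarring

/-- Combinatorial `n`-spheres: complexes PL homeomorphic to the boundary of an `(n+1)`-simplex
in which all vertex links are combinatorial spheres. -/
def IsSphere : ℕ → Cx → Prop
  | 0, T => StellarEquiv T (simplexBoundary 0)
  | n + 1, T => StellarEquiv T (simplexBoundary (n + 1)) ∧ ∀ v, {v} ∈ T.faces → IsSphere n (link T v)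

/-- Combinatorial `n`-balls: complexes PL homeomorphic to the `n`-simplex in which
all vertex links are combinatorial spheres or balls. -/
def IsBall : ℕ → Cx → Prop
  | 0, T => StellarEquiv T (simplex 0)
  | n + 1, T => StellarEquiv T (simplex (n + 1)) ∧
      ∀ v, {v} ∈ T.faces → IsSphere n (link T v) ∨ IsBall n (link T v)

/-- The boundary of an `n`-dimensional complex: generated by the `(n-1)`-simplices that lie in
exactly one `n`-simplex. -/
def boundaryCx (n : ℕ) (B : Cx) : Cx where
  faces := {σ | σ.Nonempty ∧ ∃ τ ∈ B.faces, σ ⊆ τ ∧ τ.card = n ∧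
    ∃! ρ, ρ ∈ B.faces ∧ ρ.card = n + 1 ∧ τ ⊆ ρ}
  isRelLowerSet_faces := by
    rintro σ ⟨hσ, τ, hτ, h, h'⟩
    exact ⟨hσ, fun _ hb hn => ⟨hn, τ, hτ, Finset.Subset.trans hb h, h'⟩⟩

/-- Connectedness, through edge paths. -/
def IsConnected (T : Cx) : Prop :=
  T.faces.Nonempty ∧ ∀ u v, {u} ∈ T.faces → {v} ∈ T.faces →
    Relation.ReflTransGen (fun x y => ({x, y} : Finset ℕ) ∈ T.faces) u v

/-! ### Simplicial chains and first homology -/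

/-- Functions with finite support on ordered `(k+1)`-tuples of vertices. Simplicial `k`-chains are
the alternating ones; the value at `z` is the coefficient of the oriented simplex `[z 0, …, z k]`. -/
abbrev Chain (k : ℕ) := (Fin (k + 1) → ℕ) →₀ ℤ

/-- The vertex set of a tuple. -/
def verts {k : ℕ} (z : Fin k → ℕ) : Finset ℕ := Finset.univ.image z

/-- The group of oriented simplicial `k`-chains of `T` with integer coefficients. -/
def chains (T : Cx) (k : ℕ) : Submodule ℤ (Chain k) where
  carrier := {c | (∀ z, c z ≠ 0 → Function.Injective z ∧ verts z ∈ T.faces) ∧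
    ∀ (π : Equiv.Perm (Fin (k + 1))) z, c (z ∘ π) = (Equiv.Perm.sign π : ℤ) * c z}
  zero_mem' := by simp
  add_mem' := by
    rintro c d ⟨hc, hc'⟩ ⟨hd, hd'⟩
    refine ⟨fun z hz => ?_, fun π z => ?_⟩
    · by_cases h : c z = 0
      · exact hd z (by simpa [h] using hz)
      · exact hc z h
    · simp only [Finsupp.add_apply, hc', hd', mul_add]
  smul_mem' := by
    rintro r c ⟨hc, hc'⟩
    refine ⟨fun z hz => hc z fun h => hz (by simp [h]), fun π z => ?_⟩
    simp only [Finsupp.smul_apply, hc', smul_eq_mul]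
    ring

/-- The boundary operator: `(∂ c) [x₁, …, xₖ]` is the sum over `w` of `c [w, x₁, …, xₖ]`. -/
def bd {k : ℕ} : Chain (k + 1) →ₗ[ℤ] Chain k :=
  Finsupp.lmapDomain ℤ ℤ (Fin.tail : (Fin (k + 2) → ℕ) → (Fin (k + 1) → ℕ))

/-- The subcomplex generated by the simplices with nonzero coefficient in `c`. -/
def supp {k : ℕ} (c : Chain k) : Cx where
  faces := {σ | σ.Nonempty ∧ ∃ z, c z ≠ 0 ∧ σ ⊆ verts z}
  isRelLowerSet_faces := by
    rintro σ ⟨hσ, z, hz, h⟩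
    exact ⟨hσ, fun _ hb hn => ⟨hn, z, hz, Finset.Subset.trans hb h⟩⟩

/-- Simplicial 1-cycles. -/
def cycles (F : Cx) : Submodule ℤ (Chain 1) := chains F 1 ⊓ LinearMap.ker (bd (k := 0))

/-- Simplicial 1-boundaries. -/
def boundaries (F : Cx) : Submodule ℤ (Chain 1) := (chains F 2).map (bd (k := 1))

/-- First simplicial homology with integer coefficients. -/
abbrev H1 (F : Cx) := cycles F ⧸ (boundaries F).submoduleOf (cycles F)

/-- The 1-cycles `a 0, …, a (n-1)` of `F` represent a basis of `H1 F`. -/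
def IsHomologyBasis (F : Cx) {n : ℕ} (a : Fin n → Chain 1) : Prop :=
  ∃ h : ∀ i, a i ∈ cycles F,
    LinearIndependent ℤ (fun i => (Submodule.Quotient.mk ⟨a i, h i⟩ : H1 F)) ∧
    Submodule.span ℤ (Set.range fun i => (Submodule.Quotient.mk ⟨a i, h i⟩ : H1 F)) = ⊤

open Classical in
/-- The chain map of the stellar subdivision at `A` with new vertex `a`: an oriented simplex that
contains `A` becomes the sum of the simplices obtained by replacing one vertex in `A` by `a`. -/
def sd (A : Finset ℕ) (a : ℕ) {k : ℕ} : Chain k →ₗ[ℤ] Chain k :=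
  Finsupp.linearCombination ℤ fun z : Fin (k + 1) → ℕ =>
    if A ⊆ verts z then
      ∑ i with z i ∈ A, Finsupp.single (Function.update z i a) (1 : ℤ)
    else Finsupp.single z 1

/-! ### Links and surfaces in a triangulated oriented 3-sphere -/

/-- An orientation of the triangulated closed 3-manifold `T`: a 3-cycle with coefficient `±1` at
every tetrahedron. -/
def IsFundamentalClass (T : Cx) (o : Chain 3) : Prop :=
  o ∈ chains T 3 ∧ bd o = 0 ∧
    ∀ z : Fin 4 → ℕ, Function.Injective z → verts z ∈ T.faces → o z = 1 ∨ o z = -1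

/-- Oriented knots: simplicial closed curves without self-intersections. -/
def IsKnot (T : Cx) (K : Chain 1) : Prop :=
  K ∈ chains T 1 ∧ bd K = 0 ∧ (∀ z, K z = 0 ∨ K z = 1 ∨ K z = -1) ∧ IsSphere 1 (supp K)

/-- `K ∪ L 0 ∪ … ∪ L (m-1)` is an oriented link with `m + 1` components. -/
def IsLink (T : Cx) {m : ℕ} (K : Chain 1) (L : Fin m → Chain 1) : Prop :=
  IsKnot T K ∧ (∀ i, IsKnot T (L i)) ∧ (∀ i, Disjoint (supp K) (supp (L i))) ∧
    ∀ i j, i ≠ j → Disjoint (supp (L i)) (supp (L j))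

/-- `f` is (the sum of the coherently oriented triangles of) a Seifert surface of the oriented
knot `K`: a compact connected oriented surface embedded in `T` with oriented boundary `K`. -/
def IsSeifertSurface (T : Cx) (K : Chain 1) (f : Chain 2) : Prop :=
  f ∈ chains T 2 ∧ bd f = K ∧ (∀ z, f z = 0 ∨ f z = 1 ∨ f z = -1) ∧ IsConnected (supp f) ∧
    ∀ v, {v} ∈ (supp f).faces → IsSphere 1 (link (supp f) v) ∨ IsBall 1 (link (supp f) v)

/-! ### Linking numbers and push-offs -/

/-- The 1-chain of the oriented edge from `v` to `u`. -/
def edge (v u : ℕ) : Chain 1 := Finsupp.single ![v, u] 1 - Finsupp.single ![u, v] 1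

/-- A simplicial path together with a parallel path transverse to the triangulation.

A state `(v, t)` consists of the current vertex `v` of the simplicial path and the tetrahedron
`t ∋ v` that contains the current point of the transverse path. In a step `turn` the transverse
path passes to an adjacent tetrahedron through a triangle that contains `v`; in a step `advance`
the simplicial path runs along an edge `{v, u}` of `t`, while the transverse path follows it inside
the open tetrahedron `t`. The two paths are homotopic inside the union of the open stars of the
visited vertices.

`Track T o c turnOK advOK s s' a n` says that there is such a pair from state `s` to state `s'`,
all of whose steps are permitted by `turnOK` and `advOK`, where `a` is the 1-chain of the simplicial
path and `n` is the intersection number of the 2-chain `c` with the transverse path: passing from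
`[w, x₀, x₁, x₂]` to the tetrahedron on the other side of `[x₀, x₁, x₂]` is in the direction of the
positive normal of `[x₀, x₁, x₂]` iff `[w, x₀, x₁, x₂]` is positively oriented. -/
inductive Track (T : Cx) (o : Chain 3) (c : Chain 2) (turnOK : ℕ → Finset ℕ → Prop)
    (advOK : ℕ → ℕ → Finset ℕ → Prop) :
    ℕ × Finset ℕ → ℕ × Finset ℕ → Chain 1 → ℤ → Prop
  | nil (v : ℕ) (t : Finset ℕ) (ht : t ∈ T.faces) (h4 : t.card = 4) (hv : v ∈ t) :
      Track T o c turnOK advOK (v, t) (v, t) 0 0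
  | turn (s : ℕ × Finset ℕ) (v w w' : ℕ) (x : Fin 3 → ℕ) (a : Chain 1) (n : ℤ)
      (h : Track T o c turnOK advOK s (v, insert w (verts x)) a n)
      (hw : w ∉ verts x) (hw' : w' ∉ verts x) (hne : w ≠ w') (hx : Function.Injective x)
      (hT : insert w' (verts x) ∈ T.faces) (hv : v ∈ verts x) (hok : turnOK v (verts x)) :
      Track T o c turnOK advOK s (v, insert w' (verts x)) a (n + o (Fin.cons w x) * c x)
  | advance (s : ℕ × Finset ℕ) (v u : ℕ) (t : Finset ℕ) (a : Chain 1) (n : ℤ)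
      (h : Track T o c turnOK advOK s (v, t) a n) (hu : u ∈ t) (hne : u ≠ v)
      (hok : advOK v u t) :
      Track T o c turnOK advOK s (u, t) (a + edge v u) n

/-- `n` is the linking number of the disjoint 1-cycles `x` and `y` in the sphere `T` oriented
by `o`: the intersection number of a 2-chain with boundary `x` and a closed transverse curve which
is parallel to `y` (hence homotopic to `y` in the complement of `x`). -/
def IsLinkingNumber (T : Cx) (o : Chain 3) (x y : Chain 1) (n : ℤ) : Prop :=
  ∃ c ∈ chains T 2, bd c = x ∧ ∃ s,
    Track T o c (fun v _ => {v} ∉ (supp x).faces)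
      (fun v u _ => {v} ∉ (supp x).faces ∧ {u} ∉ (supp x).faces) s s y n

/-- The tetrahedron `t ⊇ e` lies on the positive side of the oriented surface `f` along the edge
`e`: one can go from `t` to a tetrahedron on the positive side of a triangle of the surface by
rotating around `e` without crossing the surface. -/
inductive OnPositiveSide (T : Cx) (o : Chain 3) (f : Chain 2) (e : Finset ℕ) : Finset ℕ → Prop
  | base (w : ℕ) (x : Fin 3 → ℕ) (hx : e ⊆ verts x) (hw : o (Fin.cons w x) * f x = -1) :
      OnPositiveSide T o f e (insert w (verts x))
  | rotate (t t' : Finset ℕ) (h : OnPositiveSide T o f e t) (ht' : t' ∈ T.faces)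
      (h4 : t'.card = 4) (h3 : (t ∩ t').card = 3) (he : e ⊆ t ∩ t')
      (hf : t ∩ t' ∉ (supp f).faces) :
      OnPositiveSide T o f e t'

/-- `n = lk(a⁺, b)`, where `a` and `b` are 1-cycles of the oriented surface `f` and `a⁺` is obtained
by pushing `a` off the surface in the positive normal direction: `n` is the intersection number of
a 2-chain with boundary `b` and a closed transverse curve which does not meet the surface and runs
parallel to `a` on the positive side. -/
def IsPushoffLinkingNumber (T : Cx) (o : Chain 3) (f : Chain 2) (a b : Chain 1) (n : ℤ) : Prop :=
  ∃ c ∈ chains T 2, bd c = b ∧ ∃ s,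
    Track T o c (fun _ σ => σ ∉ (supp f).faces)
      (fun v u t => {v, u} ∈ (supp f).faces ∧ OnPositiveSide T o f {v, u} t) s s a n

/-- `M` is the Seifert matrix `lk(a_i⁺, a_j)` of the surface `f` with respect to `a`. -/
def IsSeifertMatrix (T : Cx) (o : Chain 3) (f : Chain 2) {n : ℕ} (a : Fin n → Chain 1)
    (M : Matrix (Fin n) (Fin n) ℤ) : Prop :=
  ∀ i j, IsPushoffLinkingNumber T o f (a i) (a j) (M i j)

/-- `V` is the vector `(lk(x, a_1), …, lk(x, a_n))`. -/
def IsLinkingVector (T : Cx) (o : Chain 3) (x : Chain 1) {n : ℕ} (a : Fin n → Chain 1)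
    (V : Fin n → ℤ) : Prop :=
  ∀ i, IsLinkingNumber T o x (a i) (V i)

/-! ### S-equivalence -/

open Classical in
/-- The Seifert surface `g` arises from the Seifert surface `f` of `K` by replacing the part `D` of
`f` in the boundary sphere of the 3-ball `B` by the complementary part of this sphere. The ball
meets the surface `f` exactly in `D`, and lies in the complement of `x` and `y`. -/
def IsBallMove (T : Cx) (o : Chain 3) (K x y : Chain 1) (B D : Cx) (f g : Chain 2) : Prop :=
  IsSeifertSurface T K f ∧ IsSeifertSurface T K g ∧
  Disjoint (supp f) (supp x) ∧ Disjoint (supp f) (supp y) ∧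
  B ≤ T ∧ IsBall 3 B ∧ IsSphere 2 (boundaryCx 3 B) ∧ Disjoint B (supp x) ∧ Disjoint B (supp y) ∧
  supp f ⊓ B = D ∧ D ≤ boundaryCx 3 B ∧
  ∃ ε : ℤ, (ε = 1 ∨ ε = -1) ∧ g = f + ε • bd (Finsupp.filter (fun z => verts z ∈ B.faces) o)

/-- Elementary ambient isotopy: a disc `D` in the surface is pushed across a 3-ball. -/
def IsIsotopyMove (T : Cx) (o : Chain 3) (K x y : Chain 1) (f g : Chain 2) : Prop :=
  ∃ B D, IsBall 2 D ∧ IsBallMove T o K x y B D f g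

/-- Attaching a hollow orientable 1-handle: two disjoint discs `D₁`, `D₂` in the surface,
which are the ends of a solid cylinder `B`, are replaced by the lateral annulus of the cylinder. -/
def IsHandleMove (T : Cx) (o : Chain 3) (K x y : Chain 1) (f g : Chain 2) : Prop :=
  ∃ B D₁ D₂, IsBall 2 D₁ ∧ IsBall 2 D₂ ∧ Disjoint D₁ D₂ ∧
    IsBallMove T o K x y B (D₁ ⊔ D₂) f g

/-- S-equivalence rel. `x ∪ y` of Seifert surfaces of `K`: the equivalence relation generated by
ambient isotopies and by attaching (and, by symmetry, deleting) hollow 1-handles in the complement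
of `x ∪ y`, where the triangulation may be subdivided at any stage. -/
inductive SEquivalent : Cx → Chain 3 → Chain 1 → Chain 1 → Chain 1 → Chain 2 → Chain 2 → Prop
  | refl (T : Cx) (o : Chain 3) (K x y : Chain 1) (f : Chain 2) (hf : IsSeifertSurface T K f) :
      SEquivalent T o K x y f f
  | isotopy (T : Cx) (o : Chain 3) (K x y : Chain 1) (f g : Chain 2)
      (h : IsIsotopyMove T o K x y f g) : SEquivalent T o K x y f g
  | handle (T : Cx) (o : Chain 3) (K x y : Chain 1) (f g : Chain 2)
      (h : IsHandleMove T o K x y f g) : SEquivalent T o K x y f g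
  | symm (T : Cx) (o : Chain 3) (K x y : Chain 1) (f g : Chain 2)
      (h : SEquivalent T o K x y f g) : SEquivalent T o K x y g f
  | trans (T : Cx) (o : Chain 3) (K x y : Chain 1) (f g h : Chain 2)
      (h₁ : SEquivalent T o K x y f g) (h₂ : SEquivalent T o K x y g h) :
      SEquivalent T o K x y f h
  | subdivide (T : Cx) (o : Chain 3) (K x y : Chain 1) (f g : Chain 2) (A : Finset ℕ) (a : ℕ)
      (hf : IsSeifertSurface T K f) (hg : IsSeifertSurface T K g)
      (hA : A ∈ T.faces) (ha : {a} ∉ T.faces)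
      (h : SEquivalent (starring T A a) (sd A a o) (sd A a K) (sd A a x) (sd A a y)
        (sd A a f) (sd A a g)) : SEquivalent T o K x y f g

/-! ### The invariants -/

section Invariants

variable {n : ℕ} (M : Matrix (Fin n) (Fin n) ℤ) (V W : Fin n → ℤ)

/-- The Alexander polynomial `det (t M - Mᵀ)` of a knot with Seifert matrix `M`
(well defined up to units of `ℤ[t, t⁻¹]`). -/
def alexander : Polynomial ℤ :=
  ((Polynomial.X : Polynomial ℤ) • M.map Polynomial.C - (M.map Polynomial.C)ᵀ).det

/-- `(1 - ω̄) M + (1 - ω) Mᵀ`. -/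
def GOmega (ω : ℂ) : Matrix (Fin n) (Fin n) ℂ :=
  (1 - starRingEnd ℂ ω) • M.map (Int.cast : ℤ → ℂ) + (1 - ω) • (M.map (Int.cast : ℤ → ℂ))ᵀ

/-- `V G_ω⁻¹ Wᵀ`. -/
def lambdaOmega (ω : ℂ) : ℂ :=
  (fun i => (V i : ℂ)) ⬝ᵥ ((GOmega M ω)⁻¹ *ᵥ fun i => (W i : ℂ))

/-- `t M - Mᵀ` over the field of rational functions in `t`. -/
def GT : Matrix (Fin n) (Fin n) (RatFunc ℚ) :=
  (RatFunc.X : RatFunc ℚ) • M.map (Int.cast : ℤ → RatFunc ℚ) - (M.map (Int.cast : ℤ → RatFunc ℚ))ᵀ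

/-- `V G(t)⁻¹ Wᵀ`. -/
def lambdaT : RatFunc ℚ :=
  (fun i => (V i : RatFunc ℚ)) ⬝ᵥ ((GT M)⁻¹ *ᵥ fun i => (W i : RatFunc ℚ))

/-- The block tridiagonal matrix with `p - 1` diagonal blocks `M + Mᵀ`, blocks `-Mᵀ` above and
`-M` below the diagonal. -/
def MP (p : ℕ) : Matrix (Fin (p - 1) × Fin n) (Fin (p - 1) × Fin n) ℚ :=
  fun r s =>
    if r.1 = s.1 then (M r.2 s.2 : ℚ) + (M s.2 r.2 : ℚ)
    else if (s.1 : ℕ) = r.1 + 1 then -(M s.2 r.2 : ℚ)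
    else if (r.1 : ℕ) = s.1 + 1 then -(M r.2 s.2 : ℚ)
    else 0

/-- The vector whose `k`-th block is `V` and whose other blocks vanish. -/
def VP (p : ℕ) (k : Fin (p - 1)) : Fin (p - 1) × Fin n → ℚ :=
  fun r => if r.1 = k then (V r.2 : ℚ) else 0

/-- `V_p^k M_p⁻¹ (W_p^l)ᵀ`; the blocks are numbered from `0` to `p - 2`. -/
def lambdaP (p : ℕ) (k l : Fin (p - 1)) : ℚ :=
  VP V p k ⬝ᵥ ((MP M p)⁻¹ *ᵥ VP W p l)

end Invariants

end PLKnot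

end

/-! Write x and y for the two link components, V and W for two linking vectors, and o for the
fundamental class. Of the S-equivalence only one consequence is used, `SEquivalent.exists_chain`: F'
= F + ∂D for a 3-chain D none of whose tetrahedra touches x or y. The rest is linking theory with
twisted coefficients in the complement of K, where F and F' are two choices of cut.

Let E be a torsion-free abelian group with an automorphism τ for which τ - 1 is bijective. Consider
2-chains with coefficients in E that are multiplied by τ when F is crossed and that have boundary ε
x. Cut open along F, such a chain is an ordinary 2-chain with boundary ε x + ∑ (τ - 1)(b_i) a_i, up
to boundaries in F. The condition that its two sides match along F is the linear system ∑_j (M_ij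
τ(b_j) - M_ji b_j) = -V_i ε, because lk(a_i⁺, a_j) = M_ij and lk(a_i⁻, a_j) = M_ji. These two
directions are `exists_twisted` and `IsTwisted.exists_solution`; bijectivity of τ - 1 allows
division by τ - 1 in both.

Write D = e · o with an integer function e on tetrahedra. Passing from F to F' is the change of
gauge by τ^e (`IsTwisted.gauge`). As e vanishes near x and y, neither the boundary ε x nor the
linking with the other component changes. Hence a solution b for F yields a solution b' for F' with
∑ W_i b_i = ∑ W'_i b'_i (`exists_solution_of_gauge`), and triviality of the homogeneous solutions
passes from F to F' (`injective_of_gauge`). Both facts are collected in `Transfers`.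

The three invariants are three choices of (E, τ). For λ(t), E = ℚ(t) and τ is multiplication by t.
For λ(ω), E = ℂ and τ is multiplication by the conjugate of ω, since (1 - ω̄)M + (1 - ω)Mᵀ = (ω -
1)(ω̄M - Mᵀ). For λ^(k,l), E = ℚ^(p-1) and τ = -Δ⁻ᵀΔ with Δ = 1 - (lower shift), since M_p = Δ⊗M +
Δᵀ⊗Mᵀ = -Δᵀ(τM - Mᵀ).

All this is carried out simplicially. Near a vertex v a 2-chain is described by a local potential, a
function on tetrahedra whose jump across each triangle at v is the coefficient of the chain
(`exists_potential_of_closed`, `exists_potential`). Linking numbers become pairings of edge cycles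
with such potentials (`linkingNumber_eq`, `pushoffLinkingNumber_eq`), and lk(a⁻, b) = lk(b⁺, a)
becomes a summation by parts (`pairing_neg_eq_pairing_pos`). The topology enters through vanishing
homology of spheres, connectedness of links, and the two tetrahedra at each triangle; these come
from invariance under stellar moves (`ConeExchange`, `IsStarring.isPoints_iff`). -/

noncomputable section

namespace PLKnot

/-! ### Alternating functions on tuples -/

/-- Alternating finitely supported functions on tuples. -/
def IsAlt {k : ℕ} (c : Chain k) : Prop :=
  ∀ (π : Equiv.Perm (Fin (k + 1))) z, c (z ∘ π) = (Equiv.Perm.sign π : ℤ) * c z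

theorem isAlt_of_mem {T : Cx} {k : ℕ} {c : Chain k} (h : c ∈ chains T k) : IsAlt c := h.2

theorem mapDomain_comp_perm_apply {k : ℕ} (c : Chain k) (π : Equiv.Perm (Fin (k + 1)))
    (z : Fin (k + 1) → ℕ) : Finsupp.mapDomain (fun z => z ∘ π) c (z ∘ π) = c z := by
  have hinj : Function.Injective (fun z : Fin (k + 1) → ℕ => z ∘ π) :=
    fun x y h => π.surjective.injective_comp_right h
  exact Finsupp.mapDomain_apply hinj c z

theorem isAlt_iff_mapDomain {k : ℕ} {c : Chain k} :
    IsAlt c ↔ ∀ π : Equiv.Perm (Fin (k + 1)),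
      Finsupp.mapDomain (fun z => z ∘ π) c = (Equiv.Perm.sign π : ℤ) • c := by
  have hs : ∀ π : Equiv.Perm (Fin (k + 1)),
      (Equiv.Perm.sign π : ℤ) * (Equiv.Perm.sign π : ℤ) = 1 := fun π => by
    rcases Int.units_eq_one_or (Equiv.Perm.sign π) with h | h <;> simp [h]
  constructor
  · intro h π
    ext z
    obtain ⟨y, rfl⟩ : ∃ y, z = y ∘ π := ⟨z ∘ π.symm, by ext i; simp⟩
    rw [mapDomain_comp_perm_apply, Finsupp.smul_apply, h, smul_eq_mul, ← mul_assoc, hs, one_mul]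
  · intro h π z
    have h1 := mapDomain_comp_perm_apply c π z
    rw [h, Finsupp.smul_apply, smul_eq_mul] at h1
    rw [← h1, ← mul_assoc, hs, one_mul]

/-- Swapping two equal entries fixes the tuple and changes the sign. Degenerate tuples are thus
harmless, and identities of chains need only be checked on injective tuples. -/
theorem IsAlt.eq_zero_of_not_injective {k : ℕ} {c : Chain k} (h : IsAlt c)
    {z : Fin (k + 1) → ℕ} (hz : ¬ Function.Injective z) : c z = 0 := by
  simp only [Function.Injective, not_forall] at hz
  obtain ⟨i, j, hij, hne⟩ := hz
  have h1 := h (Equiv.swap i j) z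
  have h2 : z ∘ Equiv.swap i j = z := by
    ext l
    simp only [Function.comp, Equiv.swap_apply_def]
    split_ifs with h3 h4
    · rw [h3, hij]
    · rw [h4, hij]
    · rfl
  rw [h2, Equiv.Perm.sign_swap hne] at h1
  simp only [Units.val_neg, Units.val_one] at h1
  omega

theorem mem_chains_of_isAlt {T : Cx} {k : ℕ} {c : Chain k} (ha : IsAlt c)
    (h : ∀ z, Function.Injective z → c z ≠ 0 → verts z ∈ T.faces) : c ∈ chains T k := by
  refine ⟨fun z hz => ?_, ha⟩
  have hi : Function.Injective z := by
    by_contra hn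
    exact hz (ha.eq_zero_of_not_injective hn)
  exact ⟨hi, h z hi hz⟩

theorem IsAlt.ext {k : ℕ} {c d : Chain k} (hc : IsAlt c) (hd : IsAlt d)
    (h : ∀ z, Function.Injective z → c z = d z) : c = d := by
  ext z
  by_cases hz : Function.Injective z
  · exact h z hz
  · rw [hc.eq_zero_of_not_injective hz, hd.eq_zero_of_not_injective hz]

theorem chains_mono {T T' : Cx} {k : ℕ} (h : T.faces ⊆ T'.faces) : chains T k ≤ chains T' k :=
  fun _ hc => ⟨fun z hz => ⟨(hc.1 z hz).1, h (hc.1 z hz).2⟩, hc.2⟩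

theorem mem_chains_inf {T T' : Cx} {k : ℕ} {c : Chain k} (h : c ∈ chains T k)
    (h' : c ∈ chains T' k) : c ∈ chains (T ⊓ T') k :=
  ⟨fun z hz => ⟨(h.1 z hz).1, (h.1 z hz).2, (h'.1 z hz).2⟩, h.2⟩

theorem verts_comp_perm {k : ℕ} (z : Fin k → ℕ) (π : Equiv.Perm (Fin k)) :
    verts (z ∘ π) = verts z := by
  ext x
  simp only [verts, Finset.mem_image, Finset.mem_univ, true_and, Function.comp]
  exact π.surjective.exists (p := fun i => z i = x) |>.symm

/-! ### The boundary operator -/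

/-- The extension of a permutation by a new fixed first element. -/
def permCons {k : ℕ} (σ : Equiv.Perm (Fin k)) : Equiv.Perm (Fin (k + 1)) :=
  Equiv.Perm.decomposeFin.symm (0, σ)

theorem sign_permCons {k : ℕ} (σ : Equiv.Perm (Fin k)) :
    Equiv.Perm.sign (permCons σ) = Equiv.Perm.sign σ := by
  simp [permCons, Equiv.Perm.decomposeFin.symm_sign]

theorem permCons_zero {k : ℕ} (σ : Equiv.Perm (Fin k)) : permCons σ 0 = 0 := by
  simp [permCons]

theorem permCons_succ {k : ℕ} (σ : Equiv.Perm (Fin k)) (i : Fin k) :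
    permCons σ i.succ = (σ i).succ := by
  simp [permCons]

theorem cons_comp_permCons {k : ℕ} (v : ℕ) (x : Fin k → ℕ) (σ : Equiv.Perm (Fin k)) :
    (Fin.cons v x : Fin (k + 1) → ℕ) ∘ permCons σ = Fin.cons v (x ∘ σ) := by
  ext i
  refine Fin.cases ?_ (fun i => ?_) i
  · simp [permCons_zero]
  · simp [permCons_succ]

theorem exists_permCons {k : ℕ} (π : Equiv.Perm (Fin (k + 1))) (h : π 0 = 0) :
    ∃ σ, π = permCons σ := by
  refine ⟨(Equiv.Perm.decomposeFin π).2, ?_⟩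
  have : (Equiv.Perm.decomposeFin π).1 = 0 := by
    have h2 := Equiv.Perm.decomposeFin_symm_apply_zero (Equiv.Perm.decomposeFin π).1
      (Equiv.Perm.decomposeFin π).2
    rw [← h2, Prod.mk.eta, Equiv.symm_apply_apply, h]
  rw [permCons, ← this, Prod.mk.eta, Equiv.symm_apply_apply]

theorem IsAlt.bd {k : ℕ} {c : Chain (k + 1)} (hc : IsAlt c) : IsAlt (bd c) := by
  rw [isAlt_iff_mapDomain] at hc ⊢
  intro π
  have h := hc (permCons π)
  rw [sign_permCons] at h
  simp only [PLKnot.bd, Finsupp.lmapDomain_apply]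
  rw [← Finsupp.mapDomain_comp, ← Finsupp.mapDomain_smul, ← h, ← Finsupp.mapDomain_comp]
  congr 1

/-- The double boundary forgets the first two entries, so it does not notice their exchange, which
negates the chain. -/
theorem bd_bd {k : ℕ} {c : Chain (k + 2)} (hc : IsAlt c) : bd (bd c) = 0 := by
  rw [isAlt_iff_mapDomain] at hc
  have h := hc (Equiv.swap 0 1)
  have h2 : bd (bd (Finsupp.mapDomain (fun z => z ∘ (Equiv.swap 0 1 : Equiv.Perm (Fin (k+3)))) c))
      = bd (bd c) := by
    simp only [PLKnot.bd, Finsupp.lmapDomain_apply]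
    rw [← Finsupp.mapDomain_comp, ← Finsupp.mapDomain_comp, ← Finsupp.mapDomain_comp]
    congr 1
  rw [h, Equiv.Perm.sign_swap (by simp)] at h2
  simp only [Units.val_neg, Units.val_one, neg_smul, one_smul, map_neg] at h2
  exact self_eq_neg.1 h2.symm

theorem verts_tail_subset {k : ℕ} (z : Fin (k + 1) → ℕ) : verts (Fin.tail z) ⊆ verts z := by
  intro x
  simp only [verts, Finset.mem_image, Finset.mem_univ, true_and]
  rintro ⟨i, rfl⟩
  exact ⟨i.succ, rfl⟩

theorem verts_nonempty {k : ℕ} (z : Fin (k + 1) → ℕ) : (verts z).Nonempty :=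
  ⟨z 0, Finset.mem_image_of_mem _ (Finset.mem_univ _)⟩

theorem bd_mem {T : Cx} {k : ℕ} {c : Chain (k + 1)} (hc : c ∈ chains T (k + 1)) :
    bd c ∈ chains T k := by
  refine mem_chains_of_isAlt (isAlt_of_mem hc).bd fun z _ hz => ?_
  have h1 : z ∈ (Finsupp.mapDomain Fin.tail c).support := Finsupp.mem_support_iff.2 hz
  obtain ⟨y, hy, rfl⟩ := Finset.mem_image.1 (Finsupp.mapDomain_support h1)
  exact (T.isRelLowerSet_faces (hc.1 y (Finsupp.mem_support_iff.1 hy)).2).2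
    (verts_tail_subset y) (verts_nonempty _)

theorem sum_bd_zero {c : Chain 1} (hc : IsAlt c) : (bd c).sum (fun _ n => n) = 0 := by
  have h := (isAlt_iff_mapDomain.1 hc) (Equiv.swap 0 1)
  have h1 : (bd c).sum (fun _ n => n) = c.sum (fun _ n => n) := by
    simp only [PLKnot.bd, Finsupp.lmapDomain_apply]
    exact Finsupp.sum_mapDomain_index_addMonoidHom (fun _ => AddMonoidHom.id ℤ)
  have h2 : (Finsupp.mapDomain (fun z => z ∘ (Equiv.swap 0 1 : Equiv.Perm (Fin 2))) c).sum
      (fun _ n => n) = c.sum (fun _ n => n) :=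
    Finsupp.sum_mapDomain_index_addMonoidHom (fun _ => AddMonoidHom.id ℤ)
  rw [h, Equiv.Perm.sign_swap (by simp)] at h2
  simp only [Units.val_neg, Units.val_one, neg_smul, one_smul] at h2
  have h3 : (-c).sum (fun _ n => n) = -c.sum (fun _ n => n) := by
    rw [Finsupp.sum_neg_index (by simp)]
    exact Finset.sum_neg_distrib _
  rw [h3] at h2
  omega

/-! ### Cones -/

/-- The cone with apex `v`. -/
def cone (v : ℕ) {k : ℕ} (c : Chain k) : Chain (k + 1) :=
  ∑ i : Fin (k + 2), (-1 : ℤ) ^ (i : ℕ) •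
    Finsupp.mapDomain (fun x => (i.insertNth v x : Fin (k + 2) → ℕ)) c

theorem IsAlt.cone {k : ℕ} {c : Chain k} (hc : IsAlt c) (v : ℕ) : IsAlt (cone v c) := by
  rw [isAlt_iff_mapDomain] at hc ⊢
  intro π
  have hterm : ∀ i : Fin (k + 2),
      Finsupp.mapDomain (fun z => z ∘ π)
        ((-1 : ℤ) ^ (i : ℕ) • Finsupp.mapDomain (fun x => (i.insertNth v x : Fin (k + 2) → ℕ)) c) =
      (Equiv.Perm.sign π : ℤ) • ((-1 : ℤ) ^ ((π.symm i : Fin (k + 2)) : ℕ) •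
        Finsupp.mapDomain (fun x => ((π.symm i).insertNth v x : Fin (k + 2) → ℕ)) c) := by
    intro i
    -- Moving the apex to the front on both sides turns π into a permutation fixing 0; σ is its
    -- action on the remaining positions. The signs of the two cycles are the signs in the
    -- definition of the cone.
    obtain ⟨σ, hσ⟩ := exists_permCons ((π.symm i).cycleRange.symm.trans (π.trans i.cycleRange))
      (by simp [Fin.cycleRange_symm_zero])
    have hσ' : i.cycleRange * π = permCons σ * (π.symm i).cycleRange := by
      rw [← hσ]; ext j; simp
    have hsgn : (-1 : ℤ) ^ (i : ℕ) * (Equiv.Perm.sign π : ℤ) =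
        (Equiv.Perm.sign σ : ℤ) * (-1) ^ ((π.symm i : Fin (k + 2)) : ℕ) := by
      have := congrArg (fun p => ((Equiv.Perm.sign p : ℤˣ) : ℤ)) hσ'
      simpa [sign_permCons, Fin.sign_cycleRange] using this
    have hfun : (fun x : Fin (k + 1) → ℕ => (i.insertNth v x : Fin (k + 2) → ℕ) ∘ π) =
        fun x => (π.symm i).insertNth v (x ∘ σ) := by
      funext x
      rw [← Fin.cons_comp_cycleRange, ← Fin.cons_comp_cycleRange, ← cons_comp_permCons]
      ext j
      have := congrArg (fun p : Equiv.Perm (Fin (k + 2)) => p j) hσ'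
      simp only [Equiv.Perm.mul_apply] at this
      simp only [Function.comp, this]
    rw [Finsupp.mapDomain_smul, ← Finsupp.mapDomain_comp]
    have : (fun z : Fin (k + 2) → ℕ => z ∘ π) ∘ (fun x => i.insertNth v x) =
        (fun x => (π.symm i).insertNth v x) ∘ (fun x : Fin (k + 1) → ℕ => x ∘ σ) := hfun
    rw [this, Finsupp.mapDomain_comp, hc, Finsupp.mapDomain_smul, smul_smul, smul_smul]
    congr 1
    have hs : (Equiv.Perm.sign σ : ℤ) * (Equiv.Perm.sign σ : ℤ) = 1 := by
      rcases Int.units_eq_one_or (Equiv.Perm.sign σ) with h | h <;> simp [h]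
    have hp : (Equiv.Perm.sign π : ℤ) * (Equiv.Perm.sign π : ℤ) = 1 := by
      rcases Int.units_eq_one_or (Equiv.Perm.sign π) with h | h <;> simp [h]
    calc (-1 : ℤ) ^ (i : ℕ) * (Equiv.Perm.sign σ : ℤ)
        = ((-1 : ℤ) ^ (i : ℕ) * (Equiv.Perm.sign π : ℤ)) *
          ((Equiv.Perm.sign π : ℤ) * (Equiv.Perm.sign σ : ℤ)) := by
          linear_combination (-(-1 : ℤ) ^ (i : ℕ) * (Equiv.Perm.sign σ : ℤ)) * hp
      _ = _ := by
          rw [hsgn]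
          linear_combination
            (-1 : ℤ) ^ ((π.symm i : Fin (k + 2)) : ℕ) * (Equiv.Perm.sign π : ℤ) * hs
  unfold PLKnot.cone
  rw [Finsupp.mapDomain_finsetSum, Finset.smul_sum, Finset.sum_congr rfl fun i _ => hterm i]
  exact Equiv.sum_comp π.symm (fun i : Fin (k + 2) => (Equiv.Perm.sign π : ℤ) •
    ((-1 : ℤ) ^ (i : ℕ) • Finsupp.mapDomain (fun x => (i.insertNth v x : Fin (k + 2) → ℕ)) c))

theorem cone_apply_ne_zero {v : ℕ} {k : ℕ} {c : Chain k} {z : Fin (k + 2) → ℕ}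
    (h : cone v c z ≠ 0) : ∃ i x, c x ≠ 0 ∧ z = (i : Fin (k + 2)).insertNth v x := by
  by_contra hn
  push Not at hn
  apply h
  unfold cone
  rw [Finsupp.finsetSum_apply]
  refine Finset.sum_eq_zero fun i _ => ?_
  rw [Finsupp.smul_apply]
  have : Finsupp.mapDomain (fun x => (i.insertNth v x : Fin (k + 2) → ℕ)) c z = 0 := by
    by_contra h2
    obtain ⟨y, hy, rfl⟩ := Finset.mem_image.1
      (Finsupp.mapDomain_support (Finsupp.mem_support_iff.2 h2))
    exact hn i y (Finsupp.mem_support_iff.1 hy) rfl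
  rw [this, smul_zero]

theorem verts_insertNth {k : ℕ} (i : Fin (k + 1)) (v : ℕ) (x : Fin k → ℕ) :
    verts (i.insertNth v x : Fin (k + 1) → ℕ) = insert v (verts x) := by
  ext y
  simp only [verts, Finset.mem_image, Finset.mem_univ, true_and, Finset.mem_insert]
  constructor
  · rintro ⟨j, rfl⟩
    rcases Fin.eq_self_or_eq_succAbove i j with rfl | ⟨l, rfl⟩
    · left; simp
    · right; exact ⟨l, by simp⟩
  · rintro (rfl | ⟨l, rfl⟩)
    · exact ⟨i, by simp⟩
    · exact ⟨i.succAbove l, by simp⟩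

theorem cone_mem {T T' : Cx} {k : ℕ} {c : Chain k} {v : ℕ} (hc : c ∈ chains T k)
    (h : ∀ σ ∈ T.faces, σ.card = k + 1 → v ∉ σ → insert v σ ∈ T'.faces) :
    cone v c ∈ chains T' (k + 1) := by
  refine mem_chains_of_isAlt ((isAlt_of_mem hc).cone v) fun z hi hz => ?_
  obtain ⟨i, x, hx, rfl⟩ := cone_apply_ne_zero hz
  rw [verts_insertNth]
  have hx' := hc.1 x hx
  refine h _ hx'.2 ?_ ?_
  · rw [verts, Finset.card_image_of_injective _ hx'.1]; simp
  · intro hv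
    obtain ⟨j, -, hj⟩ := Finset.mem_image.1 hv
    have : i.succAbove j = i := hi (by simp [hj])
    exact Fin.succAbove_ne i j this

/-- Dropping the first entry removes the apex from the summand of index 0 and leaves `c`. From the
others it removes the first entry of the base, and their position index falls by one, whence the
sign. -/
theorem bd_cone (v : ℕ) {k : ℕ} (c : Chain (k + 1)) : bd (cone v c) = c - cone v (bd c) := by
  unfold cone bd
  rw [map_sum, Fin.sum_univ_succ]
  simp only [Finsupp.lmapDomain_apply, Finsupp.mapDomain_smul, ← Finsupp.mapDomain_comp]
  rw [sub_eq_add_neg, ← Finset.sum_neg_distrib]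
  congr 1
  · simp only [Fin.val_zero, pow_zero, one_smul]
    convert Finsupp.mapDomain_id
    funext x i
    simp [Fin.insertNth_zero', Fin.tail]
  · refine Finset.sum_congr rfl fun i _ => ?_
    rw [Fin.val_succ, pow_succ]
    rw [mul_neg_one, neg_smul]
    congr 3
    funext x
    simp only [Function.comp]
    obtain ⟨w, y, rfl⟩ : ∃ w y, x = Fin.cons w y := ⟨x 0, Fin.tail x, (Fin.cons_self_tail x).symm⟩
    rw [Fin.insertNth_succ_cons, Fin.tail_cons, Fin.tail_cons]

/-- In degree zero the correction term collapses to the augmentation of `c` times the apex. -/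
theorem bd_cone_zero (v : ℕ) (c : Chain 0) (hc : c.sum (fun _ n => n) = 0) :
    bd (cone v c) = c := by
  unfold cone bd
  rw [map_sum, Fin.sum_univ_two]
  have h0 : (Fin.tail ∘ fun x : Fin 1 → ℕ => (Fin.insertNth 0 v x : Fin 2 → ℕ)) = id := by
    funext x i
    simp [Fin.insertNth_zero', Fin.tail]
  have h1 : (Fin.tail ∘ fun x : Fin 1 → ℕ => (Fin.insertNth 1 v x : Fin 2 → ℕ)) =
      fun _ => fun _ => v := by
    funext x i
    have : i = 0 := Subsingleton.elim _ _
    subst this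
    have h2 := Fin.insertNth_succ_cons 0 v (x 0) (Fin.tail x)
    rw [Fin.cons_self_tail] at h2
    simp only [Function.comp]
    change Fin.tail (Fin.insertNth (Fin.succ 0) v x : Fin 2 → ℕ) 0 = v
    rw [h2, Fin.tail_cons]
    simp
  simp only [map_smul, Finsupp.lmapDomain_apply, ← Finsupp.mapDomain_comp, h0, h1,
    Finsupp.mapDomain_id]
  have h3 : Finsupp.mapDomain (fun _ : Fin 1 → ℕ => fun _ : Fin 1 => v) c = 0 := by
    simp only [Finsupp.mapDomain]
    rw [← Finsupp.single_sum, hc, Finsupp.single_zero]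
  rw [h3]; simp

theorem face_mono {T : Cx} {σ τ : Finset ℕ} (h : σ ∈ T.faces) (hτ : τ ⊆ σ) (hn : τ.Nonempty) :
    τ ∈ T.faces := (T.isRelLowerSet_faces h).2 hτ hn

theorem face_nonempty {T : Cx} {σ : Finset ℕ} (h : σ ∈ T.faces) : σ.Nonempty :=
  (T.isRelLowerSet_faces h).1

theorem vertex_mem_face {T : Cx} {σ : Finset ℕ} (h : σ ∈ T.faces) {v : ℕ} (hv : v ∈ σ) :
    {v} ∈ T.faces := face_mono h (Finset.singleton_subset_iff.2 hv) (Finset.singleton_nonempty v)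

/-! ### Homology and connectedness of complexes which differ by the replacement of a cone -/

/-- The homology group in degree `k + 1` vanishes. -/
def HomologyVanishes (k : ℕ) (T : Cx) : Prop :=
  ∀ c ∈ chains T (k + 1), bd c = 0 → ∃ d ∈ chains T (k + 2), bd d = c

/-- `S` is a cone with apex `s`. -/
def IsCone (S : Cx) (s : ℕ) : Prop := {s} ∈ S.faces ∧ ∀ σ ∈ S.faces, insert s σ ∈ S.faces

theorem IsCone.exists_bd {S : Cx} {s : ℕ} (hS : IsCone S s) {k : ℕ} {c : Chain (k + 1)}
    (hc : c ∈ chains S (k + 1)) (h : bd c = 0) : ∃ d ∈ chains S (k + 2), bd d = c := by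
  refine ⟨cone s c, cone_mem hc fun σ hσ _ _ => hS.2 σ hσ, ?_⟩
  rw [bd_cone, h]
  simp [cone]

/-- Cones have vanishing reduced homology. Phrasing the hypothesis as being the boundary of some
chain, possibly outside the cone, treats degree zero (augmentation zero) and positive degrees
(cycle) together. -/
theorem IsCone.exists_bd_of_isBoundary {S : Cx} {s : ℕ} (hS : IsCone S s) {k : ℕ}
    {p : Chain (k + 1)} (hp : IsAlt p) (h : bd p ∈ chains S k) :
    ∃ d ∈ chains S (k + 1), bd d = bd p := by
  refine ⟨cone s (bd p), cone_mem h fun σ hσ _ _ => hS.2 σ hσ, ?_⟩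
  cases k with
  | zero => exact bd_cone_zero s _ (sum_bd_zero hp)
  | succ k =>
    rw [bd_cone, bd_bd hp]
    simp [cone]

open Classical in
theorem exists_split {T T₀ S : Cx} (h : T.faces ⊆ T₀.faces ∪ S.faces) {k : ℕ} {c : Chain k}
    (hc : c ∈ chains T k) : ∃ q ∈ chains T₀ k, ∃ p ∈ chains S k, c = q + p := by
  refine ⟨c.filter (fun z => verts z ∈ T₀.faces), ⟨fun z hz => ?_, fun π z => ?_⟩,
    c.filter (fun z => ¬ verts z ∈ T₀.faces), ⟨fun z hz => ?_, fun π z => ?_⟩,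
    (Finsupp.filter_add_filter_not c _).symm⟩
  · rw [Finsupp.filter_apply] at hz
    split_ifs at hz with hf
    · exact ⟨(hc.1 z hz).1, hf⟩
    · exact absurd rfl hz
  · simp only [Finsupp.filter_apply, verts_comp_perm]
    split_ifs
    · exact hc.2 π z
    · simp
  · rw [Finsupp.filter_apply] at hz
    split_ifs at hz with hf
    · exact absurd rfl hz
    · exact ⟨(hc.1 z hz).1, (h (hc.1 z hz).2).resolve_left hf⟩
  · simp only [Finsupp.filter_apply, verts_comp_perm]
    split_ifs
    · simp
    · exact hc.2 π z

/-- `T'` arises from `T` by replacing the cone `S` by the cone `S'`. -/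
structure ConeExchange (T₀ S S' T T' : Cx) (s s' : ℕ) : Prop where
  faces_eq : T.faces = T₀.faces ∪ S.faces
  faces_eq' : T'.faces = T₀.faces ∪ S'.faces
  inter_eq : T₀.faces ∩ S.faces = T₀.faces ∩ S'.faces
  isCone : IsCone S s
  isCone' : IsCone S' s'

theorem ConeExchange.symm {T₀ S S' T T' : Cx} {s s' : ℕ} (h : ConeExchange T₀ S S' T T' s s') :
    ConeExchange T₀ S' S T' T s' s :=
  ⟨h.faces_eq', h.faces_eq, h.inter_eq.symm, h.isCone', h.isCone⟩

/-- A Mayer–Vietoris argument by hand. A cycle q + p with q in the common part and p in the new cone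
is replaced by q + p' with p' in the old cone and the same boundary. A filling of it splits as d₀ +
d₁, and q - ∂d₀ lies in the part that both cones share with `T₀`. So p + (q - ∂d₀) is a cycle of the
new cone and can be filled there. -/
theorem ConeExchange.homologyVanishes {T₀ S S' T T' : Cx} {s s' : ℕ}
    (h : ConeExchange T₀ S S' T T' s s') {k : ℕ} (hT : HomologyVanishes k T) :
    HomologyVanishes k T' := by
  intro c hc hbc
  obtain ⟨q, hq, p, hp, rfl⟩ := exists_split h.faces_eq'.subset hc
  rw [map_add] at hbc
  have hpq : bd p = -bd q := eq_neg_of_add_eq_zero_right hbc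
  have h0T : T₀.faces ⊆ T.faces := h.faces_eq ▸ Set.subset_union_left
  have hST : S.faces ⊆ T.faces := h.faces_eq ▸ Set.subset_union_right
  have h0T' : T₀.faces ⊆ T'.faces := h.faces_eq' ▸ Set.subset_union_left
  have hST' : S'.faces ⊆ T'.faces := h.faces_eq' ▸ Set.subset_union_right
  have hpS : bd p ∈ chains S k := by
    have h1 : bd p ∈ chains (T₀ ⊓ S') k :=
      mem_chains_inf (by rw [hpq]; exact neg_mem (bd_mem hq)) (bd_mem hp)
    refine chains_mono (fun σ hσ => ?_) h1
    have : σ ∈ T₀.faces ∩ S.faces := h.inter_eq ▸ hσ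
    exact this.2
  obtain ⟨p', hp', hpp'⟩ := h.isCone.exists_bd_of_isBoundary (isAlt_of_mem hp) hpS
  obtain ⟨d, hd, hdq⟩ := hT (q + p') (add_mem (chains_mono h0T hq) (chains_mono hST hp'))
    (by rw [map_add, hpp', hpq, add_neg_cancel])
  obtain ⟨d₀, hd₀, d₁, hd₁, rfl⟩ := exists_split h.faces_eq.subset hd
  rw [map_add] at hdq
  have hl : q - bd d₀ ∈ chains S' (k + 1) := by
    have h1 : q - bd d₀ ∈ chains (T₀ ⊓ S) (k + 1) := by
      refine mem_chains_inf (sub_mem hq (bd_mem hd₀)) ?_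
      have : q - bd d₀ = bd d₁ - p' := by
        rw [sub_eq_sub_iff_add_eq_add, ← hdq]
        exact add_comm _ _
      rw [this]
      exact sub_mem (bd_mem hd₁) hp'
    refine chains_mono (fun σ hσ => ?_) h1
    have : σ ∈ T₀.faces ∩ S'.faces := h.inter_eq ▸ hσ
    exact this.2
  obtain ⟨d', hd', hbd'⟩ := h.isCone'.exists_bd (add_mem hp hl) (by
    rw [map_add, map_sub, bd_bd (isAlt_of_mem hd₀), sub_zero, hpq, neg_add_cancel])
  refine ⟨d₀ + d', add_mem (chains_mono h0T' hd₀) (chains_mono hST' hd'), ?_⟩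
  rw [map_add, hbd']
  abel

/-- A predicate on vertices which is preserved along edges holds at all vertices or at none. -/
def Conn (T : Cx) : Prop :=
  ∀ κ : ℕ → Prop, (∀ u v, ({u, v} : Finset ℕ) ∈ T.faces → κ u → κ v) →
    ∀ u v, {u} ∈ T.faces → {v} ∈ T.faces → κ u → κ v

theorem ConeExchange.conn {T₀ S S' T T' : Cx} {s s' : ℕ}
    (h : ConeExchange T₀ S S' T T' s s') (hT : Conn T) : Conn T' := by
  intro κ' hκ'
  have h0T : T₀.faces ⊆ T.faces := h.faces_eq ▸ Set.subset_union_left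
  have hST : S.faces ⊆ T.faces := h.faces_eq ▸ Set.subset_union_right
  have h0T' : T₀.faces ⊆ T'.faces := h.faces_eq' ▸ Set.subset_union_left
  have hST' : S'.faces ⊆ T'.faces := h.faces_eq' ▸ Set.subset_union_right
  have happ : ∀ u, {u} ∈ S'.faces → (κ' u ↔ κ' s') := by
    intro u hu
    have h1 := hST' (h.isCone'.2 _ hu)
    exact ⟨hκ' u s' (by rwa [Finset.pair_comm]), hκ' s' u h1⟩
  have happ₀ : ∀ u, {u} ∈ T₀.faces → {u} ∈ S.faces → (κ' u ↔ κ' s') := fun u hu hu' =>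
    happ u (h.inter_eq.subset ⟨hu, hu'⟩).2
  -- Vertices that exist only in the old cone receive the value at the new apex, which is the common
  -- value on the whole new cone.
  let κ : ℕ → Prop := fun u => ({u} ∈ T₀.faces ∧ κ' u) ∨ ({u} ∉ T₀.faces ∧ κ' s')
  have hκ0 : ∀ u, {u} ∈ T₀.faces → (κ u ↔ κ' u) := fun u hu => by simp [κ, hu]
  have hκS : ∀ u, {u} ∈ S.faces → (κ u ↔ κ' s') := fun u hu => by
    by_cases hu0 : {u} ∈ T₀.faces
    · rw [hκ0 u hu0, happ₀ u hu0 hu]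
    · simp [κ, hu0]
  have hκ : ∀ u v, ({u, v} : Finset ℕ) ∈ T.faces → κ u → κ v := by
    intro u v huv hu
    rw [h.faces_eq] at huv
    rcases huv with huv | huv
    · rw [hκ0 v (vertex_mem_face huv (by simp))]
      rw [hκ0 u (vertex_mem_face huv (by simp))] at hu
      exact hκ' u v (h0T' huv) hu
    · rw [hκS v (vertex_mem_face huv (by simp))]
      rwa [hκS u (vertex_mem_face huv (by simp))] at hu
  have key := hT κ hκ
  have hs := hST h.isCone.1
  have main : ∀ u, {u} ∈ T'.faces → (κ' u ↔ κ' s') := by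
    intro u hu
    rw [h.faces_eq'] at hu
    rcases hu with hu | hu
    · rw [← hκ0 u hu, ← hκS s h.isCone.1]
      exact ⟨key u s (h0T hu) hs, key s u hs (h0T hu)⟩
    · exact happ u hu
  intro u v hu hv huκ
  rwa [main v hv, ← main u hu]

/-- The unchanged part consists of the faces not containing `A`. The old cone is the closed star of
`A`, with any vertex of `A` as apex. The new one has apex `a` over the faces of that star not
containing `A`. -/
theorem exists_coneExchange {T T' : Cx} (h : IsStarring T T') :
    ∃ T₀ S S' s s', ConeExchange T₀ S S' T T' s s' := by
  obtain ⟨A, hA, a, ha, rfl⟩ := h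
  have haT : ∀ σ ∈ T.faces, a ∉ σ := fun σ hσ h => ha (vertex_mem_face hσ h)
  obtain ⟨s, hs⟩ := face_nonempty hA
  let T₀ : Cx :=
    { faces := {σ | σ ∈ T.faces ∧ ¬ A ⊆ σ}
      isRelLowerSet_faces := fun σ hσ => ⟨face_nonempty hσ.1, fun τ hτ hn =>
        ⟨face_mono hσ.1 hτ hn, fun hA' => hσ.2 (hA'.trans hτ)⟩⟩ }
  let S : Cx :=
    { faces := {σ | σ.Nonempty ∧ σ ∪ A ∈ T.faces}
      isRelLowerSet_faces := fun σ hσ => ⟨hσ.1, fun τ hτ hn =>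
        ⟨hn, face_mono hσ.2 (Finset.union_subset_union_left hτ)
          (hn.mono Finset.subset_union_left)⟩⟩ }
  let S' : Cx :=
    { faces := {σ | σ.Nonempty ∧ ¬ A ⊆ σ.erase a ∧ σ.erase a ∪ A ∈ T.faces}
      isRelLowerSet_faces := fun σ hσ => ⟨hσ.1, fun τ hτ hn =>
        ⟨hn, fun hA' => hσ.2.1 (hA'.trans (Finset.erase_subset_erase a hτ)),
          face_mono hσ.2.2 (Finset.union_subset_union_left (Finset.erase_subset_erase a hτ))
          ((face_nonempty hA).mono Finset.subset_union_right)⟩⟩ }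
  refine ⟨T₀, S, S', s, a, ?_, ?_, ?_, ⟨?_, ?_⟩, ⟨?_, ?_⟩⟩
  · ext σ
    constructor
    · intro hσ
      by_cases hAσ : A ⊆ σ
      · exact Or.inr ⟨face_nonempty hσ, by rwa [Finset.union_eq_left.2 hAσ]⟩
      · exact Or.inl ⟨hσ, hAσ⟩
    · rintro (hσ | hσ)
      · exact hσ.1
      · exact face_mono hσ.2 Finset.subset_union_left hσ.1
  · ext σ
    constructor
    · rintro ⟨hn, hAσ, ⟨haσ, hσ⟩ | ⟨haσ, hσ⟩⟩
      · exact Or.inl ⟨hσ, by rwa [Finset.erase_eq_of_notMem haσ] at hAσ⟩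
      · exact Or.inr ⟨hn, hAσ, hσ⟩
    · rintro (hσ | hσ)
      · exact ⟨face_nonempty hσ.1, by rw [Finset.erase_eq_of_notMem (haT σ hσ.1)]; exact hσ.2,
          Or.inl ⟨haT σ hσ.1, hσ.1⟩⟩
      · refine ⟨hσ.1, hσ.2.1, ?_⟩
        by_cases haσ : a ∈ σ
        · exact Or.inr ⟨haσ, hσ.2.2⟩
        · refine Or.inl ⟨haσ, face_mono hσ.2.2 ?_ hσ.1⟩
          rw [Finset.erase_eq_of_notMem haσ]
          exact Finset.subset_union_left
  · ext σ
    constructor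
    · rintro ⟨h1, h2⟩
      refine ⟨h1, h2.1, ?_⟩
      rw [Finset.erase_eq_of_notMem (haT σ h1.1)]
      exact ⟨h1.2, h2.2⟩
    · rintro ⟨h1, h2⟩
      refine ⟨h1, h2.1, ?_⟩
      have := h2.2.2
      rwa [Finset.erase_eq_of_notMem (haT σ h1.1)] at this
  · exact ⟨Finset.singleton_nonempty s,
      by rwa [Finset.union_eq_right.2 (Finset.singleton_subset_iff.2 hs)]⟩
  · intro σ hσ
    refine ⟨Finset.insert_nonempty _ _, ?_⟩
    rw [Finset.insert_union, Finset.insert_eq_of_mem (Finset.mem_union_right _ hs)]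
    exact hσ.2
  · refine ⟨Finset.singleton_nonempty a, ?_, ?_⟩
    · intro h
      have := h hs
      simp at this
    · have : ({a} : Finset ℕ).erase a = ∅ := by simp
      rw [this, Finset.empty_union]
      exact hA
  · intro σ hσ
    have : (insert a σ).erase a = σ.erase a := by
      ext x; simp
    refine ⟨Finset.insert_nonempty _ _, ?_, ?_⟩
    · rw [this]; exact hσ.2.1
    · rw [this]; exact hσ.2.2

theorem StellarEquiv.iff_of_invariant {P : Cx → Prop} (hP : ∀ T T', IsStarring T T' → (P T ↔ P T'))
    {T T' : Cx} (h : StellarEquiv T T') : P T ↔ P T' := by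
  induction h with
  | rel T T' h => exact hP T T' h
  | refl T => exact Iff.rfl
  | symm T T' _ ih => exact ih.symm
  | trans T T' T'' _ _ ih₁ ih₂ => exact ih₁.trans ih₂

theorem StellarEquiv.homologyVanishes_iff {k : ℕ} {T T' : Cx} (h : StellarEquiv T T') :
    HomologyVanishes k T ↔ HomologyVanishes k T' :=
  h.iff_of_invariant fun T T' h => by
    obtain ⟨_, _, _, _, _, h⟩ := exists_coneExchange h
    exact ⟨h.homologyVanishes, h.symm.homologyVanishes⟩

theorem StellarEquiv.conn_iff {T T' : Cx} (h : StellarEquiv T T') : Conn T ↔ Conn T' :=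
  h.iff_of_invariant fun T T' h => by
    obtain ⟨_, _, _, _, _, h⟩ := exists_coneExchange h
    exact ⟨h.conn, h.symm.conn⟩

theorem StellarEquiv.nonempty_iff {T T' : Cx} (h : StellarEquiv T T') :
    T.faces.Nonempty ↔ T'.faces.Nonempty :=
  h.iff_of_invariant (P := fun T => T.faces.Nonempty) fun T T' h => by
    obtain ⟨T₀, S, S', s, s', h⟩ := exists_coneExchange h
    exact ⟨fun _ => ⟨_, h.faces_eq'.symm.subset (Or.inr h.isCone'.1)⟩,
      fun _ => ⟨_, h.faces_eq.symm.subset (Or.inr h.isCone.1)⟩⟩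

/-! ### Zero-dimensional complexes -/

/-- The complex consists of `n` points. -/
def IsPoints (n : ℕ) (T : Cx) : Prop := (∀ σ ∈ T.faces, σ.card = 1) ∧ T.faces.ncard = n

theorem starring_singleton_faces {T : Cx} (hT : ∀ σ ∈ T.faces, σ.card = 1) {u a : ℕ}
    (hu : {u} ∈ T.faces) (ha : {a} ∉ T.faces) :
    (starring T {u} a).faces = insert {a} (T.faces \ {{u}}) := by
  have hau : a ≠ u := by rintro rfl; exact ha hu
  ext σ
  constructor
  · rintro ⟨hn, hA, ⟨haσ, hσ⟩ | ⟨haσ, hσ⟩⟩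
    · right
      refine ⟨hσ, ?_⟩
      rintro rfl
      rw [Finset.erase_eq_of_notMem haσ] at hA
      exact hA subset_rfl
    · left
      have h1 := hT _ hσ
      have h2 : u ∉ σ.erase a := by simpa using hA
      have h3 : (σ.erase a).card = 0 := by
        rw [Finset.card_union_of_disjoint (by simpa using h2)] at h1
        simpa using h1
      rw [Finset.card_eq_zero] at h3
      rw [← Finset.insert_erase haσ, h3]
      rfl
  · rintro (rfl | ⟨hσ, hne⟩)
    · exact ⟨Finset.singleton_nonempty a, by simp, Or.inr ⟨by simp, by simpa using hu⟩⟩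
    · obtain ⟨x, rfl⟩ := Finset.card_eq_one.1 (hT _ hσ)
      have hxa : x ≠ a := by rintro rfl; exact ha hσ
      have hxu : x ≠ u := by rintro rfl; exact hne rfl
      refine ⟨Finset.singleton_nonempty x, ?_, Or.inl ⟨by simpa using hxa.symm, hσ⟩⟩
      simp [hxu.symm]

/-- Starring at a vertex exchanges one point for another. For the converse one must see that `T` had
dimension zero: starring at a larger face would create an edge at `a`, and a larger face elsewhere
would survive with the same cardinality. -/
theorem IsStarring.isPoints_iff {n : ℕ} {T T' : Cx} (h : IsStarring T T') :
    IsPoints n T ↔ IsPoints n T' := by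
  obtain ⟨A, hA, a, ha, rfl⟩ := h
  have haT : ∀ σ ∈ T.faces, a ∉ σ := fun σ hσ h => ha (vertex_mem_face hσ h)
  have key : (∀ σ ∈ T.faces, σ.card = 1) → (IsPoints n T ↔ IsPoints n (starring T A a)) := by
    intro hT
    obtain ⟨u, rfl⟩ := Finset.card_eq_one.1 (hT A hA)
    have hf := starring_singleton_faces hT hA ha
    unfold IsPoints
    rw [hf, Set.ncard_exchange ha hA]
    refine ⟨fun h => ⟨?_, h.2⟩, fun h => ⟨hT, h.2⟩⟩
    rintro σ (rfl | hσ)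
    · simp
    · exact hT σ hσ.1
  refine ⟨fun h => (key h.1).1 h, fun h => ?_⟩
  suffices hT : ∀ σ ∈ T.faces, σ.card = 1 from (key hT).2 h
  have hA1 : A.card = 1 := by
    by_contra hA1
    obtain ⟨u, hu⟩ := face_nonempty hA
    have hau : a ≠ u := by rintro rfl; exact haT A hA hu
    have hmem : ({a, u} : Finset ℕ) ∈ (starring T A a).faces := by
      have he : ({a, u} : Finset ℕ).erase a = {u} := by
        ext x; simp only [Finset.mem_erase, Finset.mem_insert, Finset.mem_singleton]
        constructor
        · tauto
        · rintro rfl; exact ⟨hau.symm, Or.inr rfl⟩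
      refine ⟨Finset.insert_nonempty _ _, ?_, Or.inr ⟨by simp, ?_⟩⟩
      · rw [he]
        intro hAu
        exact hA1 (by rw [Finset.Subset.antisymm hAu (Finset.singleton_subset_iff.2 hu)]; simp)
      · rw [he, Finset.union_eq_right.2 (Finset.singleton_subset_iff.2 hu)]
        exact hA
    have := h.1 _ hmem
    rw [Finset.card_pair hau] at this
    omega
  obtain ⟨u, rfl⟩ := Finset.card_eq_one.1 hA1
  intro σ hσ
  have haσ := haT σ hσ
  by_cases huσ : u ∈ σ
  · have he : (insert a (σ.erase u)).erase a = σ.erase u :=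
      Finset.erase_insert fun h => haσ (Finset.mem_of_mem_erase h)
    have hm : insert a (σ.erase u) ∈ (starring T {u} a).faces := by
      refine ⟨Finset.insert_nonempty _ _, by rw [he]; simp, Or.inr ⟨by simp, ?_⟩⟩
      rw [he, Finset.union_comm, ← Finset.insert_eq, Finset.insert_erase huσ]
      exact hσ
    have := h.1 _ hm
    rw [Finset.card_insert_of_notMem fun h => haσ (Finset.mem_of_mem_erase h),
      Finset.card_erase_add_one huσ] at this
    exact this
  · refine h.1 _ ⟨face_nonempty hσ, ?_, Or.inl ⟨haσ, hσ⟩⟩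
    rw [Finset.erase_eq_of_notMem haσ]
    simpa using huσ

theorem StellarEquiv.isPoints_iff {n : ℕ} {T T' : Cx} (h : StellarEquiv T T') :
    IsPoints n T ↔ IsPoints n T' := h.iff_of_invariant fun _ _ h => h.isPoints_iff

/-! ### Combinatorial spheres and balls -/

/-- Below the top dimension, coning from the vertex 0 never produces the full simplex. -/
theorem homologyVanishes_simplexBoundary {k n : ℕ} (h : k + 1 < n) :
    HomologyVanishes k (simplexBoundary n) := by
  intro c hc hbc
  refine ⟨cone 0 c, cone_mem hc fun σ hσ h1 h2 => ⟨Finset.insert_nonempty _ _, ?_⟩, ?_⟩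
  · rw [Finset.ssubset_iff_subset_ne]
    refine ⟨Finset.insert_subset (by simp) hσ.2.subset, fun he => ?_⟩
    have := congrArg Finset.card he
    rw [Finset.card_insert_of_notMem h2, h1, Finset.card_range] at this
    omega
  · rw [bd_cone, hbc]; simp [cone]

theorem conn_simplexBoundary {n : ℕ} (h : 1 ≤ n) : Conn (simplexBoundary n) := by
  intro κ hκ u v hu hv
  refine hκ u v ⟨Finset.insert_nonempty _ _, ?_⟩
  rw [Finset.ssubset_iff_subset_ne]
  refine ⟨Finset.insert_subset (Finset.singleton_subset_iff.1 hu.2.subset) hv.2.subset,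
    fun he => ?_⟩
  have := congrArg Finset.card he
  rw [Finset.card_range] at this
  have h2 := Finset.card_le_two (a := u) (b := v)
  omega

theorem conn_simplex (n : ℕ) : Conn (simplex n) := fun _ hκ u v hu hv =>
  hκ u v ⟨Finset.insert_nonempty _ _,
    Finset.insert_subset (Finset.singleton_subset_iff.1 hu.2) hv.2⟩

theorem isPoints_simplexBoundary_zero : IsPoints 2 (simplexBoundary 0) := by
  have h : (simplexBoundary 0).faces = {{0}, {1}} := by
    ext σ
    constructor
    · rintro ⟨hn, hs⟩
      have hc := Finset.card_lt_card hs
      have hc' := hn.card_pos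
      rw [Finset.card_range] at hc
      obtain ⟨x, rfl⟩ := Finset.card_eq_one.1 (show σ.card = 1 by omega)
      have := Finset.mem_range.1 (Finset.singleton_subset_iff.1 hs.subset)
      have : x = 0 ∨ x = 1 := by omega
      rcases this with rfl | rfl <;> simp
    · rintro (rfl | rfl)
      · exact ⟨by simp, by decide⟩
      · exact ⟨by simp, by decide⟩
  refine ⟨?_, ?_⟩
  · rw [h]; rintro σ (rfl | rfl) <;> simp
  · rw [h, Set.ncard_pair (by simp)]

theorem isPoints_simplex_zero : IsPoints 1 (simplex 0) := by
  have h : (simplex 0).faces = {{0}} := by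
    ext σ
    constructor
    · rintro ⟨hn, hs⟩
      exact (Finset.subset_singleton_iff.1 (by simpa using hs)).resolve_left hn.ne_empty
    · rintro rfl
      exact ⟨by simp, by simp⟩
  refine ⟨?_, ?_⟩
  · rw [h]; rintro σ rfl; simp
  · rw [h, Set.ncard_singleton]

theorem IsSphere.stellarEquiv {n : ℕ} {T : Cx} (h : IsSphere n T) :
    StellarEquiv T (simplexBoundary n) := by
  cases n with
  | zero => exact h
  | succ n => exact h.1

theorem IsBall.stellarEquiv {n : ℕ} {T : Cx} (h : IsBall n T) :
    StellarEquiv T (simplex n) := by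
  cases n with
  | zero => exact h
  | succ n => exact h.1

theorem IsSphere.nonempty {n : ℕ} {T : Cx} (h : IsSphere n T) : T.faces.Nonempty :=
  h.stellarEquiv.nonempty_iff.2 ⟨{0}, by simp, by
    rw [Finset.ssubset_iff_subset_ne]
    refine ⟨by simp, fun he => ?_⟩
    have := congrArg Finset.card he
    simp at this⟩

theorem IsSphere.homologyVanishes {n k : ℕ} {T : Cx} (h : IsSphere n T) (hk : k + 1 < n) :
    HomologyVanishes k T :=
  h.stellarEquiv.homologyVanishes_iff.2 (homologyVanishes_simplexBoundary hk)

theorem IsSphere.conn {n : ℕ} {T : Cx} (h : IsSphere n T) (hn : 1 ≤ n) : Conn T :=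
  h.stellarEquiv.conn_iff.2 (conn_simplexBoundary hn)

theorem IsBall.conn {n : ℕ} {T : Cx} (h : IsBall n T) : Conn T :=
  h.stellarEquiv.conn_iff.2 (conn_simplex n)

theorem IsSphere.isPoints {T : Cx} (h : IsSphere 0 T) : IsPoints 2 T :=
  h.stellarEquiv.isPoints_iff.2 isPoints_simplexBoundary_zero

theorem IsBall.isPoints {T : Cx} (h : IsBall 0 T) : IsPoints 1 T :=
  h.stellarEquiv.isPoints_iff.2 isPoints_simplex_zero

/-! ### The chain map of a stellar subdivision and its left inverse -/

theorem mem_verts {k : ℕ} {z : Fin k → ℕ} {v : ℕ} : v ∈ verts z ↔ ∃ i, z i = v := by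
  simp [verts]

theorem verts_cons {k : ℕ} (v : ℕ) (x : Fin k → ℕ) :
    verts (Fin.cons v x : Fin (k + 1) → ℕ) = insert v (verts x) := by
  rw [← verts_insertNth 0, Fin.insertNth_zero']

theorem bd_apply {k : ℕ} (c : Chain (k + 1)) (x : Fin (k + 1) → ℕ) (S : Finset ℕ)
    (h : ∀ w, c (Fin.cons w x) ≠ 0 → w ∈ S) :
    bd c x = ∑ w ∈ S, c (Fin.cons w x) := by
  simp only [bd, Finsupp.lmapDomain_apply, Finsupp.mapDomain, Finsupp.sum_apply]
  rw [Finsupp.sum]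
  symm
  refine Finset.sum_bij_ne_zero (fun w _ _ => Fin.cons w x) ?_ ?_ ?_ ?_
  · intro w _ hw
    exact Finsupp.mem_support_iff.2 hw
  · intro w _ _ w' _ _ he
    simpa using congrFun he 0
  · intro z hz hne
    have ht : Fin.tail z = x := by
      by_contra hne'
      exact hne (Finsupp.single_eq_of_ne (Ne.symm hne'))
    refine ⟨z 0, h _ ?_, ?_, ?_⟩ <;> rw [← ht, Fin.cons_self_tail]
    · exact Finsupp.mem_support_iff.1 hz
    · exact Finsupp.mem_support_iff.1 hz
  · intro w _ hw
    rw [Fin.tail_cons, Finsupp.single_eq_same]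

open Classical in
theorem sd_apply (A : Finset ℕ) (a : ℕ) {k : ℕ} (c : Chain k) (z : Fin (k + 1) → ℕ) :
    sd A a c z = c.sum fun w n => n * (if A ⊆ verts w then
      ∑ i with w i ∈ A, Finsupp.single (Function.update w i a) (1 : ℤ) z
    else Finsupp.single w (1 : ℤ) z) := by
  rw [sd, Finsupp.linearCombination_apply, Finsupp.sum_apply]
  refine Finset.sum_congr rfl fun w _ => ?_
  dsimp only
  rw [Finsupp.smul_apply, smul_eq_mul]
  split_ifs
  · rw [Finsupp.finsetSum_apply]
  · rfl

theorem sd_apply_ne_zero {A : Finset ℕ} {a : ℕ} {k : ℕ} {c : Chain k} {z : Fin (k + 1) → ℕ}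
    (h : sd A a c z ≠ 0) : ∃ w, c w ≠ 0 ∧ ((¬ A ⊆ verts w ∧ z = w) ∨
      (A ⊆ verts w ∧ ∃ i, w i ∈ A ∧ z = Function.update w i a)) := by
  classical
  rw [sd_apply] at h
  obtain ⟨w, hw, hne⟩ := Finset.exists_ne_zero_of_sum_ne_zero h
  refine ⟨w, Finsupp.mem_support_iff.1 hw, ?_⟩
  have h2 := right_ne_zero_of_mul hne
  split_ifs at h2 with hA
  · obtain ⟨i, hi, hne⟩ := Finset.exists_ne_zero_of_sum_ne_zero h2
    refine Or.inr ⟨hA, i, (Finset.mem_filter.1 hi).2, ?_⟩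
    by_contra hz
    exact hne (Finsupp.single_eq_of_ne hz)
  · refine Or.inl ⟨hA, ?_⟩
    by_contra hz
    exact h2 (Finsupp.single_eq_of_ne hz)

open Classical in
theorem sd_comp_perm (A : Finset ℕ) (a : ℕ) {k : ℕ} (π : Equiv.Perm (Fin (k + 1))) (c : Chain k) :
    sd A a (Finsupp.mapDomain (fun z => z ∘ π) c) =
      Finsupp.mapDomain (fun z => z ∘ π) (sd A a c) := by
  induction c using Finsupp.induction_linear with
  | zero => simp
  | add c d hc hd => rw [Finsupp.mapDomain_add, map_add, map_add, Finsupp.mapDomain_add, hc, hd]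
  | single w n =>
    rw [Finsupp.mapDomain_single, sd, Finsupp.linearCombination_single,
      Finsupp.linearCombination_single, verts_comp_perm, Finsupp.mapDomain_smul]
    congr 1
    split_ifs
    · rw [Finsupp.mapDomain_finsetSum]
      refine Finset.sum_equiv π (by simp) fun i _ => ?_
      rw [Finsupp.mapDomain_single]
      congr 1
      ext j
      simp only [Function.comp, Function.update_apply, EmbeddingLike.apply_eq_iff_eq]
    · rw [Finsupp.mapDomain_single]

theorem IsAlt.sd {k : ℕ} {c : Chain k} (hc : IsAlt c) (A : Finset ℕ) (a : ℕ) :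
    IsAlt (sd A a c) := by
  rw [isAlt_iff_mapDomain] at hc ⊢
  intro π
  rw [← sd_comp_perm, hc, map_smul]

theorem verts_update {k : ℕ} {w : Fin k → ℕ} (hw : Function.Injective w) (i : Fin k) (a : ℕ) :
    verts (Function.update w i a) = insert a ((verts w).erase (w i)) := by
  ext x
  simp only [mem_verts, Finset.mem_insert, Finset.mem_erase]
  constructor
  · rintro ⟨j, rfl⟩
    by_cases h : j = i
    · subst h; simp
    · right
      rw [Function.update_of_ne h]
      exact ⟨fun he => h (hw he), j, rfl⟩
  · rintro (rfl | ⟨hne, j, rfl⟩)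
    · exact ⟨i, by simp⟩
    · refine ⟨j, Function.update_of_ne ?_ _ _⟩
      rintro rfl
      exact hne rfl

theorem sd_mem {T : Cx} {A : Finset ℕ} {a : ℕ} (ha : {a} ∉ T.faces) {k : ℕ}
    {c : Chain k} (hc : c ∈ chains T k) : sd A a c ∈ chains (starring T A a) k := by
  refine mem_chains_of_isAlt ((isAlt_of_mem hc).sd A a) fun z _ hz => ?_
  obtain ⟨w, hw, ⟨hA, rfl⟩ | ⟨hA, i, hi, rfl⟩⟩ := sd_apply_ne_zero hz
  · have hT := (hc.1 z hw).2
    have haz : a ∉ verts z := fun h => ha (vertex_mem_face hT h)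
    exact ⟨verts_nonempty z, by rwa [Finset.erase_eq_of_notMem haz], Or.inl ⟨haz, hT⟩⟩
  · have hT := (hc.1 w hw).2
    have haz : a ∉ verts w := fun h => ha (vertex_mem_face hT h)
    have he : (insert a ((verts w).erase (w i))).erase a = (verts w).erase (w i) :=
      Finset.erase_insert fun h => haz (Finset.mem_of_mem_erase h)
    refine ⟨verts_nonempty _, ?_, Or.inr ⟨?_, ?_⟩⟩
    · rw [verts_update (hc.1 w hw).1, he]
      exact fun h => Finset.notMem_erase _ _ (h hi)
    · rw [verts_update (hc.1 w hw).1]; simp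
    · rw [verts_update (hc.1 w hw).1, he]
      refine face_mono hT (Finset.union_subset (Finset.erase_subset _ _) hA) ?_
      exact ⟨w i, Finset.mem_union_right _ hi⟩

theorem sd_apply_of_not_subset {T : Cx} {A : Finset ℕ} {a : ℕ} (ha : {a} ∉ T.faces) {k : ℕ}
    {c : Chain k} (hc : c ∈ chains T k) {z : Fin (k + 1) → ℕ} (hz : c z ≠ 0)
    (hA : ¬ A ⊆ verts z) : sd A a c z = c z := by
  classical
  have haz : a ∉ verts z := fun h => ha (vertex_mem_face (hc.1 z hz).2 h)
  rw [sd_apply, Finsupp.sum, Finset.sum_eq_single z]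
  · simp [hA]
  · intro w _ hne
    split_ifs
    · rw [Finset.sum_eq_zero, mul_zero]
      intro i _
      refine Finsupp.single_eq_of_ne ?_
      rintro rfl
      exact haz (mem_verts.2 ⟨i, by simp⟩)
    · rw [Finsupp.single_eq_of_ne hne.symm, mul_zero]
  · intro h
    exact absurd (Finsupp.mem_support_iff.2 hz) h

theorem sd_apply_update {T : Cx} {A : Finset ℕ} {a : ℕ} (ha : {a} ∉ T.faces) {k : ℕ}
    {c : Chain k} (hc : c ∈ chains T k) {z : Fin (k + 1) → ℕ} (hz : c z ≠ 0)
    (hA : A ⊆ verts z) {i : Fin (k + 1)} (hi : z i ∈ A) :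
    sd A a c (Function.update z i a) = c z := by
  classical
  have hinj := (hc.1 z hz).1
  have hav : ∀ w, c w ≠ 0 → ∀ j, w j ≠ a := fun w hw j h =>
    ha (vertex_mem_face (hc.1 w hw).2 (mem_verts.2 ⟨j, h⟩))
  have hpos : ∀ w, c w ≠ 0 → ∀ j, Function.update z i a = Function.update w j a → i = j := by
    intro w hw j he
    by_contra hij
    have := congrFun he i
    rw [Function.update_self, Function.update_of_ne hij] at this
    exact hav w hw i this.symm
  rw [sd_apply, Finsupp.sum, Finset.sum_eq_single z]
  · rw [if_pos hA, Finset.sum_eq_single i]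
    · simp
    · intro j _ hj
      refine Finsupp.single_eq_of_ne fun he => hj (hpos z hz j he).symm
    · intro h
      exact absurd (by simpa using hi) h
  · intro w hw hne
    have hw' := Finsupp.mem_support_iff.1 hw
    split_ifs with hAw
    · rw [Finset.sum_eq_zero, mul_zero]
      intro j _
      refine Finsupp.single_eq_of_ne fun he => ?_
      obtain rfl := hpos w hw' j he
      apply hne
      have hoff : ∀ l, l ≠ i → w l = z l := fun l hl => by
        have := congrFun he l
        rw [Function.update_of_ne hl, Function.update_of_ne hl] at this
        exact this.symm
      obtain ⟨l, hl⟩ := mem_verts.1 (hAw hi)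
      have hli : l = i := by
        by_contra hli
        rw [hoff l hli] at hl
        exact hli (hinj hl)
      funext m
      by_cases hm : m = i
      · rw [hm, ← hl, hli]
      · exact hoff m hm
    · rw [Finsupp.single_eq_of_ne, mul_zero]
      rintro rfl
      exact hav _ hw' i (by simp)
  · intro h
    exact absurd (Finsupp.mem_support_iff.2 hz) h

/-- The chain map which replaces the vertex `a` by `v`. -/
def ret (a v : ℕ) {k : ℕ} : Chain k →ₗ[ℤ] Chain k :=
  Finsupp.lmapDomain ℤ ℤ (fun z => Function.update id a v ∘ z)

theorem bd_ret (a v : ℕ) {k : ℕ} (c : Chain (k + 1)) : bd (ret a v c) = ret a v (bd c) := by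
  simp only [bd, ret, Finsupp.lmapDomain_apply, ← Finsupp.mapDomain_comp]
  rfl

theorem IsAlt.ret {k : ℕ} {c : Chain k} (hc : IsAlt c) (a v : ℕ) : IsAlt (ret a v c) := by
  rw [isAlt_iff_mapDomain] at hc ⊢
  intro π
  rw [PLKnot.ret, Finsupp.lmapDomain_apply, ← Finsupp.mapDomain_smul, ← hc,
    ← Finsupp.mapDomain_comp, ← Finsupp.mapDomain_comp]
  rfl

theorem ret_apply_ne_zero {a v : ℕ} {k : ℕ} {c : Chain k} {z : Fin (k + 1) → ℕ}
    (h : ret a v c z ≠ 0) : ∃ w, c w ≠ 0 ∧ z = Function.update id a v ∘ w := by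
  obtain ⟨w, hw, rfl⟩ := Finset.mem_image.1
    (Finsupp.mapDomain_support (Finsupp.mem_support_iff.2 h))
  exact ⟨w, Finsupp.mem_support_iff.1 hw, rfl⟩

theorem ret_mem {T : Cx} {A : Finset ℕ} {a v : ℕ} (hv : v ∈ A) {k : ℕ} {c : Chain k}
    (hc : c ∈ chains (starring T A a) k) : ret a v c ∈ chains T k := by
  refine mem_chains_of_isAlt ((isAlt_of_mem hc).ret a v) fun z _ hz => ?_
  obtain ⟨w, hw, rfl⟩ := ret_apply_ne_zero hz
  obtain ⟨-, -, ⟨haw, hT⟩ | ⟨haw, hT⟩⟩ := (hc.1 w hw).2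
  · refine face_mono hT (fun x hx => ?_) (verts_nonempty _)
    obtain ⟨i, rfl⟩ := mem_verts.1 hx
    have : w i ≠ a := fun h => haw (mem_verts.2 ⟨i, h⟩)
    rw [Function.comp, Function.update_of_ne this]
    exact mem_verts.2 ⟨i, rfl⟩
  · refine face_mono hT (fun x hx => ?_) (verts_nonempty _)
    obtain ⟨i, rfl⟩ := mem_verts.1 hx
    by_cases h : w i = a
    · rw [Function.comp, h, Function.update_self]
      exact Finset.mem_union_right _ hv
    · rw [Function.comp, Function.update_of_ne h]
      exact Finset.mem_union_left _ (Finset.mem_erase.2 ⟨h, mem_verts.2 ⟨i, rfl⟩⟩)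

/-- In the subdivision of a simplex containing `A`, the piece where `v` was replaced by `a` is sent
back to the simplex. Every other piece still contains `v` and becomes degenerate. -/
theorem ret_sd {T : Cx} {A : Finset ℕ} {a v : ℕ} (ha : {a} ∉ T.faces) (hv : v ∈ A)
    {k : ℕ} {c : Chain k} (hc : c ∈ chains T k) : ret a v (sd A a c) = c := by
  classical
  refine (((isAlt_of_mem hc).sd A a).ret a v).ext (isAlt_of_mem hc) fun z hz => ?_
  have h1 : ret a v (sd A a c) z = c.sum fun w n => n * (if w = z then 1 else 0) := by
    rw [sd, Finsupp.linearCombination_apply, Finsupp.sum, map_sum, Finsupp.finsetSum_apply]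
    refine Finset.sum_congr rfl fun w hw => ?_
    have hw' := hc.1 w (Finsupp.mem_support_iff.1 hw)
    have haw : ∀ j, w j ≠ a := fun j h => ha (vertex_mem_face hw'.2 (mem_verts.2 ⟨j, h⟩))
    dsimp only
    rw [map_smul, Finsupp.smul_apply, smul_eq_mul]
    congr 1
    have hid : Function.update id a v ∘ w = w := by
      funext j
      rw [Function.comp, Function.update_of_ne (haw j)]; rfl
    split_ifs with hA hwz hwz
    · subst hwz
      obtain ⟨i, hi⟩ := mem_verts.1 (hA hv)
      rw [map_sum, Finsupp.finsetSum_apply, Finset.sum_eq_single i]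
      · rw [ret, Finsupp.lmapDomain_apply, Finsupp.mapDomain_single]
        have : Function.update id a v ∘ Function.update w i a = w := by
          funext j
          by_cases hj : j = i
          · subst hj; simp [hi]
          · simp [Function.update_of_ne hj, haw j]
        rw [this, Finsupp.single_eq_same]
      · intro j _ hj
        rw [ret, Finsupp.lmapDomain_apply, Finsupp.mapDomain_single]
        refine Finsupp.single_eq_of_ne fun he => ?_
        have := congrFun he j
        simp at this
        exact hj (hw'.1 (this.trans hi.symm))
      · intro h
        exact absurd (Finset.mem_filter.2 ⟨Finset.mem_univ _, hi ▸ hv⟩) h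
    · rw [map_sum, Finsupp.finsetSum_apply, Finset.sum_eq_zero]
      intro j hj
      rw [ret, Finsupp.lmapDomain_apply, Finsupp.mapDomain_single]
      refine Finsupp.single_eq_of_ne ?_
      rintro rfl
      obtain ⟨i, hi⟩ := mem_verts.1 (hA hv)
      by_cases hij : i = j
      · apply hwz
        funext l
        by_cases hl : l = j
        · subst hl; subst hij; simp [hi]
        · simp [Function.update_of_ne hl, haw l]
      · refine hij (hz ?_)
        have hva : v ≠ a := hi ▸ haw i
        simp [Function.update_of_ne hij, hi, hva]
    · subst hwz
      rw [ret, Finsupp.lmapDomain_apply, Finsupp.mapDomain_single, hid, Finsupp.single_eq_same]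
    · rw [ret, Finsupp.lmapDomain_apply, Finsupp.mapDomain_single, hid,
        Finsupp.single_eq_of_ne (Ne.symm hwz)]
  rw [h1, Finsupp.sum, Finset.sum_eq_single z]
  · simp
  · intro w _ hw; simp [hw]
  · intro h
    rw [Finsupp.notMem_support_iff.1 h]; simp

theorem mem_supp_of_ne_zero {k : ℕ} {c : Chain k} {z : Fin (k + 1) → ℕ} (h : c z ≠ 0) {v : ℕ}
    (hv : v ∈ verts z) : {v} ∈ (supp c).faces :=
  ⟨Finset.singleton_nonempty v, z, h, Finset.singleton_subset_iff.2 hv⟩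

theorem vertex_mem_supp_sd {T : Cx} {A : Finset ℕ} {a u : ℕ} (ha : {a} ∉ T.faces) {x : Chain 1}
    (hx : x ∈ chains T 1) (hu : {u} ∈ (supp x).faces) :
    (A = {u} → {a} ∈ (supp (sd A a x)).faces) ∧
      (A.Nonempty → A ≠ {u} → {u} ∈ (supp (sd A a x)).faces) := by
  obtain ⟨-, z, hz, huz⟩ := hu
  rw [Finset.singleton_subset_iff] at huz
  obtain ⟨i, hi⟩ := mem_verts.1 huz
  constructor
  · rintro rfl
    have h := sd_apply_update ha hx hz (Finset.singleton_subset_iff.2 huz)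
      (i := i) (by simp [hi])
    exact mem_supp_of_ne_zero (h ▸ hz) (mem_verts.2 ⟨i, by simp⟩)
  · intro hn hA
    by_cases hAz : A ⊆ verts z
    · obtain ⟨b, hb, hbu⟩ : ∃ b ∈ A, b ≠ u := by
        by_contra hcon
        push Not at hcon
        exact hA (Finset.eq_singleton_iff_nonempty_unique_mem.2 ⟨hn, hcon⟩)
      obtain ⟨j, hj⟩ := mem_verts.1 (hAz hb)
      have hij : i ≠ j := by
        rintro rfl
        exact hbu (hj.symm.trans hi)
      have h := sd_apply_update ha hx hz hAz (i := j) (hj ▸ hb)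
      exact mem_supp_of_ne_zero (h ▸ hz)
        (mem_verts.2 ⟨i, by rw [Function.update_of_ne hij, hi]⟩)
    · have h := sd_apply_of_not_subset ha hx hz hAz
      exact mem_supp_of_ne_zero (h.symm ▸ hz) huz

/-! ### S-equivalent surfaces bound a 3-chain away from the other components -/

/-- The 3-chain `e` does not meet the support of the 1-chain `x`. -/
def Avoids (e : Chain 3) (x : Chain 1) : Prop :=
  ∀ z, ∀ u ∈ verts z, {u} ∈ (supp x).faces → e z = 0

theorem exists_perm_fin_four : ∀ i j : Fin 4, i ≠ j →
    ∃ π : Equiv.Perm (Fin 4), π 0 = i ∧ π 1 = j := by decide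

/-- The danger is a tetrahedron of `e` that contains `a` but not `v`, with `v` on `x`: the
retraction moves it onto `x`. Its coefficient is zero because the boundary of `e`, being a
subdivided chain, has no triangle containing `a` and missing two vertices of `A`. -/
theorem avoids_ret {T : Cx} (hdim : ∀ σ ∈ T.faces, σ.card ≤ 4) {A : Finset ℕ} {a v : ℕ}
    (ha : {a} ∉ T.faces) (hv : v ∈ A) {x : Chain 1} (hx : x ∈ chains T 1)
    {e : Chain 3} (he : e ∈ chains (starring T A a) 3) {c : Chain 2} (hc : c ∈ chains T 2)
    (hbd : bd e = sd A a c) (hex : Avoids e (sd A a x)) : Avoids (ret a v e) x := by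
  classical
  intro z u hu hux
  by_contra hne
  have hzT := (ret_mem hv he).1 z hne
  obtain ⟨w, hw, hzw⟩ := ret_apply_ne_zero hne
  have hwT := (he.1 w hw)
  have hsd := vertex_mem_supp_sd (A := A) ha hx hux
  by_cases haw : a ∈ verts w
  · obtain ⟨i, hi⟩ := mem_verts.1 haw
    have hAne : A ≠ {u} := by
      rintro rfl
      exact hw (hex w a haw (hsd.1 rfl))
    have huS := hsd.2 ⟨v, hv⟩ hAne
    have huw : u ∉ verts w := fun h => hw (hex w u h huS)
    obtain ⟨j, hj⟩ := mem_verts.1 hu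
    have hvu : v = u := by
      have hj2 : z j = Function.update id a v (w j) := by rw [hzw]; rfl
      by_cases hja : w j = a
      · rw [hja, Function.update_self] at hj2
        rw [← hj, hj2]
      · rw [Function.update_of_ne hja] at hj2
        exact absurd (mem_verts.2 ⟨j, hj2.symm.trans hj⟩) huw
    subst hvu
    obtain ⟨b, hb, hbv⟩ : ∃ b ∈ A, b ≠ v := by
      by_contra hcon
      push Not at hcon
      exact hAne (Finset.eq_singleton_iff_nonempty_unique_mem.2 ⟨⟨v, hv⟩, hcon⟩)
    have hface : (verts w).erase a ∪ A ∈ T.faces := by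
      obtain ⟨-, -, h | h⟩ := hwT.2
      · exact absurd haw h.1
      · exact h.2
    have hcard : (verts w).card = 4 := by
      rw [verts, Finset.card_image_of_injective _ hwT.1]; simp
    -- A face of `T` has at most four vertices, so every vertex of `A` other than `v` already lies
    -- in `w`.
    have hU : (verts w).erase a ∪ A = insert v ((verts w).erase a) := by
      symm
      apply Finset.eq_of_subset_of_card_le
      · exact Finset.insert_subset (Finset.mem_union_right _ hv) Finset.subset_union_left
      · rw [Finset.card_insert_of_notMem (fun h => huw (Finset.mem_of_mem_erase h)),
          Finset.card_erase_of_mem haw, hcard]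
        exact hdim _ hface
    have hbw : b ∈ (verts w).erase a := by
      have : b ∈ (verts w).erase a ∪ A := Finset.mem_union_right _ hb
      rw [hU, Finset.mem_insert] at this
      exact this.resolve_left hbv
    obtain ⟨l, hl⟩ := mem_verts.1 (Finset.mem_of_mem_erase hbw)
    have hba : b ≠ a := Finset.ne_of_mem_erase hbw
    have hli : l ≠ i := by
      rintro rfl
      exact hba (hl.symm.trans hi)
    obtain ⟨π, hπ0, hπ1⟩ := exists_perm_fin_four l i hli
    -- the triangle opposite to `b` in `w`
    have hy : ∃ y : Fin 3 → ℕ, w ∘ π = Fin.cons b y ∧ y 0 = a := by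
      refine ⟨Fin.tail (w ∘ π), ?_, ?_⟩
      · rw [← hl, ← hπ0]
        exact (Fin.cons_self_tail (w ∘ π)).symm
      · change w (π (Fin.succ 0)) = a
        rw [Fin.succ_zero_eq_one, hπ1, hi]
    obtain ⟨y, hy, hy0⟩ := hy
    have heb : e (Fin.cons b y) ≠ 0 := by
      rw [← hy, he.2]
      exact mul_ne_zero (Units.ne_zero _) hw
    have hyw : verts w = insert b (verts y) := by
      rw [← verts_comp_perm w π, hy, verts_cons]
    have hbinj : Function.Injective (Fin.cons b y : Fin 4 → ℕ) := (he.1 _ heb).1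
    have hby : b ∉ verts y := by
      intro h
      obtain ⟨m, hm⟩ := mem_verts.1 h
      have : (0 : Fin 4) = m.succ := hbinj (by simp [hm])
      exact absurd this.symm (Fin.succ_ne_zero m)
    have hvy : v ∉ verts y := fun h => huw (hyw ▸ Finset.mem_insert_of_mem h)
    have hay : a ∈ verts y := mem_verts.2 ⟨0, hy0⟩
    -- The only tetrahedra of the subdivision at the triangle `y` that can have nonzero coefficient
    -- are the ones with fourth vertex `v` or `b`; a further one would give a face of `T` with five
    -- vertices.
    have hsum := bd_apply e y {v, b} (by
      intro w' hw'
      have h1 := (he.1 _ hw')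
      have haw' : a ∈ verts (Fin.cons w' y : Fin 4 → ℕ) := by rw [verts_cons]; simp [hay]
      have h2 : (verts (Fin.cons w' y : Fin 4 → ℕ)).erase a ∪ A ∈ T.faces := by
        obtain ⟨-, -, h | h⟩ := h1.2
        · exact absurd haw' h.1
        · exact h.2
      have hw'y : w' ∉ verts y := by
        intro h
        obtain ⟨m, hm⟩ := mem_verts.1 h
        have : (0 : Fin 4) = m.succ := h1.1 (by simp [hm])
        exact absurd this.symm (Fin.succ_ne_zero m)
      by_contra hcon
      simp only [Finset.mem_insert, Finset.mem_singleton, not_or] at hcon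
      have hw'a : w' ≠ a := by rintro rfl; exact hw'y hay
      have hsub : insert w' (insert v (insert b ((verts y).erase a))) ⊆
          (verts (Fin.cons w' y : Fin 4 → ℕ)).erase a ∪ A := by
        rw [verts_cons]
        intro r hr
        simp only [Finset.mem_insert, Finset.mem_erase, Finset.mem_union] at hr ⊢
        rcases hr with rfl | rfl | rfl | hr
        · exact Or.inl ⟨hw'a, Or.inl rfl⟩
        · exact Or.inr hv
        · exact Or.inr hb
        · exact Or.inl ⟨hr.1, Or.inr hr.2⟩
      have hycard : (verts y).card = 3 := by
        have := hcard
        rw [hyw, Finset.card_insert_of_notMem hby] at this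
        omega
      have h5 := Finset.card_le_card hsub
      rw [Finset.card_insert_of_notMem, Finset.card_insert_of_notMem,
        Finset.card_insert_of_notMem (fun h => hby (Finset.mem_of_mem_erase h)),
        Finset.card_erase_of_mem hay, hycard] at h5
      · have := hdim _ h2
        omega
      · simp only [Finset.mem_insert, Finset.mem_erase, not_or, not_and]
        exact ⟨hbv.symm, fun _ => hvy⟩
      · simp only [Finset.mem_insert, Finset.mem_erase, not_or, not_and]
        exact ⟨hcon.1, hcon.2, fun _ => hw'y⟩)
    have hv0 : e (Fin.cons v y) = 0 := hex _ v (by rw [verts_cons]; simp) huS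
    -- A triangle of the subdivided chain through `a` misses just one vertex of `A`, while `y`
    -- misses both `v` and `b`.
    have hc0 : sd A a c y = 0 := by
      by_contra h
      obtain ⟨r, hr, ⟨-, rfl⟩ | ⟨hA, m, hm, rfl⟩⟩ := sd_apply_ne_zero h
      · exact ha (vertex_mem_face (hc.1 _ hr).2 hay)
      · have hvr := hA hv
        have hbr := hA hb
        rw [verts_update (hc.1 _ hr).1] at hvy hby
        simp only [Finset.mem_insert, Finset.mem_erase, not_or, not_and] at hvy hby
        by_cases h1 : v = r m
        · exact hby.2 (fun h2 => hbv (h2.trans h1.symm)) hbr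
        · exact hvy.2 h1 hvr
    rw [hbd, hc0, Finset.sum_pair hbv.symm, hv0, zero_add] at hsum
    exact heb hsum.symm
  · have hid : z = w := by
      rw [hzw]
      funext j
      rw [Function.comp, Function.update_of_ne]
      · rfl
      · exact fun h => haw (mem_verts.2 ⟨j, h⟩)
    subst hid
    have hA : ¬ A ⊆ verts z := by
      have := hwT.2.2.1
      rwa [Finset.erase_eq_of_notMem haw] at this
    refine hw (hex z u hu (hsd.2 ⟨v, hv⟩ ?_))
    rintro rfl
    exact hA (Finset.singleton_subset_iff.2 hu)

theorem card_le_of_mem_starring {T : Cx} {n : ℕ} (hdim : ∀ σ ∈ T.faces, σ.card ≤ n) {A : Finset ℕ}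
    {a : ℕ} : ∀ σ ∈ (starring T A a).faces, σ.card ≤ n := by
  rintro σ ⟨-, hA, ⟨-, h⟩ | ⟨ha, h⟩⟩
  · exact hdim σ h
  · have h1 : σ.erase a ⊂ σ.erase a ∪ A := by
      rw [Finset.ssubset_iff_subset_ne]
      refine ⟨Finset.subset_union_left, fun h => hA ?_⟩
      rw [h]
      exact Finset.subset_union_right
    have h2 := Finset.card_lt_card h1
    have h3 := Finset.card_erase_add_one ha
    have h4 := hdim _ h
    omega

/-- Isotopies and handle attachments both enter only through the ball they sweep out: the chain is
the signed fundamental class of that ball, which is disjoint from `x` and `y`. -/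
theorem IsBallMove.exists_chain {T : Cx} {o : Chain 3} {K x y : Chain 1} {B D : Cx} {f g : Chain 2}
    (h : IsBallMove T o K x y B D f g) (ho : o ∈ chains T 3) :
    ∃ e ∈ chains T 3, g = f + bd e ∧ Avoids e x ∧ Avoids e y := by
  classical
  obtain ⟨-, -, -, -, -, -, -, hBx, hBy, -, -, ε, -, hg⟩ := h
  have hav : ∀ x : Chain 1, Disjoint B (supp x) →
      Avoids (ε • o.filter (fun z => verts z ∈ B.faces)) x := by
    intro x hd z u hu hux
    rw [Finsupp.smul_apply, Finsupp.filter_apply, if_neg, smul_zero]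
    intro hB
    have h1 : {u} ∈ (B ⊓ supp x).faces := ⟨vertex_mem_face hB hu, hux⟩
    rw [disjoint_iff.1 hd] at h1
    exact h1
  refine ⟨ε • o.filter (fun z => verts z ∈ B.faces), Submodule.smul_mem _ _ ⟨fun z hz => ?_,
    fun π z => ?_⟩, ?_, hav x hBx, hav y hBy⟩
  · rw [Finsupp.filter_apply] at hz
    split_ifs at hz
    · exact ho.1 z hz
    · exact absurd rfl hz
  · simp only [Finsupp.filter_apply, verts_comp_perm]
    split_ifs
    · exact ho.2 π z
    · simp
  · rw [map_smul, hg]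

/-- Such chains can be negated and added. A chain found in a subdivision is pushed back to `T` by
the simplicial retraction, which commutes with the boundary and is a left inverse of subdivision. -/
theorem SEquivalent.exists_chain {T : Cx} {o : Chain 3} {K x y : Chain 1} {f g : Chain 2}
    (h : SEquivalent T o K x y f g) (hdim : ∀ σ ∈ T.faces, σ.card ≤ 4) (ho : o ∈ chains T 3)
    (hx : x ∈ chains T 1) (hy : y ∈ chains T 1) :
    ∃ e ∈ chains T 3, g = f + bd e ∧ Avoids e x ∧ Avoids e y := by
  induction h with
  | refl T o K x y f hf => exact ⟨0, zero_mem _, by simp, fun _ _ _ _ => rfl, fun _ _ _ _ => rfl⟩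
  | isotopy T o K x y f g h =>
    obtain ⟨B, D, -, h⟩ := h
    exact h.exists_chain ho
  | handle T o K x y f g h =>
    obtain ⟨B, D₁, D₂, -, -, -, h⟩ := h
    exact h.exists_chain ho
  | symm T o K x y f g h ih =>
    obtain ⟨e, he, rfl, h1, h2⟩ := ih hdim ho hx hy
    exact ⟨-e, neg_mem he, by simp, fun z u hu hux => by simp [h1 z u hu hux],
      fun z u hu hux => by simp [h2 z u hu hux]⟩
  | trans T o K x y f g h _ _ ih₁ ih₂ =>
    obtain ⟨e, he, rfl, h1, h2⟩ := ih₁ hdim ho hx hy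
    obtain ⟨e', he', rfl, h1', h2'⟩ := ih₂ hdim ho hx hy
    exact ⟨e + e', add_mem he he', by rw [map_add, add_assoc],
      fun z u hu hux => by simp [h1 z u hu hux, h1' z u hu hux],
      fun z u hu hux => by simp [h2 z u hu hux, h2' z u hu hux]⟩
  | subdivide T o K x y f g A a hf hg hA ha h ih =>
    obtain ⟨e, he, hge, h1, h2⟩ := ih (card_le_of_mem_starring hdim) (sd_mem ha ho)
      (sd_mem ha hx) (sd_mem ha hy)
    obtain ⟨v, hv⟩ := face_nonempty hA
    have hbd : bd e = sd A a (g - f) := by rw [map_sub, hge]; abel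
    have hgf : g - f ∈ chains T 2 := sub_mem hg.1 hf.1
    refine ⟨ret a v e, ret_mem hv he, ?_, avoids_ret hdim ha hv hx he hgf hbd h1,
      avoids_ret hdim ha hv hy he hgf hbd h2⟩
    rw [bd_ret, hbd, ret_sd ha hv hgf]
    abel

/-! ### Coefficients of low-dimensional chains -/

theorem IsAlt.swap {k : ℕ} {c : Chain k} (hc : IsAlt c) {i j : Fin (k + 1)} (hij : i ≠ j)
    {z z' : Fin (k + 1) → ℕ} (h : z' = z ∘ Equiv.swap i j) : c z' = -c z := by
  rw [h, hc, Equiv.Perm.sign_swap hij]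
  simp

theorem IsAlt.swap01 {c : Chain 1} (hc : IsAlt c) (v u : ℕ) : c ![u, v] = -c ![v, u] :=
  hc.swap (i := 0) (j := 1) (by decide) (by ext l; fin_cases l <;> rfl)

theorem IsAlt.tri01 {c : Chain 2} (hc : IsAlt c) (w v u : ℕ) : c ![v, w, u] = -c ![w, v, u] :=
  hc.swap (i := 0) (j := 1) (by decide) (by ext l; fin_cases l <;> rfl)

theorem IsAlt.tri12 {c : Chain 2} (hc : IsAlt c) (w v u : ℕ) : c ![w, u, v] = -c ![w, v, u] :=
  hc.swap (i := 1) (j := 2) (by decide) (by ext l; fin_cases l <;> rfl)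

theorem IsAlt.tri02 {c : Chain 2} (hc : IsAlt c) (w v u : ℕ) : c ![u, v, w] = -c ![w, v, u] :=
  hc.swap (i := 0) (j := 2) (by decide) (by ext l; fin_cases l <;> rfl)

theorem IsAlt.tet01 {c : Chain 3} (hc : IsAlt c) (s w v u : ℕ) :
    c ![w, s, v, u] = -c ![s, w, v, u] :=
  hc.swap (i := 0) (j := 1) (by decide) (by ext l; fin_cases l <;> rfl)

theorem IsAlt.tet12 {c : Chain 3} (hc : IsAlt c) (s w v u : ℕ) :
    c ![s, v, w, u] = -c ![s, w, v, u] :=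
  hc.swap (i := 1) (j := 2) (by decide) (by ext l; fin_cases l <;> rfl)

theorem IsAlt.tet23 {c : Chain 3} (hc : IsAlt c) (s w v u : ℕ) :
    c ![s, w, u, v] = -c ![s, w, v, u] :=
  hc.swap (i := 2) (j := 3) (by decide) (by ext l; fin_cases l <;> rfl)

theorem verts_two (v u : ℕ) : verts ![v, u] = {v, u} := by
  ext x; simp [verts, Fin.exists_fin_succ, eq_comm]

theorem verts_three (w v u : ℕ) : verts ![w, v, u] = {w, v, u} := by
  ext x; simp [verts, Fin.exists_fin_succ, eq_comm]

theorem verts_four (s w v u : ℕ) : verts ![s, w, v, u] = {s, w, v, u} := by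
  ext x; simp [verts, Fin.exists_fin_succ, eq_comm]

theorem injective_two {v u : ℕ} : Function.Injective ![v, u] ↔ v ≠ u := by
  simp [Function.Injective, Fin.forall_fin_succ, eq_comm]

theorem injective_three {w v u : ℕ} :
    Function.Injective ![w, v, u] ↔ w ≠ v ∧ w ≠ u ∧ v ≠ u := by
  simp [Function.Injective, Fin.forall_fin_succ]
  grind

theorem injective_four {s w v u : ℕ} : Function.Injective ![s, w, v, u] ↔
    s ≠ w ∧ s ≠ v ∧ s ≠ u ∧ w ≠ v ∧ w ≠ u ∧ v ≠ u := by
  simp [Function.Injective, Fin.forall_fin_succ]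
  grind

/-- The vertices of the tetrahedra in a 3-chain. -/
def vset (o : Chain 3) : Finset ℕ := o.support.biUnion verts

theorem mem_vset {o : Chain 3} {z : Fin 4 → ℕ} (h : o z ≠ 0) (i : Fin 4) : z i ∈ vset o :=
  Finset.mem_biUnion.2 ⟨z, Finsupp.mem_support_iff.2 h, mem_verts.2 ⟨i, rfl⟩⟩

/-! ### Triangulated 3-spheres -/

theorem mem_link_link {T : Cx} {v u : ℕ} {σ : Finset ℕ} :
    σ ∈ (link (link T v) u).faces ↔
      σ.Nonempty ∧ u ∉ σ ∧ v ∉ insert u σ ∧ insert v (insert u σ) ∈ T.faces := by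
  constructor
  · rintro ⟨h1, h2, -, h3, h4⟩
    exact ⟨h1, h2, h3, h4⟩
  · rintro ⟨h1, h2, h3, h4⟩
    exact ⟨h1, h2, Finset.insert_nonempty _ _, h3, h4⟩

theorem mem_link_link_link {T : Cx} {v u w : ℕ} {σ : Finset ℕ} :
    σ ∈ (link (link (link T v) u) w).faces ↔
      σ.Nonempty ∧ w ∉ σ ∧ u ∉ insert w σ ∧ v ∉ insert u (insert w σ) ∧
        insert v (insert u (insert w σ)) ∈ T.faces := by
  constructor
  · rintro ⟨h1, h2, h⟩
    obtain ⟨-, h3, h4, h5⟩ := mem_link_link.1 h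
    exact ⟨h1, h2, h3, h4, h5⟩
  · rintro ⟨h1, h2, h3, h4, h5⟩
    exact ⟨h1, h2, mem_link_link.2 ⟨Finset.insert_nonempty _ _, h3, h4, h5⟩⟩

theorem IsSphere.link_vertex {T : Cx} (hT : IsSphere 3 T) {v : ℕ} (hv : {v} ∈ T.faces) :
    IsSphere 2 (link T v) := hT.2 v hv

theorem IsSphere.link_edge {T : Cx} (hT : IsSphere 3 T) {v u : ℕ} (hne : v ≠ u)
    (h : {v, u} ∈ T.faces) : IsSphere 1 (link (link T v) u) :=
  (hT.link_vertex (vertex_mem_face h (by simp))).2 u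
    ⟨Finset.singleton_nonempty u, by simpa using hne, h⟩

theorem IsSphere.link_triangle {T : Cx} (hT : IsSphere 3 T) {v u w : ℕ}
    (hvu : v ≠ u) (hvw : v ≠ w) (huw : u ≠ w)
    (h : {v, u, w} ∈ T.faces) : IsPoints 2 (link (link (link T v) u) w) := by
  have h1 := hT.link_edge hvu (face_mono h (by grind) (Finset.insert_nonempty _ _))
  refine IsSphere.isPoints (h1.2 w (mem_link_link.2 ⟨Finset.singleton_nonempty w, ?_, ?_, h⟩))
  · simpa using huw
  · simp [hvu, hvw]

/-- The link of a triangle consists of isolated points, whereas a face with five vertices would put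
an edge into it. -/
theorem IsSphere.card_le {T : Cx} (hT : IsSphere 3 T) : ∀ σ ∈ T.faces, σ.card ≤ 4 := by
  intro σ hσ
  by_contra hcard
  obtain ⟨v, hv⟩ := face_nonempty hσ
  obtain ⟨u, hu⟩ : (σ.erase v).Nonempty := by
    rw [← Finset.card_pos, Finset.card_erase_of_mem hv]; omega
  obtain ⟨w, hw⟩ : ((σ.erase v).erase u).Nonempty := by
    rw [← Finset.card_pos, Finset.card_erase_of_mem hu, Finset.card_erase_of_mem hv]; omega
  have hc : (((σ.erase v).erase u).erase w).card ≥ 2 := by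
    rw [Finset.card_erase_of_mem hw, Finset.card_erase_of_mem hu, Finset.card_erase_of_mem hv]
    omega
  have hp := hT.link_triangle (v := v) (u := u) (w := w) (by grind) (by grind) (by grind)
    (face_mono hσ (by grind) (Finset.insert_nonempty _ _))
  have := hp.1 (((σ.erase v).erase u).erase w) (mem_link_link_link.2
    ⟨Finset.card_pos.1 (by omega), by grind, by grind, by grind,
      face_mono hσ (by grind) (Finset.insert_nonempty _ _)⟩)
  omega

/-! ### Adjacent tetrahedra and jumps of functions on tetrahedra. -/

section Oriented

variable {T : Cx} {o : Chain 3}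

theorem IsFundamentalClass.isAlt (ho : IsFundamentalClass T o) : IsAlt o := ho.1.2

theorem IsFundamentalClass.ne_zero_iff (ho : IsFundamentalClass T o) {s w v u : ℕ} :
    o ![s, w, v, u] ≠ 0 ↔
      (s ≠ w ∧ s ≠ v ∧ s ≠ u ∧ w ≠ v ∧ w ≠ u ∧ v ≠ u) ∧ {s, w, v, u} ∈ T.faces := by
  rw [← injective_four, ← verts_four]
  refine ⟨fun h => ho.1.1 _ h, fun h => ?_⟩
  rcases ho.2.2 _ h.1 h.2 with h | h <;> simp [h]

theorem IsFundamentalClass.eq_or (ho : IsFundamentalClass T o) {z : Fin 4 → ℕ} (h : o z ≠ 0) :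
    o z = 1 ∨ o z = -1 := ho.2.2 z (ho.1.1 z h).1 (ho.1.1 z h).2

theorem exists_two_cofaces (hT : IsSphere 3 T) (ho : IsFundamentalClass T o)
    {w v u : ℕ} (hwv : w ≠ v) (hwu : w ≠ u) (hvu : v ≠ u)
    (h : {w, v, u} ∈ T.faces) : ∃ s s', s ≠ s' ∧ o ![s, w, v, u] ≠ 0 ∧ o ![s', w, v, u] ≠ 0 ∧
      ∀ r, o ![r, w, v, u] ≠ 0 → r = s ∨ r = s' := by
  obtain ⟨h1, h2⟩ := hT.link_triangle hwv hwu hvu h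
  have hmem : ∀ r, {r} ∈ (link (link (link T w) v) u).faces ↔ o ![r, w, v, u] ≠ 0 := by
    intro r
    rw [mem_link_link_link, ho.ne_zero_iff]
    have : insert w (insert v (insert u {r})) = ({r, w, v, u} : Finset ℕ) := by grind
    rw [this]
    have hr := Finset.singleton_nonempty r
    grind
  obtain ⟨σ, τ, hne, he⟩ := Set.ncard_eq_two.1 h2
  obtain ⟨s, rfl⟩ := Finset.card_eq_one.1 (h1 σ (he ▸ by simp))
  obtain ⟨s', rfl⟩ := Finset.card_eq_one.1 (h1 τ (he ▸ by simp))
  refine ⟨s, s', fun h => hne (by rw [h]), (hmem s).1 (he ▸ by simp), (hmem s').1 (he ▸ by simp),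
    fun r hr => ?_⟩
  have := (hmem r).2 hr
  rw [he] at this
  simpa using this

theorem mem_vset_of_mem (hT : IsSphere 3 T) (ho : IsFundamentalClass T o)
    {v : ℕ} (hv : {v} ∈ T.faces) : v ∈ vset o := by
  obtain ⟨σ, hσ⟩ := (hT.link_vertex hv).nonempty
  obtain ⟨u, hu⟩ := hσ.1
  have hvu : v ≠ u := by rintro rfl; exact hσ.2.1 hu
  have huT : {v, u} ∈ T.faces := face_mono hσ.2.2 (by grind) (Finset.insert_nonempty _ _)
  obtain ⟨τ, hτ⟩ := (hT.link_edge hvu huT).nonempty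
  rw [mem_link_link] at hτ
  obtain ⟨w, hw⟩ := hτ.1
  obtain ⟨s, -, -, h, -⟩ := exists_two_cofaces hT ho (w := v) (v := u) (u := w) hvu
    (by grind) (by grind) (face_mono hτ.2.2.2 (by grind) (Finset.insert_nonempty _ _))
  exact mem_vset h 1

/-- The vanishing boundary of `o` at the triangle is the sum of the coefficients at its two
tetrahedra. -/
theorem exists_opposite (hT : IsSphere 3 T) (ho : IsFundamentalClass T o)
    {s w v u : ℕ} (h : o ![s, w, v, u] ≠ 0) :
    ∃ s', s' ≠ s ∧ o ![s', w, v, u] = -o ![s, w, v, u] ∧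
      ∀ r, o ![r, w, v, u] ≠ 0 → r = s ∨ r = s' := by
  obtain ⟨⟨hsw, hsv, hsu, hwv, hwu, hvu⟩, hF⟩ := ho.ne_zero_iff.1 h
  obtain ⟨s₁, s₂, hne, h₁, h₂, hall⟩ := exists_two_cofaces hT ho hwv hwu hvu
    (face_mono hF (by grind) (Finset.insert_nonempty _ _))
  have hsum := bd_apply o ![w, v, u] {s₁, s₂} (fun r hr => by simpa using hall r hr)
  rw [ho.2.1, Finset.sum_pair hne] at hsum
  change 0 = o ![s₁, w, v, u] + o ![s₂, w, v, u] at hsum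
  rcases hall s h with rfl | rfl
  · exact ⟨s₂, hne.symm, by omega, hall⟩
  · exact ⟨s₁, hne, by omega, fun r hr => (hall r hr).symm⟩

variable {E : Type*} [AddCommGroup E]

/-- The boundary, at the triangle `[w, v, u]`, of the 3-chain with coefficients `ψ`. -/
def jump (o : Chain 3) (ψ : Finset ℕ → E) (w v u : ℕ) : E :=
  ∑ s ∈ vset o, o ![s, w, v, u] • ψ {s, w, v, u}

theorem jump_eq (hT : IsSphere 3 T) (ho : IsFundamentalClass T o)
    {s s' w v u : ℕ} (ψ : Finset ℕ → E) (h : o ![s, w, v, u] ≠ 0)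
    (h' : o ![s', w, v, u] ≠ 0) (hne : s ≠ s') :
    jump o ψ w v u = o ![s, w, v, u] • (ψ {s, w, v, u} - ψ {s', w, v, u}) := by
  obtain ⟨r, hr, hrs, hall⟩ := exists_opposite hT ho h
  obtain rfl : s' = r := (hall s' h').resolve_left hne.symm
  rw [jump, ← Finset.sum_subset (s₁ := {s, s'}), Finset.sum_pair hne, hrs, smul_sub, neg_smul,
    sub_eq_add_neg]
  · intro x hx
    simp only [Finset.mem_insert, Finset.mem_singleton] at hx
    rcases hx with rfl | rfl
    · exact mem_vset h 0
    · exact mem_vset h' 0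
  · intro x _ hx
    by_contra hcon
    have : o ![x, w, v, u] ≠ 0 := fun h0 => hcon (by rw [h0, zero_smul])
    exact hx (by simpa using hall x this)

theorem eq_of_jump_eq_zero (hT : IsSphere 3 T) (ho : IsFundamentalClass T o)
    {s s' w v u : ℕ} {ψ : Finset ℕ → E} (hψ : jump o ψ w v u = 0)
    (h : o ![s, w, v, u] ≠ 0) (h' : o ![s', w, v, u] ≠ 0) :
    ψ {s, w, v, u} = ψ {s', w, v, u} := by
  by_cases hne : s = s'
  · rw [hne]
  · rw [jump_eq hT ho ψ h h' hne] at hψ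
    rcases ho.eq_or h with h1 | h1 <;> rw [h1] at hψ
    · simpa [sub_eq_zero] using hψ
    · simp only [neg_smul, one_smul, neg_sub] at hψ
      exact (sub_eq_zero.1 hψ).symm

theorem jump_eq_zero (hT : IsSphere 3 T) (ho : IsFundamentalClass T o)
    {w v u : ℕ} {ψ : Finset ℕ → E}
    (hψ : ∀ s s', o ![s, w, v, u] ≠ 0 → o ![s', w, v, u] ≠ 0 →
      ψ {s, w, v, u} = ψ {s', w, v, u}) : jump o ψ w v u = 0 := by
  by_cases h : ∃ s, o ![s, w, v, u] ≠ 0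
  · obtain ⟨s, hs⟩ := h
    obtain ⟨s', hne, hs', -⟩ := exists_opposite hT ho hs
    have hs'' : o ![s', w, v, u] ≠ 0 := by rw [hs']; simpa using hs
    rw [jump_eq hT ho ψ hs hs'' hne.symm, hψ s s' hs hs'', sub_self, smul_zero]
  · push Not at h
    exact Finset.sum_eq_zero fun s _ => by rw [h, zero_smul]

theorem jump_swap01 (ho : IsFundamentalClass T o) (ψ : Finset ℕ → E) (w v u : ℕ) :
    jump o ψ v w u = -jump o ψ w v u := by
  rw [jump, jump, ← Finset.sum_neg_distrib]
  refine Finset.sum_congr rfl fun s _ => ?_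
  rw [ho.isAlt.tet12 s w v u, neg_smul, Finset.insert_comm v w]

theorem jump_swap12 (ho : IsFundamentalClass T o) (ψ : Finset ℕ → E) (w v u : ℕ) :
    jump o ψ w u v = -jump o ψ w v u := by
  rw [jump, jump, ← Finset.sum_neg_distrib]
  refine Finset.sum_congr rfl fun s _ => ?_
  rw [ho.isAlt.tet23 s w v u, neg_smul, Finset.pair_comm u v]

theorem jump_eq_zero_of_notMem (ho : IsFundamentalClass T o) (ψ : Finset ℕ → E) {w v u : ℕ}
    (h : ¬ ({w, v, u} : Finset ℕ) ∈ T.faces) : jump o ψ w v u = 0 := by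
  refine Finset.sum_eq_zero fun s _ => ?_
  rw [not_not.1 fun h0 => h (face_mono (ho.ne_zero_iff.1 h0).2 (by grind)
    (Finset.insert_nonempty _ _)), zero_smul]

end Oriented

/-- A finite double sum of an antisymmetric function vanishes. -/
theorem sum_sum_antisymm {E : Type*} [AddCommGroup E] [Module.IsTorsionFree ℤ E] (S : Finset ℕ)
    (F : ℕ → ℕ → E) (h : ∀ x y, F y x = -F x y) : ∑ x ∈ S, ∑ y ∈ S, F x y = 0 := by
  have h1 : ∑ x ∈ S, ∑ y ∈ S, F x y = -∑ x ∈ S, ∑ y ∈ S, F x y := by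
    conv_lhs => rw [Finset.sum_comm]
    rw [← Finset.sum_neg_distrib]
    refine Finset.sum_congr rfl fun x _ => ?_
    rw [← Finset.sum_neg_distrib]
    exact Finset.sum_congr rfl fun y _ => h x y
  have h2 : (2 : ℤ) • ∑ x ∈ S, ∑ y ∈ S, F x y = 0 := by
    rw [two_smul]
    nth_rewrite 2 [h1]
    exact add_neg_cancel _
  exact (smul_eq_zero.1 h2).resolve_left (by norm_num)

section Ring

variable {T : Cx} {o : Chain 3} {E : Type*} [AddCommGroup E]

/-- This is ∂∂ = 0 at the edge vu, for the 3-chain with coefficients `ψ`. -/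
theorem sum_jump [Module.IsTorsionFree ℤ E] (ho : IsFundamentalClass T o) (ψ : Finset ℕ → E)
    (v u : ℕ) : ∑ w ∈ vset o, jump o ψ w v u = 0 := by
  unfold jump
  refine sum_sum_antisymm _ _ fun x y => ?_
  rw [ho.isAlt.tet01 y x, neg_smul, Finset.insert_comm x y]

/-- The tetrahedra around an edge form a cycle. -/
theorem eq_around_edge (hT : IsSphere 3 T) (ho : IsFundamentalClass T o) {v u : ℕ}
    {ψ : Finset ℕ → E} (hψ : ∀ w, jump o ψ w v u = 0) {s w s' w' : ℕ}
    (h : o ![s, w, v, u] ≠ 0) (h' : o ![s', w', v, u] ≠ 0) :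
    ψ {s, w, v, u} = ψ {s', w', v, u} := by
  obtain ⟨hd, hF⟩ := ho.ne_zero_iff.1 h
  obtain ⟨hd', hF'⟩ := ho.ne_zero_iff.1 h'
  have hL := (hT.link_edge (v := v) (u := u) (by grind)
    (face_mono hF (by grind) (Finset.insert_nonempty _ _))).conn le_rfl
  -- All tetrahedra at the triangle xvu carry the reference value. This passes along an edge xy of
  -- the link, since xyvu is a tetrahedron at both triangles, and the link of vu is a circle.
  let κ : ℕ → Prop := fun x => ∀ r, o ![r, x, v, u] ≠ 0 → ψ {r, x, v, u} = ψ {s, w, v, u}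
  have hκ : ∀ x y, ({x, y} : Finset ℕ) ∈ (link (link T v) u).faces → κ x → κ y := by
    intro x y hxy hx
    by_cases hne : x = y
    · exact hne ▸ hx
    · rw [mem_link_link] at hxy
      have hxy' : o ![y, x, v, u] ≠ 0 := by
        rw [ho.ne_zero_iff]
        have : insert v (insert u {x, y}) = ({y, x, v, u} : Finset ℕ) := by grind
        rw [this] at hxy
        refine ⟨?_, hxy.2.2.2⟩
        grind
      intro r hr
      have hyx : o ![x, y, v, u] ≠ 0 := by rw [ho.isAlt.tet01 y x]; simpa using hxy'
      rw [eq_of_jump_eq_zero hT ho (hψ y) hr hyx, Finset.insert_comm x y]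
      exact hx y hxy'
  have hmem : ∀ {r x : ℕ}, o ![r, x, v, u] ≠ 0 → {x} ∈ (link (link T v) u).faces := by
    intro r x hr
    obtain ⟨hd, hF⟩ := ho.ne_zero_iff.1 hr
    exact mem_link_link.2 ⟨Finset.singleton_nonempty x, by grind, by grind,
      face_mono hF (by grind) (Finset.insert_nonempty _ _)⟩
  have := hL κ hκ w w' (hmem h) (hmem h') (fun r hr => eq_of_jump_eq_zero hT ho (hψ w) hr h)
  exact (this s' h').symm

end Ring

/-! ### Embedded surfaces -/

theorem exists_perm_of_verts_eq {k : ℕ} {z z' : Fin k → ℕ}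
    (hz' : Function.Injective z') (h : verts z = verts z') :
    ∃ π : Equiv.Perm (Fin k), z' = z ∘ π := by
  have hex : ∀ i, ∃ j, z j = z' i := fun i =>
    mem_verts.1 (h ▸ mem_verts.2 ⟨i, rfl⟩ : z' i ∈ verts z)
  choose g hg using hex
  have hinj : Function.Injective g := fun i j hij => hz' (by rw [← hg, ← hg, hij])
  exact ⟨Equiv.ofBijective g (Finite.injective_iff_bijective.1 hinj), funext fun i => (hg i).symm⟩

theorem IsAlt.ne_zero_of_verts_eq {k : ℕ} {c : Chain k} (hc : IsAlt c) {z z' : Fin (k + 1) → ℕ}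
    (hz' : Function.Injective z') (h : verts z = verts z') (hne : c z ≠ 0) : c z' ≠ 0 := by
  obtain ⟨π, rfl⟩ := exists_perm_of_verts_eq hz' h
  rw [hc]
  exact mul_ne_zero (Units.ne_zero _) hne

theorem card_verts {k : ℕ} {z : Fin k → ℕ} (hz : Function.Injective z) : (verts z).card = k := by
  rw [verts, Finset.card_image_of_injective _ hz]; simp

theorem IsAlt.injective_of_ne_zero {k : ℕ} {c : Chain k} (hc : IsAlt c) {z : Fin (k + 1) → ℕ}
    (h : c z ≠ 0) : Function.Injective z := by
  by_contra hn
  exact h (hc.eq_zero_of_not_injective hn)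

theorem IsAlt.triangle_mem_supp {f : Chain 2} (hf : IsAlt f) {w v u : ℕ} (hwv : w ≠ v)
    (hwu : w ≠ u) (hvu : v ≠ u) : {w, v, u} ∈ (supp f).faces ↔ f ![w, v, u] ≠ 0 := by
  constructor
  · rintro ⟨-, z, hz, hs⟩
    refine hf.ne_zero_of_verts_eq (injective_three.2 ⟨hwv, hwu, hvu⟩) ?_ hz
    rw [verts_three]
    refine (Finset.eq_of_subset_of_card_le hs ?_).symm
    rw [card_verts (hf.injective_of_ne_zero hz),
      Finset.card_eq_three.2 ⟨w, v, u, hwv, hwu, hvu, rfl⟩]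
  · intro h
    exact ⟨Finset.insert_nonempty _ _, _, h, by rw [verts_three]⟩

theorem IsAlt.exists_of_edge_mem_supp {f : Chain 2} (hf : IsAlt f) {v u : ℕ} (hvu : v ≠ u)
    (h : {v, u} ∈ (supp f).faces) : ∃ w, f ![w, v, u] ≠ 0 := by
  obtain ⟨-, z, hz, hs⟩ := h
  have hc := card_verts (hf.injective_of_ne_zero hz)
  obtain ⟨w, hw⟩ : (verts z \ {v, u}).Nonempty := by
    rw [← Finset.card_pos, Finset.card_sdiff_of_subset hs, hc, Finset.card_pair hvu]
    norm_num
  rw [Finset.mem_sdiff] at hw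
  refine ⟨w, (hf.triangle_mem_supp (by grind) (by grind) hvu).1 ?_⟩
  exact ⟨Finset.insert_nonempty _ _, z, hz, Finset.insert_subset hw.1 hs⟩

/-- The properties of an embedded oriented surface that are used below. -/
structure IsSurface (T : Cx) (f : Chain 2) : Prop where
  mem : f ∈ chains T 2
  eq_or : ∀ z, f z = 0 ∨ f z = 1 ∨ f z = -1
  two_at_edge : ∀ {v u w w' : ℕ}, f ![w, v, u] ≠ 0 → f ![w', v, u] ≠ 0 → w ≠ w' →
    f ![w', v, u] = -f ![w, v, u] ∧ ∀ r, f ![r, v, u] ≠ 0 → r = w ∨ r = w'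
  conn_link : ∀ v, {v} ∈ (supp f).faces → Conn (link (supp f) v)
  conn : Conn (supp f)

theorem IsSurface.isAlt {T : Cx} {f : Chain 2} (h : IsSurface T f) : IsAlt f := h.mem.2

theorem IsConnected.conn {T : Cx} (h : IsConnected T) : Conn T := by
  intro κ hκ u v hu hv h0
  have := h.2 u v hu hv
  induction this with
  | refl => exact h0
  | @tail b c _ hbc ih => exact hκ b c hbc (ih (vertex_mem_face hbc (by simp)))

theorem IsSeifertSurface.isSurface {T : Cx} {K : Chain 1} {f : Chain 2}
    (hK : ∀ z, K z = 0 ∨ K z = 1 ∨ K z = -1) (h : IsSeifertSurface T K f) : IsSurface T f := by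
  obtain ⟨hmem, hbd, hval, hconn, hlink⟩ := h
  have hf : IsAlt f := hmem.2
  refine ⟨hmem, hval, ?_, ?_, hconn.conn⟩
  · intro v u w w' h1 h2 hne
    have hdist : ∀ {r}, f ![r, v, u] ≠ 0 → r ≠ v ∧ r ≠ u ∧ v ≠ u := fun hr =>
      injective_three.1 (hf.injective_of_ne_zero hr)
    have hmemL : ∀ r, f ![r, v, u] ≠ 0 → {r} ∈ (link (link (supp f) v) u).faces := by
      intro r hr
      obtain ⟨hrv, hru, hvu⟩ := hdist hr
      refine mem_link_link.2 ⟨Finset.singleton_nonempty r, by grind, by grind, ?_⟩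
      have := (hf.triangle_mem_supp hrv hru hvu).2 hr
      convert this using 1
      grind
    have hv : {v} ∈ (supp f).faces := mem_supp_of_ne_zero h1 (by rw [verts_three]; simp)
    have hu : {u} ∈ (link (supp f) v).faces := by
      obtain ⟨hrv, hru, hvu⟩ := hdist h1
      refine ⟨Finset.singleton_nonempty u, by simpa using hvu, ?_⟩
      exact face_mono ((hf.triangle_mem_supp hrv hru hvu).2 h1) (by grind)
        (Finset.insert_nonempty _ _)
    have hcard : IsPoints 2 (link (link (supp f) v) u) ∨ IsPoints 1 (link (link (supp f) v) u) := by
      rcases hlink v hv with hs | hb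
      · exact Or.inl (IsSphere.isPoints (hs.2 u hu))
      · rcases hb.2 u hu with hs | hb
        · exact Or.inl (IsSphere.isPoints hs)
        · exact Or.inr (IsBall.isPoints hb)
    have hnp : ({w} : Finset ℕ) ≠ {w'} := by simpa using hne
    have hall : ∀ r, f ![r, v, u] ≠ 0 → r = w ∨ r = w' := by
      intro r hr
      rcases hcard with hc | hc
      · obtain ⟨σ, τ, hστ, he⟩ := Set.ncard_eq_two.1 hc.2
        have m1 := hmemL w h1
        have m2 := hmemL w' h2
        have m3 := hmemL r hr
        rw [he] at m1 m2 m3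
        simp only [Set.mem_insert_iff, Set.mem_singleton_iff] at m1 m2 m3
        have : ({r} : Finset ℕ) = {w} ∨ ({r} : Finset ℕ) = {w'} := by
          rcases m1 with m1 | m1 <;> rcases m2 with m2 | m2 <;> rcases m3 with m3 | m3 <;>
            simp_all
        simpa using this
      · obtain ⟨σ, he⟩ := Set.ncard_eq_one.1 hc.2
        have m1 := hmemL w h1
        have m2 := hmemL w' h2
        rw [he] at m1 m2
        exact absurd (m1.trans m2.symm) hnp
    refine ⟨?_, hall⟩
    -- The two coefficients ±1 have an even sum, which is a coefficient of `K` and hence 0, 1 or -1;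
    -- so they cancel.
    have hsum := bd_apply f ![v, u] {w, w'} (fun r hr => by simpa using hall r hr)
    rw [Finset.sum_pair hne, hbd] at hsum
    change K ![v, u] = f ![w, v, u] + f ![w', v, u] at hsum
    rcases hK ![v, u] with h3 | h3 | h3 <;> rcases hval ![w, v, u] with h4 | h4 | h4 <;>
      rcases hval ![w', v, u] with h5 | h5 | h5 <;> omega
  · intro v hv
    rcases hlink v hv with hs | hb
    · exact hs.conn le_rfl
    · exact hb.conn

/-! ### The two sides of an embedded surface. -/

section Sides

variable {T : Cx} {o : Chain 3} {f : Chain 2} {E : Type*} [AddCommGroup E]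

theorem exists_side (hT : IsSphere 3 T) (ho : IsFundamentalClass T o) (hf : IsSurface T f)
    {w v u : ℕ} (h : f ![w, v, u] ≠ 0) : ∃ s s', s ≠ s' ∧
      o ![s, w, v, u] * f ![w, v, u] = -1 ∧ o ![s', w, v, u] * f ![w, v, u] = 1 := by
  have hd := injective_three.1 (hf.isAlt.injective_of_ne_zero h)
  have hF := (hf.mem.1 _ h).2
  rw [verts_three] at hF
  obtain ⟨s, -, -, hs, -⟩ := exists_two_cofaces hT ho hd.1 hd.2.1 hd.2.2 hF
  obtain ⟨s', hne, hs', -⟩ := exists_opposite hT ho hs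
  rcases ho.eq_or hs with h1 | h1 <;> rcases (hf.eq_or _).resolve_left h with h2 | h2
  · exact ⟨s', s, hne, by rw [hs', h1, h2]; rfl, by rw [h1, h2]; rfl⟩
  · exact ⟨s, s', hne.symm, by rw [h1, h2]; rfl, by rw [hs', h1, h2]; rfl⟩
  · exact ⟨s, s', hne.symm, by rw [h1, h2]; rfl, by rw [hs', h1, h2]; rfl⟩
  · exact ⟨s', s, hne, by rw [hs', h1, h2]; rfl, by rw [h1, h2]; rfl⟩

theorem exists_side_of_sign (hT : IsSphere 3 T) (ho : IsFundamentalClass T o) (hf : IsSurface T f)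
    {δ : ℤ} (hδ : δ = 1 ∨ δ = -1) {w v u : ℕ} (h : f ![w, v, u] ≠ 0) :
    ∃ s, o ![s, w, v, u] * f ![w, v, u] = δ := by
  obtain ⟨s, s', -, h1, h2⟩ := exists_side hT ho hf h
  rcases hδ with rfl | rfl
  · exact ⟨s', h2⟩
  · exact ⟨s, h1⟩

theorem side_unique (hT : IsSphere 3 T) (ho : IsFundamentalClass T o)
    {δ : ℤ} (hδ : δ = 1 ∨ δ = -1) {s s' w v u : ℕ}
    (h : o ![s, w, v, u] * f ![w, v, u] = δ) (h' : o ![s', w, v, u] * f ![w, v, u] = δ) :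
    s = s' := by
  have hf0 : f ![w, v, u] ≠ 0 := by
    intro h0; rw [h0, mul_zero] at h; omega
  have hs : o ![s, w, v, u] ≠ 0 := by
    intro h0; rw [h0, zero_mul] at h; omega
  have hs' : o ![s', w, v, u] ≠ 0 := by
    intro h0; rw [h0, zero_mul] at h'; omega
  obtain ⟨r, -, hr, hall⟩ := exists_opposite hT ho hs
  rcases hall s' hs' with h1 | rfl
  · exact h1.symm
  · have := mul_right_cancel₀ hf0 (h.trans h'.symm)
    omega

/-- A function on the tetrahedra around an edge of the surface which is constant away from the
surface takes the same value on the same sides of the two triangles of the surface. -/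
theorem eq_of_same_side (hT : IsSphere 3 T) (ho : IsFundamentalClass T o) (hf : IsSurface T f)
    {v u : ℕ} {ψ : Finset ℕ → E}
    (hψ : ∀ w, f ![w, v, u] = 0 → jump o ψ w v u = 0) {δ : ℤ} (hδ : δ = 1 ∨ δ = -1)
    {s₁ w₁ s₂ w₂ : ℕ} (h₁ : o ![s₁, w₁, v, u] * f ![w₁, v, u] = δ)
    (h₂ : o ![s₂, w₂, v, u] * f ![w₂, v, u] = δ) :
    ψ {s₁, w₁, v, u} = ψ {s₂, w₂, v, u} := by
  classical
  by_cases hw : w₁ = w₂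
  · subst hw
    rw [side_unique hT ho hδ h₁ h₂]
  have hδ0 : δ ≠ 0 := by omega
  have hf₁ : f ![w₁, v, u] ≠ 0 := fun h0 => by rw [h0, mul_zero] at h₁; exact hδ0 h₁.symm
  have hf₂ : f ![w₂, v, u] ≠ 0 := fun h0 => by rw [h0, mul_zero] at h₂; exact hδ0 h₂.symm
  have ho₁ : o ![s₁, w₁, v, u] ≠ 0 := fun h0 => by rw [h0, zero_mul] at h₁; exact hδ0 h₁.symm
  have ho₂ : o ![s₂, w₂, v, u] ≠ 0 := fun h0 => by rw [h0, zero_mul] at h₂; exact hδ0 h₂.symm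
  obtain ⟨hop, hall⟩ := hf.two_at_edge hf₁ hf₂ hw
  obtain ⟨s₁', hs₁', ho₁', -⟩ := exists_opposite hT ho ho₁
  obtain ⟨s₂', hs₂', ho₂', -⟩ := exists_opposite hT ho ho₂
  have ho₁0 : o ![s₁', w₁, v, u] ≠ 0 := by rw [ho₁']; simpa using ho₁
  have ho₂0 : o ![s₂', w₂, v, u] ≠ 0 := by rw [ho₂']; simpa using ho₂
  have hw₁S : w₁ ∈ vset o := mem_vset ho₁ 1
  have hw₂S : w₂ ∈ vset o := mem_vset ho₂ 1
  have hoo : o ![s₂, w₂, v, u] = -o ![s₁, w₁, v, u] := by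
    rw [hop] at h₂
    have : (o ![s₂, w₂, v, u] + o ![s₁, w₁, v, u]) * f ![w₁, v, u] = 0 := by linarith
    have := (mul_eq_zero.1 this).resolve_right hf₁
    omega
  -- the jumps at the two triangles agree
  have jumps : ∀ χ : Finset ℕ → ℤ,
      (∀ w, f ![w, v, u] = 0 → jump o χ w v u = 0) →
      χ {s₁, w₁, v, u} - χ {s₁', w₁, v, u} = χ {s₂, w₂, v, u} - χ {s₂', w₂, v, u} := by
    intro χ hχ
    have h := sum_jump ho χ v u
    rw [← Finset.sum_subset (s₁ := {w₁, w₂}), Finset.sum_pair hw,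
      jump_eq hT ho χ ho₁ ho₁0 hs₁'.symm, jump_eq hT ho χ ho₂ ho₂0 hs₂'.symm, hoo, neg_smul,
      ← sub_eq_add_neg, sub_eq_zero] at h
    · rcases ho.eq_or ho₁ with h1 | h1 <;> rw [h1] at h <;> simp only [smul_eq_mul] at h <;> omega
    · intro x hx
      simp only [Finset.mem_insert, Finset.mem_singleton] at hx
      rcases hx with rfl | rfl
      · exact hw₁S
      · exact hw₂S
    · intro x _ hx
      refine hχ x ?_
      by_contra hne
      exact hx (by simpa using hall x hne)
  -- One rotation step around the edge without crossing the surface; `P` holds on the tetrahedra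
  -- reachable from the first one.
  let r : Finset ℕ → Finset ℕ → Prop := fun τ τ' => ∃ w s s', f ![w, v, u] = 0 ∧
    o ![s, w, v, u] ≠ 0 ∧ o ![s', w, v, u] ≠ 0 ∧ τ = {s, w, v, u} ∧ τ' = {s', w, v, u}
  let P : Finset ℕ → Prop := fun τ => Relation.ReflTransGen r {s₁, w₁, v, u} τ
  have hPψ : ∀ τ, P τ → ψ τ = ψ {s₁, w₁, v, u} := by
    intro τ hτ
    induction hτ with
    | refl => rfl
    | tail _ h ih =>
      obtain ⟨w, s, s', h0, hs, hs', rfl, rfl⟩ := h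
      rw [← ih]
      exact eq_of_jump_eq_zero hT ho (hψ w h0) hs' hs
  by_cases hP₂ : P {s₂, w₂, v, u}
  · exact (hPψ _ hP₂).symm
  exfalso
  let ι : Finset ℕ → ℤ := fun τ => if P τ then 1 else 0
  have hι : ∀ w, f ![w, v, u] = 0 → jump o ι w v u = 0 := by
    intro w h0
    refine jump_eq_zero hT ho fun s s' hs hs' => ?_
    have : P {s, w, v, u} ↔ P {s', w, v, u} :=
      ⟨fun h => h.tail ⟨w, s, s', h0, hs, hs', rfl, rfl⟩,
        fun h => h.tail ⟨w, s', s, h0, hs', hs, rfl, rfl⟩⟩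
    simp only [ι, this]
  -- Here ι is 1 at the first tetrahedron and 0 at the second. Equality of the two jumps then forces
  -- 1 and 0 on the opposite sides as well, so ι does not jump anywhere around the edge,
  -- contradicting `eq_around_edge`.
  have hj := jumps ι hι
  have hP₁ : P {s₁, w₁, v, u} := Relation.ReflTransGen.refl
  have e1 : ι {s₁, w₁, v, u} = 1 := if_pos hP₁
  have e2 : ι {s₂, w₂, v, u} = 0 := if_neg hP₂
  have e3 : ι {s₁', w₁, v, u} = 0 ∨ ι {s₁', w₁, v, u} = 1 := by simp only [ι]; split_ifs <;> simp
  have e4 : ι {s₂', w₂, v, u} = 0 ∨ ι {s₂', w₂, v, u} = 1 := by simp only [ι]; split_ifs <;> simp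
  have e5 : ι {s₁, w₁, v, u} = ι {s₁', w₁, v, u} := by omega
  have e6 : ι {s₂, w₂, v, u} = ι {s₂', w₂, v, u} := by omega
  have hι' : ∀ w, jump o ι w v u = 0 := by
    intro w
    by_cases h0 : f ![w, v, u] = 0
    · exact hι w h0
    · rcases hall w h0 with rfl | rfl
      · rw [jump_eq hT ho ι ho₁ ho₁0 hs₁'.symm, e5, sub_self, smul_zero]
      · rw [jump_eq hT ho ι ho₂ ho₂0 hs₂'.symm, e6, sub_self, smul_zero]
  have := eq_around_edge hT ho hι' ho₁ ho₂
  omega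

/-- A function on the tetrahedra around a vertex of the surface which is constant away from the
surface is constant on each side of the surface. -/
theorem eq_of_same_side_vertex (hT : IsSphere 3 T) (ho : IsFundamentalClass T o)
    (hf : IsSurface T f) {v : ℕ} {ψ : Finset ℕ → E}
    (hψ : ∀ w u, f ![w, u, v] = 0 → jump o ψ w u v = 0) {δ : ℤ} (hδ : δ = 1 ∨ δ = -1)
    {s₁ w₁ u₁ s₂ w₂ u₂ : ℕ} (h₁ : o ![s₁, w₁, u₁, v] * f ![w₁, u₁, v] = δ)
    (h₂ : o ![s₂, w₂, u₂, v] * f ![w₂, u₂, v] = δ) :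
    ψ {s₁, w₁, u₁, v} = ψ {s₂, w₂, u₂, v} := by
  have hδ0 : δ ≠ 0 := by omega
  have hfne : ∀ {s w u}, o ![s, w, u, v] * f ![w, u, v] = δ → f ![w, u, v] ≠ 0 :=
    fun h h0 => by rw [h0, mul_zero] at h; exact hδ0 h.symm
  have hmem : ∀ {w u}, f ![w, u, v] ≠ 0 → {u} ∈ (link (supp f) v).faces := by
    intro w u h
    have hd := injective_three.1 (hf.isAlt.injective_of_ne_zero h)
    exact ⟨Finset.singleton_nonempty u, by grind, face_mono
      ((hf.isAlt.triangle_mem_supp hd.1 hd.2.1 hd.2.2).2 h) (by grind)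
      (Finset.insert_nonempty _ _)⟩
  have hv : {v} ∈ (supp f).faces :=
    mem_supp_of_ne_zero (hfne h₁) (by rw [verts_three]; simp)
  -- On the chosen side, all surface triangles at the edge uv carry the reference value. An edge xy
  -- of the link of `v` is a surface triangle at both xv and yv, and this link is connected.
  let κ : ℕ → Prop := fun u => ∀ w s, o ![s, w, u, v] * f ![w, u, v] = δ →
    ψ {s, w, u, v} = ψ {s₁, w₁, u₁, v}
  have hκ : ∀ x y, ({x, y} : Finset ℕ) ∈ (link (supp f) v).faces → κ x → κ y := by
    intro x y hxy hx
    by_cases hne : x = y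
    · exact hne ▸ hx
    · obtain ⟨-, hvn, hF⟩ := hxy
      have hxyv : f ![y, x, v] ≠ 0 := by
        refine (hf.isAlt.triangle_mem_supp (by grind) (by grind) (by grind)).1 ?_
        convert hF using 1
        grind
      obtain ⟨r, hr⟩ := exists_side_of_sign hT ho hf hδ hxyv
      intro w s hs
      have hr' : o ![r, x, y, v] * f ![x, y, v] = δ := by
        rw [ho.isAlt.tet12 r y x v, hf.isAlt.tri01 y x v, neg_mul_neg, hr]
      rw [eq_of_same_side hT ho hf (fun w h => hψ w y h) hδ hs hr', Finset.insert_comm x y]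
      exact hx y r hr
  exact (hf.conn_link v hv κ hκ u₁ u₂ (hmem (hfne h₁)) (hmem (hfne h₂))
    (fun w s hs => eq_of_same_side hT ho hf (fun w h => hψ w u₁ h) hδ hs h₁) w₂ s₂ h₂).symm

end Sides

/-! ### Local potentials of 2-chains -/

theorem cons_injective (v : ℕ) {k : ℕ} :
    Function.Injective (fun x : Fin k → ℕ => (Fin.cons v x : Fin (k + 1) → ℕ)) := by
  intro x y h
  funext i
  simpa using congrFun h i.succ

theorem cone_apply_cons {v : ℕ} {k : ℕ} (c : Chain k) {x : Fin (k + 1) → ℕ} (hx : v ∉ verts x) :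
    cone v c (Fin.cons v x) = c x := by
  unfold cone
  rw [Finsupp.finsetSum_apply, Finset.sum_eq_single 0]
  · rw [Finsupp.smul_apply]
    have h0 : (fun x : Fin (k + 1) → ℕ => (Fin.insertNth 0 v x : Fin (k + 2) → ℕ)) =
        fun x => (Fin.cons v x : Fin (k + 2) → ℕ) := by
      funext x; rw [Fin.insertNth_zero']
    rw [h0, Finsupp.mapDomain_apply (cons_injective v)]
    simp
  · intro i _ hi
    rw [Finsupp.smul_apply]
    have : Finsupp.mapDomain (fun x => (i.insertNth v x : Fin (k + 2) → ℕ)) c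
        (Fin.cons v x) = 0 := by
      by_contra h2
      obtain ⟨y, -, hy⟩ := Finset.mem_image.1
        (Finsupp.mapDomain_support (Finsupp.mem_support_iff.2 h2))
      obtain ⟨j, rfl⟩ := Fin.exists_succ_eq.2 hi
      have := congrFun hy j.succ
      simp only [Fin.insertNth_apply_same, Fin.cons_succ] at this
      exact hx (mem_verts.2 ⟨j, this.symm⟩)
    rw [this, smul_zero]
  · simp

theorem bd_cone_apply_cons {v : ℕ} {k : ℕ} {c : Chain (k + 1)}
    (hc : ∀ z, c z ≠ 0 → v ∉ verts z) {x : Fin (k + 1) → ℕ} (hx : v ∉ verts x) :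
    bd (cone v c) (Fin.cons v x) = -bd c x := by
  rw [bd_cone, Finsupp.sub_apply, cone_apply_cons _ hx]
  have : c (Fin.cons v x) = 0 := by
    by_contra h
    exact hc _ h (by rw [verts_cons]; simp)
  rw [this, zero_sub]

/-- The link of the vertex `v` in the chain `c`. -/
def linkChain (v : ℕ) {k : ℕ} (c : Chain (k + 1)) : Chain k :=
  c.comapDomain (fun x : Fin (k + 1) → ℕ => (Fin.cons v x : Fin (k + 2) → ℕ))
    (cons_injective v).injOn

theorem linkChain_apply (v : ℕ) {k : ℕ} (c : Chain (k + 1)) (x : Fin (k + 1) → ℕ) :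
    linkChain v c x = c (Fin.cons v x) := rfl

theorem IsAlt.linkChain {k : ℕ} {c : Chain (k + 1)} (hc : IsAlt c) (v : ℕ) :
    IsAlt (linkChain v c) := by
  intro π z
  rw [linkChain_apply, linkChain_apply, ← cons_comp_permCons, hc, sign_permCons]

theorem linkChain_mem {T : Cx} {k : ℕ} {c : Chain (k + 1)} (hc : c ∈ chains T (k + 1)) (v : ℕ) :
    linkChain v c ∈ chains (link T v) k := by
  refine mem_chains_of_isAlt ((isAlt_of_mem hc).linkChain v) fun z _ hz => ?_
  obtain ⟨h1, h2⟩ := hc.1 _ hz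
  rw [verts_cons] at h2
  refine ⟨verts_nonempty z, fun hv => ?_, h2⟩
  obtain ⟨j, hj⟩ := mem_verts.1 hv
  have : (0 : Fin (k + 2)) = j.succ := h1 (by simp [hj])
  exact absurd this.symm (Fin.succ_ne_zero j)

theorem bd_linkChain {k : ℕ} {c : Chain (k + 2)} (hc : IsAlt c) (v : ℕ) (x : Fin (k + 1) → ℕ) :
    bd (linkChain v c) x = -bd c (Fin.cons v x) := by
  classical
  let S : Finset ℕ := c.support.biUnion verts
  have hS : ∀ z, c z ≠ 0 → ∀ w ∈ verts z, w ∈ S := fun z hz w hw =>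
    Finset.mem_biUnion.2 ⟨z, Finsupp.mem_support_iff.2 hz, hw⟩
  rw [bd_apply _ x S, bd_apply _ (Fin.cons v x) S, ← Finset.sum_neg_distrib]
  · refine Finset.sum_congr rfl fun w _ => ?_
    rw [linkChain_apply]
    refine hc.swap (i := 0) (j := 1) (by simp) ?_
    funext l
    refine Fin.cases ?_ (fun l => Fin.cases ?_ (fun l => ?_) l) l
    · simp
    · rw [Fin.succ_zero_eq_one, Function.comp, Equiv.swap_apply_right]
      rfl
    · rw [Function.comp, Equiv.swap_apply_of_ne_of_ne (Fin.succ_ne_zero _)]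
      · simp
      · rw [← Fin.succ_zero_eq_one]
        exact fun h => Fin.succ_ne_zero _ (Fin.succ_injective _ h)
  · intro w hw
    exact hS _ hw w (by rw [verts_cons]; simp)
  · intro w hw
    rw [linkChain_apply] at hw
    exact hS _ hw w (by rw [verts_cons, verts_cons]; simp)

theorem edge_mem {T : Cx} {v u : ℕ} (h : {v, u} ∈ T.faces) :
    edge v u ∈ chains T 1 := by
  have hval : ∀ z : Fin 2 → ℕ, edge v u z ≠ 0 → z = ![v, u] ∨ z = ![u, v] := by
    intro z hz
    by_contra hcon
    push Not at hcon
    apply hz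
    rw [edge, Finsupp.sub_apply, Finsupp.single_eq_of_ne hcon.1,
      Finsupp.single_eq_of_ne hcon.2, sub_zero]
  refine mem_chains_of_isAlt ?_ fun z _ hz => ?_
  · rw [isAlt_iff_mapDomain]
    intro π
    rw [edge, sub_eq_add_neg, Finsupp.mapDomain_add, ← Finsupp.single_neg,
      Finsupp.mapDomain_single, Finsupp.mapDomain_single]
    have hπ : π = 1 ∨ π = Equiv.swap 0 1 := by
      revert π; decide
    rcases hπ with rfl | rfl
    · simp
    · have h1 : ![v, u] ∘ (Equiv.swap 0 1 : Equiv.Perm (Fin 2)) = ![u, v] := by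
        ext l; fin_cases l <;> rfl
      have h2 : ![u, v] ∘ (Equiv.swap 0 1 : Equiv.Perm (Fin 2)) = ![v, u] := by
        ext l; fin_cases l <;> rfl
      rw [h1, h2, Equiv.Perm.sign_swap (by decide)]
      simp only [Finsupp.single_neg, Units.val_neg, Units.val_one, neg_smul, one_smul]
      abel
  · rcases hval z hz with rfl | rfl <;> rw [verts_two]
    · exact h
    · rwa [Finset.pair_comm]

theorem bd_edge (v u : ℕ) : bd (edge v u) = Finsupp.single ![u] 1 - Finsupp.single ![v] 1 := by
  rw [edge, map_sub, bd, Finsupp.lmapDomain_apply, Finsupp.lmapDomain_apply,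
    Finsupp.mapDomain_single, Finsupp.mapDomain_single]
  rfl

/-- In a connected complex any two vertices are homologous. -/
theorem Conn.exists_path {L : Cx} (hL : Conn L) {u v : ℕ} (hu : {u} ∈ L.faces)
    (hv : {v} ∈ L.faces) :
    ∃ p ∈ chains L 1, bd p = Finsupp.single ![v] 1 - Finsupp.single ![u] 1 := by
  refine hL (fun v => ∃ p ∈ chains L 1, bd p = Finsupp.single ![v] 1 - Finsupp.single ![u] 1)
    ?_ u v hu hv ⟨0, zero_mem _, by simp⟩
  rintro x y hxy ⟨p, hp, hbp⟩
  refine ⟨p + edge x y, add_mem hp (edge_mem hxy), ?_⟩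
  rw [map_add, hbp, bd_edge]
  abel

theorem Conn.exists_bd {L : Cx} (hL : Conn L) {q : Chain 0} (hq : q ∈ chains L 0)
    (hsum : q.sum (fun _ n => n) = 0) : ∃ p ∈ chains L 1, bd p = q := by
  by_cases h0 : q = 0
  · exact ⟨0, zero_mem _, by simp [h0]⟩
  obtain ⟨z₀, hz₀⟩ := Finsupp.ne_iff.1 h0
  have hvert : ∀ z, q z ≠ 0 → {z 0} ∈ L.faces := fun z hz =>
    vertex_mem_face (hq.1 z hz).2 (mem_verts.2 ⟨0, rfl⟩)
  have hex : ∀ z : Fin 1 → ℕ, ∃ p ∈ chains L 1, q z ≠ 0 →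
      bd p = Finsupp.single z 1 - Finsupp.single z₀ 1 := by
    intro z
    by_cases hz : q z = 0
    · exact ⟨0, zero_mem _, fun h => absurd hz h⟩
    · obtain ⟨p, hp, hbp⟩ := hL.exists_path (hvert z₀ hz₀) (hvert z hz)
      refine ⟨p, hp, fun _ => ?_⟩
      have h1 : ∀ y : Fin 1 → ℕ, ![y 0] = y := fun y => by ext i; fin_cases i; rfl
      rw [hbp, h1, h1]
  choose p hp hbp using hex
  refine ⟨q.sum fun z n => n • p z,
    Submodule.sum_mem _ fun z _ => Submodule.smul_mem _ _ (hp z), ?_⟩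
  rw [Finsupp.sum, map_sum]
  have h2 : ∀ z ∈ q.support,
      bd (q z • p z) = Finsupp.single z (q z) - q z • Finsupp.single z₀ 1 := by
    intro z hz
    rw [map_smul, hbp z (Finsupp.mem_support_iff.1 hz), smul_sub]
    simp
  rw [Finset.sum_congr rfl h2, Finset.sum_sub_distrib, ← Finset.sum_smul]
  have h3 : ∑ z ∈ q.support, q z = 0 := hsum
  have h4 : ∑ z ∈ q.support, Finsupp.single z (q z) = q := Finsupp.sum_single q
  rw [h3, h4]
  simp

/-! ### Existence of global and local potentials. -/

section Potentials

variable {T : Cx} {o : Chain 3} {f : Chain 2}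

/-- The 3-chains of a closed oriented 3-manifold are the functions on its tetrahedra. -/
theorem exists_function_of_chain (ho : IsFundamentalClass T o) {D : Chain 3}
    (hD : D ∈ chains T 3) : ∃ ψ : Finset ℕ → ℤ, ∀ z, D z = o z * ψ (verts z) := by
  classical
  let ψ : Finset ℕ → ℤ := fun τ =>
    if h : ∃ z : Fin 4 → ℕ, D z ≠ 0 ∧ verts z = τ then o h.choose * D h.choose else 0
  refine ⟨ψ, fun z => ?_⟩
  by_cases h : ∃ y : Fin 4 → ℕ, D y ≠ 0 ∧ verts y = verts z
  · have hψ : ψ (verts z) = o h.choose * D h.choose := dif_pos h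
    rw [hψ]
    obtain ⟨hy, hyz⟩ := h.choose_spec
    generalize h.choose = y at hy hyz
    by_cases hz : Function.Injective z
    · obtain ⟨π, rfl⟩ := exists_perm_of_verts_eq hz hyz
      have hoy := ho.2.2 y (hD.1 y hy).1 (hD.1 y hy).2
      rw [hD.2, ho.1.2]
      rcases hoy with h1 | h1 <;> rw [h1] <;> ring
    · rw [(isAlt_of_mem hD).eq_zero_of_not_injective hz, ho.isAlt.eq_zero_of_not_injective hz,
        zero_mul]
  · have hψ : ψ (verts z) = 0 := dif_neg h
    rw [hψ, mul_zero]
    by_contra hz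
    exact h ⟨z, hz, rfl⟩

theorem bd_eq_jump {D : Chain 3} {ψ : Finset ℕ → ℤ} (h : ∀ z, D z = o z * ψ (verts z))
    (w v u : ℕ) : bd D ![w, v, u] = jump o ψ w v u := by
  rw [bd_apply D ![w, v, u] (vset o), jump]
  · refine Finset.sum_congr rfl fun s _ => ?_
    rw [h, smul_eq_mul]
    change o ![s, w, v, u] * ψ (verts ![s, w, v, u]) = _
    rw [verts_four]
  · intro s hs
    rw [h] at hs
    exact mem_vset (left_ne_zero_of_mul hs) 0

/-- The second homology of the 3-sphere vanishes, and a filling 3-chain is a function on tetrahedra.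
-/
theorem exists_global_potential (hT : IsSphere 3 T) (ho : IsFundamentalClass T o) {c : Chain 2}
    (hc : c ∈ chains T 2) (h : bd c = 0) :
    ∃ ψ : Finset ℕ → ℤ, ∀ w v u, c ![w, v, u] = jump o ψ w v u := by
  obtain ⟨D, hD, rfl⟩ := hT.homologyVanishes (k := 1) (by norm_num) c hc h
  obtain ⟨ψ, hψ⟩ := exists_function_of_chain ho hD
  exact ⟨ψ, fun w v u => bd_eq_jump hψ w v u⟩

/-- If `c` has no boundary at `v`, its link at `v` is a 1-cycle in a 2-sphere and bounds there. The
negative cone from `v` over the filling has the same boundary as `c` on all triangles through `v`.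
-/
theorem exists_potential_of_closed (hT : IsSphere 3 T) (ho : IsFundamentalClass T o) {c : Chain 2}
    (hc : c ∈ chains T 2) {v : ℕ} (h : ∀ u, bd c ![v, u] = 0) :
    ∃ ψ : Finset ℕ → ℤ, ∀ w u, c ![w, u, v] = jump o ψ w u v := by
  have hca := isAlt_of_mem hc
  by_cases hv : {v} ∈ T.faces
  · obtain ⟨d, hd, hbd⟩ := (hT.link_vertex hv).homologyVanishes (k := 0) (by norm_num)
      (linkChain v c) (linkChain_mem hc v) (by
        ext x
        rw [bd_linkChain hca]
        have : (Fin.cons v x : Fin 2 → ℕ) = ![v, x 0] := by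
          ext l; fin_cases l <;> rfl
        rw [this, h]; rfl)
    have hD : cone v d ∈ chains T 3 := cone_mem hd fun σ hσ _ _ => hσ.2.2
    obtain ⟨ψ, hψ⟩ := exists_function_of_chain ho (neg_mem hD)
    refine ⟨ψ, fun w u => ?_⟩
    by_cases hwu : v ∈ verts ![w, u]
    · rw [hca.eq_zero_of_not_injective]
      · rw [← bd_eq_jump hψ]
        symm
        refine (isAlt_of_mem (neg_mem hD)).bd.eq_zero_of_not_injective ?_
        rw [verts_two] at hwu
        rw [injective_three]
        grind
      · rw [verts_two] at hwu
        rw [injective_three]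
        grind
    · rw [← bd_eq_jump hψ]
      have hcyc : ∀ b : Chain 2, IsAlt b → b ![w, u, v] = b ![v, w, u] := fun b hb => by
        rw [hb.tri12 w v u, hb.tri01 v w u, neg_neg]
      rw [hcyc c hca, hcyc _ (isAlt_of_mem (neg_mem hD)).bd, map_neg, Finsupp.neg_apply]
      have := bd_cone_apply_cons (c := d) (v := v) (fun z hz => (hd.1 z hz).2.2.1) hwu
      change bd (cone v d) ![v, w, u] = _ at this
      rw [this, hbd, neg_neg]
      rfl
  · refine ⟨0, fun w u => ?_⟩
    rw [jump_eq_zero_of_notMem ho]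
    · by_contra hne
      refine hv (vertex_mem_face (hc.1 _ hne).2 ?_)
      rw [verts_three]; simp
    · exact fun hF => hv (vertex_mem_face hF (by simp))

/-- The family `φ` of functions on tetrahedra, indexed by the vertices, consists of local potentials
of the 2-chain `c` away from the surface `f`. -/
def IsPotential {E : Type*} [AddCommGroup E] (o : Chain 3) (f : Chain 2) (c : ℕ → ℕ → ℕ → E)
    (φ : ℕ → Finset ℕ → E) : Prop :=
  ∀ w u v, f ![w, u, v] = 0 → c w u v = jump o (φ v) w u v

/-- Near a vertex of the surface, the boundary of `c` is first cancelled by a cone inside the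
surface. This is possible because the link of the vertex in the surface is connected and the
boundary of the link chain has augmentation zero. The correction does not affect triangles off the
surface. -/
theorem exists_potential (hT : IsSphere 3 T) (ho : IsFundamentalClass T o) (hf : IsSurface T f)
    {c : Chain 2} (hc : c ∈ chains T 2)
    (h : ∀ v u, bd c ![v, u] ≠ 0 → {v, u} ∈ (supp f).faces) :
    ∃ φ : ℕ → Finset ℕ → ℤ, IsPotential o f (fun w u v => c ![w, u, v]) φ := by
  suffices hv : ∀ v, ∃ ψ : Finset ℕ → ℤ, ∀ w u, f ![w, u, v] = 0 →
      c ![w, u, v] = jump o ψ w u v by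
    choose φ hφ using hv
    exact ⟨φ, fun w u v h0 => hφ v w u h0⟩
  intro v
  have hca := isAlt_of_mem hc
  have hcons : ∀ x : Fin 1 → ℕ, (Fin.cons v x : Fin 2 → ℕ) = ![v, x 0] := fun x => by
    ext l; fin_cases l <;> rfl
  by_cases hvf : {v} ∈ (supp f).faces
  · have hq : bd (linkChain v c) ∈ chains (link (supp f) v) 0 := by
      refine mem_chains_of_isAlt (hca.linkChain v).bd fun z _ hz => ?_
      rw [bd_linkChain hca, neg_ne_zero, hcons] at hz
      have h1 := h v (z 0) hz
      have h2 := injective_two.1 (hca.bd.injective_of_ne_zero hz)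
      have hvz : verts z = {z 0} := by
        ext x; simp [verts]
      refine ⟨verts_nonempty z, ?_, ?_⟩
      · rw [hvz]; simpa using h2
      · rw [hvz]; exact h1
    obtain ⟨ρ, hρ, hbρ⟩ := (hf.conn_link v hvf).exists_bd hq (sum_bd_zero (hca.linkChain v))
    have hcone : cone v ρ ∈ chains (supp f) 2 := cone_mem hρ fun σ hσ _ _ => hσ.2.2
    have hsub : (supp f).faces ⊆ T.faces := by
      rintro σ ⟨hn, z, hz, hσ⟩
      exact face_mono (hf.mem.1 z hz).2 hσ hn
    obtain ⟨ψ, hψ⟩ := exists_potential_of_closed hT ho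
      (sub_mem hc (chains_mono hsub hcone)) (v := v) (fun u => by
        by_cases huv : u = v
        · subst huv
          exact (isAlt_of_mem (sub_mem hc (chains_mono hsub hcone))).bd.eq_zero_of_not_injective
            (by rw [injective_two]; simp)
        · rw [map_sub, Finsupp.sub_apply]
          have h1 := bd_cone_apply_cons (c := ρ) (v := v) (fun z hz => (hρ.1 z hz).2.2.1)
            (x := ![u]) (by simpa [verts] using Ne.symm huv)
          have h2 := bd_linkChain hca v ![u]
          rw [hcons] at h1 h2
          change bd (cone v ρ) ![v, u] = _ at h1
          change _ = -bd c ![v, u] at h2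
          rw [h1, hbρ, h2]
          simp)
    refine ⟨ψ, fun w u h0 => ?_⟩
    rw [← hψ, Finsupp.sub_apply]
    have : cone v ρ ![w, u, v] = 0 := by
      by_contra hne
      have h3 := hcone.1 _ hne
      have h4 := injective_three.1 h3.1
      rw [verts_three] at h3
      exact (hf.isAlt.triangle_mem_supp h4.1 h4.2.1 h4.2.2).1 h3.2 h0
    rw [this, sub_zero]
  · obtain ⟨ψ, hψ⟩ := exists_potential_of_closed hT ho hc (v := v) (fun u => by
      by_contra hne
      exact hvf (vertex_mem_face (h v u hne) (by simp)))
    exact ⟨ψ, fun w u _ => hψ w u⟩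

theorem exists_potential_off (hT : IsSphere 3 T) (ho : IsFundamentalClass T o)
    {c : Chain 2} (hc : c ∈ chains T 2) :
    ∃ φ : ℕ → Finset ℕ → ℤ, ∀ v, {v} ∉ (supp (bd c)).faces →
      ∀ w u, c ![w, u, v] = jump o (φ v) w u v := by
  have hv : ∀ v, ∃ ψ : Finset ℕ → ℤ, {v} ∉ (supp (bd c)).faces →
      ∀ w u, c ![w, u, v] = jump o ψ w u v := by
    intro v
    by_cases hvx : {v} ∈ (supp (bd c)).faces
    · exact ⟨0, fun h => absurd hvx h⟩
    · obtain ⟨ψ, hψ⟩ := exists_potential_of_closed hT ho hc (v := v) (fun u => by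
        by_contra hne
        exact hvx (mem_supp_of_ne_zero hne (by rw [verts_two]; simp)))
      exact ⟨ψ, fun _ => hψ⟩
  choose φ hφ using hv
  exact ⟨φ, hφ⟩

end Potentials

/-! ### Pairing of 1-chains with functions on oriented edges -/

section Pairing

variable {E : Type*} [AddCommGroup E]

/-- The pairing of a 1-chain with a function on oriented edges. -/
def pairing (S : Finset ℕ) (a : Chain 1) (q : ℕ → ℕ → E) : E :=
  ∑ v ∈ S, ∑ u ∈ S, a ![v, u] • q v u

theorem pairing_congr {S : Finset ℕ} {a : Chain 1} {q q' : ℕ → ℕ → E}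
    (h : ∀ v u, a ![v, u] ≠ 0 → q v u = q' v u) : pairing S a q = pairing S a q' := by
  refine Finset.sum_congr rfl fun v _ => Finset.sum_congr rfl fun u _ => ?_
  by_cases h0 : a ![v, u] = 0
  · rw [h0, zero_smul, zero_smul]
  · rw [h v u h0]

theorem pairing_add (S : Finset ℕ) (a : Chain 1) (q q' : ℕ → ℕ → E) :
    pairing S a (fun v u => q v u + q' v u) = pairing S a q + pairing S a q' := by
  simp only [pairing, smul_add, Finset.sum_add_distrib]

theorem pairing_sub (S : Finset ℕ) (a : Chain 1) (q q' : ℕ → ℕ → E) :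
    pairing S a (fun v u => q v u - q' v u) = pairing S a q - pairing S a q' := by
  simp only [pairing, smul_sub, Finset.sum_sub_distrib]

theorem pairing_map {F : Type*} [AddCommGroup F] (ℓ : E →+ F) (S : Finset ℕ) (a : Chain 1)
    (q : ℕ → ℕ → E) : pairing S a (fun v u => ℓ (q v u)) = ℓ (pairing S a q) := by
  simp only [pairing, map_sum, map_zsmul]

theorem pairing_smul (S : Finset ℕ) (a : Chain 1) (q : ℕ → ℕ → ℤ) (e : E) :
    pairing S a (fun v u => q v u • e) = pairing S a q • e := by
  simp only [pairing, Finset.sum_smul, smul_assoc]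

theorem pairing_add_left (S : Finset ℕ) (a b : Chain 1) (q : ℕ → ℕ → E) :
    pairing S (a + b) q = pairing S a q + pairing S b q := by
  simp only [pairing, Finsupp.add_apply, add_smul, Finset.sum_add_distrib]

theorem pairing_eq_zero_of_symm [Module.IsTorsionFree ℤ E] (S : Finset ℕ) {a : Chain 1}
    (ha : IsAlt a) {q : ℕ → ℕ → E} (hq : ∀ v u, q v u = q u v) : pairing S a q = 0 :=
  sum_sum_antisymm S _ fun x y => by rw [ha.swap01 x y, hq, neg_smul]

theorem pairing_eq_zero_of_cycle {S : Finset ℕ} {a : Chain 1} (ha : IsAlt a) (hbd : bd a = 0)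
    (hS : ∀ v u, a ![v, u] ≠ 0 → v ∈ S) (κ : ℕ → E) : pairing S a (fun v _ => κ v) = 0 := by
  refine Finset.sum_eq_zero fun v _ => ?_
  rw [← Finset.sum_smul]
  have h := bd_apply a ![v] S (fun u hu => hS u v hu)
  rw [hbd] at h
  have : ∑ u ∈ S, a ![v, u] = 0 := by
    rw [← neg_eq_zero, ← Finset.sum_neg_distrib]
    refine Eq.trans (Finset.sum_congr rfl fun u _ => ?_) h.symm
    exact (ha.swap01 v u).symm
  rw [this, zero_smul]

theorem pairing_edge {S : Finset ℕ} {v u : ℕ} (hv : v ∈ S) (hu : u ∈ S)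
    (q : ℕ → ℕ → E) : pairing S (edge v u) q = q v u - q u v := by
  have hval : ∀ x y, edge v u ![x, y] =
      (if x = v ∧ y = u then 1 else 0) - (if x = u ∧ y = v then 1 else 0) := by
    intro x y
    have hp : ∀ p r : ℕ, (![p, r] = ![x, y]) = (x = p ∧ y = r) := by
      intro p r
      simp only [Matrix.vecCons_inj, and_true, eq_iff_iff]
      constructor <;> rintro ⟨rfl, rfl⟩ <;> simp
    rw [edge, Finsupp.sub_apply, Finsupp.single_apply, Finsupp.single_apply]
    simp only [hp]
  unfold pairing
  simp only [hval, sub_smul, Finset.sum_sub_distrib, ite_smul, one_smul, zero_smul]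
  congr 1
  · rw [Finset.sum_eq_single v, Finset.sum_eq_single u]
    · simp
    · intro y _ hy; simp [hy]
    · intro h; exact absurd hu h
    · intro x _ hx
      refine Finset.sum_eq_zero fun y _ => ?_
      simp [hx]
    · intro h; exact absurd hv h
  · rw [Finset.sum_eq_single u, Finset.sum_eq_single v]
    · simp
    · intro y _ hy; simp [hy]
    · intro h; exact absurd hv h
    · intro x _ hx
      refine Finset.sum_eq_zero fun y _ => ?_
      simp [hx]
    · intro h; exact absurd hu h

end Pairing

/-! ### Tetrahedra at the edges -/

section EdgeTets

variable {T : Cx} {o : Chain 3} {f : Chain 2} {E : Type*} [AddCommGroup E]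

/-- A choice of a tetrahedron at every edge. -/
def IsEdgeTet (T : Cx) (o : Chain 3) (t : ℕ → ℕ → Finset ℕ) : Prop :=
  (∀ v u, t v u = t u v) ∧ ∀ v u, v ≠ u → {v, u} ∈ T.faces →
    ∃ s w, o ![s, w, v, u] ≠ 0 ∧ t v u = {s, w, v, u}

/-- A choice of a triangle of the surface at every edge of the surface; `P` is the tetrahedron on
its positive side, and `N` the one on its negative side. -/
structure IsSideTets (T : Cx) (o : Chain 3) (f : Chain 2) (P N : ℕ → ℕ → Finset ℕ) : Prop where
  pos : IsEdgeTet T o P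
  neg : IsEdgeTet T o N
  exists_triangle : ∀ v u, v ≠ u → {v, u} ∈ (supp f).faces → ∃ w s s',
    o ![s, w, v, u] * f ![w, v, u] = -1 ∧ o ![s', w, v, u] * f ![w, v, u] = 1 ∧
      P v u = {s, w, v, u} ∧ N v u = {s', w, v, u}

theorem exists_tet_of_edge (hT : IsSphere 3 T) (ho : IsFundamentalClass T o) {v u : ℕ}
    (hvu : v ≠ u) (h : {v, u} ∈ T.faces) : ∃ s w, o ![s, w, v, u] ≠ 0 := by
  obtain ⟨τ, hτ⟩ := (hT.link_edge hvu h).nonempty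
  rw [mem_link_link] at hτ
  obtain ⟨w, hw⟩ := hτ.1
  obtain ⟨s, -, -, h, -⟩ := exists_two_cofaces hT ho (w := w) (v := v) (u := u)
    (by grind) (by grind) hvu (face_mono hτ.2.2.2 (by grind) (Finset.insert_nonempty _ _))
  exact ⟨s, w, h⟩

theorem IsSurface.supp_subset (hf : IsSurface T f) : (supp f).faces ⊆ T.faces := by
  rintro σ ⟨hn, z, hz, hσ⟩
  exact face_mono (hf.mem.1 z hz).2 hσ hn

theorem exists_sideTets (hT : IsSphere 3 T) (ho : IsFundamentalClass T o) (hf : IsSurface T f) :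
    ∃ P N, IsSideTets T o f P N := by
  have hex : ∀ v u : ℕ, ∃ p n : Finset ℕ, v ≠ u → {v, u} ∈ T.faces →
      (∃ s w, o ![s, w, v, u] ≠ 0 ∧ p = {s, w, v, u}) ∧
      (∃ s w, o ![s, w, v, u] ≠ 0 ∧ n = {s, w, v, u}) ∧
      ({v, u} ∈ (supp f).faces → ∃ w s s',
        o ![s, w, v, u] * f ![w, v, u] = -1 ∧ o ![s', w, v, u] * f ![w, v, u] = 1 ∧
        p = {s, w, v, u} ∧ n = {s', w, v, u}) := by
    intro v u
    by_cases hvu : v ≠ u ∧ {v, u} ∈ T.faces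
    · by_cases hfe : {v, u} ∈ (supp f).faces
      · obtain ⟨w, hw⟩ := hf.isAlt.exists_of_edge_mem_supp hvu.1 hfe
        obtain ⟨s, s', -, h1, h2⟩ := exists_side hT ho hf hw
        refine ⟨{s, w, v, u}, {s', w, v, u}, fun _ _ => ⟨⟨s, w, fun h => ?_, rfl⟩,
          ⟨s', w, fun h => ?_, rfl⟩, fun _ => ⟨w, s, s', h1, h2, rfl, rfl⟩⟩⟩
        · rw [h] at h1; simp at h1
        · rw [h] at h2; simp at h2
      · obtain ⟨s, w, h⟩ := exists_tet_of_edge hT ho hvu.1 hvu.2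
        exact ⟨{s, w, v, u}, {s, w, v, u}, fun _ _ => ⟨⟨s, w, h, rfl⟩, ⟨s, w, h, rfl⟩,
          fun h => absurd h hfe⟩⟩
    · exact ⟨∅, ∅, fun h1 h2 => absurd ⟨h1, h2⟩ hvu⟩
  choose p n hpn using hex
  have ho' : ∀ s w v u, o ![s, w, u, v] ≠ 0 → o ![s, w, v, u] ≠ 0 := fun s w v u h => by
    rw [ho.isAlt.tet23 s w u v]; simpa using h
  -- The choices are made for the ordered pair (min, max), so that they do not depend on the
  -- direction of the edge.
  have key : ∀ v u, v ≠ u → {v, u} ∈ T.faces →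
      (∃ s w, o ![s, w, v, u] ≠ 0 ∧ p (min v u) (max v u) = {s, w, v, u}) ∧
      (∃ s w, o ![s, w, v, u] ≠ 0 ∧ n (min v u) (max v u) = {s, w, v, u}) ∧
      ({v, u} ∈ (supp f).faces → ∃ w s s',
        o ![s, w, v, u] * f ![w, v, u] = -1 ∧ o ![s', w, v, u] * f ![w, v, u] = 1 ∧
        p (min v u) (max v u) = {s, w, v, u} ∧ n (min v u) (max v u) = {s', w, v, u}) := by
    intro v u hvu hF
    rcases lt_or_gt_of_ne hvu with hlt | hlt
    · rw [min_eq_left hlt.le, max_eq_right hlt.le]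
      exact hpn v u hvu hF
    · rw [min_eq_right hlt.le, max_eq_left hlt.le]
      obtain ⟨⟨s, w, h1, h2⟩, ⟨s', w', h3, h4⟩, h5⟩ := hpn u v hvu.symm (by rwa [Finset.pair_comm])
      refine ⟨⟨s, w, ho' _ _ _ _ h1, by rw [h2, Finset.pair_comm]⟩,
        ⟨s', w', ho' _ _ _ _ h3, by rw [h4, Finset.pair_comm]⟩, fun h => ?_⟩
      obtain ⟨w, s, s', h6, h7, h8, h9⟩ := h5 (by rwa [Finset.pair_comm])
      refine ⟨w, s, s', ?_, ?_, by rw [h8, Finset.pair_comm], by rw [h9, Finset.pair_comm]⟩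
      · rw [ho.isAlt.tet23 s w u v, hf.isAlt.tri12 w u v, neg_mul_neg, h6]
      · rw [ho.isAlt.tet23 s' w u v, hf.isAlt.tri12 w u v, neg_mul_neg, h7]
  refine ⟨fun v u => p (min v u) (max v u), fun v u => n (min v u) (max v u),
    ⟨fun v u => by dsimp only; rw [min_comm, max_comm], fun v u h1 h2 => (key v u h1 h2).1⟩,
    ⟨fun v u => by dsimp only; rw [min_comm, max_comm], fun v u h1 h2 => (key v u h1 h2).2.1⟩,
    fun v u h1 h2 => (key v u h1 (hf.supp_subset h2)).2.2 h2⟩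

/-- The chosen tetrahedra on the side of the surface with sign `δ`. -/
def IsSide (o : Chain 3) (f : Chain 2) (δ : ℤ) (t : ℕ → ℕ → Finset ℕ) : Prop :=
  ∀ v u, v ≠ u → {v, u} ∈ (supp f).faces →
    ∃ w s, o ![s, w, v, u] * f ![w, v, u] = δ ∧ t v u = {s, w, v, u}

theorem IsSideTets.isSide_pos {P N : ℕ → ℕ → Finset ℕ} (h : IsSideTets T o f P N) :
    IsSide o f (-1) P := fun v u h1 h2 => by
  obtain ⟨w, s, s', h3, -, h4, -⟩ := h.exists_triangle v u h1 h2
  exact ⟨w, s, h3, h4⟩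

theorem IsSideTets.isSide_neg {P N : ℕ → ℕ → Finset ℕ} (h : IsSideTets T o f P N) :
    IsSide o f 1 N := fun v u h1 h2 => by
  obtain ⟨w, s, s', -, h3, -, h4⟩ := h.exists_triangle v u h1 h2
  exact ⟨w, s', h3, h4⟩

theorem edge_of_ne_zero {F : Cx} {a : Chain 1} (ha : a ∈ chains F 1) {v u : ℕ}
    (h : a ![v, u] ≠ 0) : v ≠ u ∧ {v, u} ∈ F.faces := by
  have := ha.1 _ h
  rw [injective_two, verts_two] at this
  exact this

/-- Functions which are locally constant around the vertices of the surface, away from the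
surface, pair trivially with cycles. -/
theorem exists_side_value (hT : IsSphere 3 T) (ho : IsFundamentalClass T o) (hf : IsSurface T f)
    {δ : ℤ} (hδ : δ = 1 ∨ δ = -1) {k : ℕ → Finset ℕ → E}
    (hk : ∀ w u v, f ![w, u, v] = 0 → jump o (k v) w u v = 0) :
    ∃ κ : ℕ → E, ∀ s w u v, o ![s, w, u, v] * f ![w, u, v] = δ → k v {s, w, u, v} = κ v := by
  have hex : ∀ v, ∃ e : E, ∀ s w u, o ![s, w, u, v] * f ![w, u, v] = δ → k v {s, w, u, v} = e := by
    intro v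
    by_cases h : ∃ s w u, o ![s, w, u, v] * f ![w, u, v] = δ
    · obtain ⟨s, w, u, h⟩ := h
      exact ⟨k v {s, w, u, v}, fun s' w' u' h' =>
        eq_of_same_side_vertex hT ho hf (fun w u h0 => hk w u v h0) hδ h' h⟩
    · push Not at h
      exact ⟨0, fun s w u h' => absurd h' (h s w u)⟩
  choose κ hκ using hex
  exact ⟨κ, fun s w u v h => hκ v s w u h⟩

/-- On one side of the surface the value at an edge vu depends on `v` alone, and a cycle pairs to
zero with a function of the initial vertex. -/
theorem pairing_side_eq_zero (hT : IsSphere 3 T) (ho : IsFundamentalClass T o) (hf : IsSurface T f)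
    {δ : ℤ} (hδ : δ = 1 ∨ δ = -1) {t : ℕ → ℕ → Finset ℕ} (ht : IsSide o f δ t)
    {k : ℕ → Finset ℕ → E} (hk : ∀ w u v, f ![w, u, v] = 0 → jump o (k v) w u v = 0)
    {a : Chain 1} (ha : a ∈ cycles (supp f)) :
    pairing (vset o) a (fun v u => k v (t v u)) = 0 := by
  obtain ⟨κ, hκ⟩ := exists_side_value hT ho hf hδ hk
  rw [pairing_congr (q' := fun v _ => κ v)]
  · exact pairing_eq_zero_of_cycle (isAlt_of_mem ha.1) ha.2 (fun v u h =>
      mem_vset_of_mem hT ho (vertex_mem_face (hf.supp_subset (edge_of_ne_zero ha.1 h).2)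
        (by simp))) κ
  · intro v u h
    obtain ⟨hne, hF⟩ := edge_of_ne_zero ha.1 h
    obtain ⟨w, s, h1, h2⟩ := ht v u hne hF
    rw [h2, Finset.pair_comm]
    refine hκ s w u v ?_
    rw [ho.isAlt.tet23 s w v u, hf.isAlt.tri12 w v u, neg_mul_neg, h1]

end EdgeTets

/-! ### Linking numbers in terms of potentials -/

section Tracks

variable {T : Cx} {o : Chain 3} {f : Chain 2}

theorem Track.mem {c : Chain 2} {tOK : ℕ → Finset ℕ → Prop}
    {aOK : ℕ → ℕ → Finset ℕ → Prop} {s s' : ℕ × Finset ℕ} {a : Chain 1} {n : ℤ}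
    (h : Track T o c tOK aOK s s' a n) : s'.2 ∈ T.faces ∧ s'.2.card = 4 ∧ s'.1 ∈ s'.2 := by
  induction h with
  | nil v t ht h4 hv => exact ⟨ht, h4, hv⟩
  | turn s v w w' x a n h hw hw' hne hx hT hv hok ih =>
    refine ⟨hT, ?_, Finset.mem_insert_of_mem hv⟩
    rw [Finset.card_insert_of_notMem hw', card_verts hx]
  | advance s v u t a n h hu hne hok ih => exact ⟨ih.1, ih.2.1, hu⟩

/-- The intersection number is a telescoping sum. A turn changes the potential of the current vertex
by its jump; an advance along vu replaces the potential of `v` by that of `u` in the same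
tetrahedron, and `q` records the difference. -/
theorem Track.count {c : Chain 2} {tOK : ℕ → Finset ℕ → Prop}
    {aOK : ℕ → ℕ → Finset ℕ → Prop} {s s' : ℕ × Finset ℕ} {a : Chain 1} {n : ℤ}
    (h : Track T o c tOK aOK s s' a n) (φ : ℕ → Finset ℕ → ℤ) (q : ℕ → ℕ → ℤ) (S : Finset ℕ)
    (hS : ∀ v, {v} ∈ T.faces → v ∈ S)
    (hturn : ∀ v w w' x, w ∉ verts x → w' ∉ verts x → w ≠ w' → Function.Injective x →
      insert w (verts x) ∈ T.faces → insert w' (verts x) ∈ T.faces → v ∈ verts x →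
      tOK v (verts x) →
      o (Fin.cons w x) * c x = φ v (insert w (verts x)) - φ v (insert w' (verts x)))
    (hadv : ∀ v u t, t ∈ T.faces → t.card = 4 → v ∈ t → u ∈ t → u ≠ v → aOK v u t →
      q v u - q u v = φ v t - φ u t) :
    n = φ s.1 s.2 - φ s'.1 s'.2 - pairing S a q := by
  induction h with
  | nil v t ht h4 hv => simp [pairing]
  | turn s v w w' x a n h hw hw' hne hx hT hv hok ih =>
    rw [hturn v w w' x hw hw' hne hx h.mem.1 hT hv hok, ih]
    ring
  | advance s v u t a n h hu hne hok ih =>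
    have hm := h.mem
    rw [pairing_add_left, pairing_edge (hS v (vertex_mem_face hm.1 hm.2.2))
      (hS u (vertex_mem_face hm.1 hu)), hadv v u t hm.1 hm.2.1 hm.2.2 hu hne hok, ih]
    ring

theorem exists_perm_last {x : Fin 3 → ℕ} {v : ℕ} (hv : v ∈ verts x) :
    ∃ (σ : Equiv.Perm (Fin 3)) (p q : ℕ), x ∘ σ = ![p, q, v] := by
  obtain ⟨i, rfl⟩ := mem_verts.1 hv
  refine ⟨Equiv.swap i 2, (x ∘ Equiv.swap i 2) 0, (x ∘ Equiv.swap i 2) 1, ?_⟩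
  ext l
  fin_cases l
  · rfl
  · rfl
  · simp

theorem mul_comp_perm {c : Chain 2} (ho : IsAlt o) (hc : IsAlt c) (w : ℕ) (x : Fin 3 → ℕ)
    (σ : Equiv.Perm (Fin 3)) :
    o (Fin.cons w (x ∘ σ)) * c (x ∘ σ) = o (Fin.cons w x) * c x := by
  rw [← cons_comp_permCons, ho, hc, sign_permCons]
  rcases Int.units_eq_one_or (Equiv.Perm.sign σ) with h | h <;> simp [h]

/-- The change of a potential when a triangle is crossed. -/
theorem turn_of_potential (hT : IsSphere 3 T) (ho : IsFundamentalClass T o) {c : Chain 2}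
    (hc : IsAlt c) {φ : Finset ℕ → ℤ} {v w w' : ℕ} {x : Fin 3 → ℕ} (hw : w ∉ verts x)
    (hw' : w' ∉ verts x) (hne : w ≠ w') (hx : Function.Injective x)
    (hF : insert w (verts x) ∈ T.faces) (hF' : insert w' (verts x) ∈ T.faces) (hv : v ∈ verts x)
    (h : ∀ p q, verts x = {p, q, v} → c ![p, q, v] = jump o φ p q v) :
    o (Fin.cons w x) * c x = φ (insert w (verts x)) - φ (insert w' (verts x)) := by
  obtain ⟨σ, p, q, hσ⟩ := exists_perm_last hv
  have hvx : verts x = {p, q, v} := by rw [← verts_comp_perm x σ, hσ, verts_three]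
  have hinj : Function.Injective ![p, q, v] := hσ ▸ hx.comp σ.injective
  rw [injective_three] at hinj
  rw [← mul_comp_perm ho.isAlt hc w x σ, hσ, h p q hvx]
  rw [hvx] at hw hw' hF hF' ⊢
  have h1 : o ![w, p, q, v] ≠ 0 := ho.ne_zero_iff.2 ⟨by grind, hF⟩
  have h2 : o ![w', p, q, v] ≠ 0 := ho.ne_zero_iff.2 ⟨by grind, hF'⟩
  rw [jump_eq hT ho φ h1 h2 hne]
  change o ![w, p, q, v] * (o ![w, p, q, v] • _) = _
  rcases ho.eq_or h1 with h3 | h3 <;> rw [h3] <;> simp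

theorem exists_tuple_of_tet (ho : IsFundamentalClass T o) {t : Finset ℕ} (ht : t ∈ T.faces)
    (h4 : t.card = 4) {v u : ℕ} (hv : v ∈ t) (hu : u ∈ t) (hne : v ≠ u) :
    ∃ s w, o ![s, w, v, u] ≠ 0 ∧ t = {s, w, v, u} := by
  have hc : (t \ {v, u}).card = 2 := by
    rw [Finset.card_sdiff_of_subset (by grind), h4, Finset.card_pair hne]
  obtain ⟨s, w, hsw, he⟩ := Finset.card_eq_two.1 hc
  have htt : t = {s, w, v, u} := by
    have : t = (t \ {v, u}) ∪ {v, u} := by grind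
    rw [this, he]
    grind
  refine ⟨s, w, ho.ne_zero_iff.2 ⟨?_, htt ▸ ht⟩, htt⟩
  have hs : s ∈ t \ {v, u} := by rw [he]; simp
  have hw : w ∈ t \ {v, u} := by rw [he]; simp
  grind

theorem jump_add {E : Type*} [AddCommGroup E] (o : Chain 3) (ψ χ : Finset ℕ → E) (w v u : ℕ) :
    jump o (fun τ => ψ τ + χ τ) w v u = jump o ψ w v u + jump o χ w v u := by
  simp only [jump, smul_add, Finset.sum_add_distrib]

theorem jump_sub {E : Type*} [AddCommGroup E] (o : Chain 3) (ψ χ : Finset ℕ → E) (w v u : ℕ) :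
    jump o (fun τ => ψ τ - χ τ) w v u = jump o ψ w v u - jump o χ w v u := by
  simp only [jump, smul_sub, Finset.sum_sub_distrib]

theorem jump_smul {E : Type*} [AddCommGroup E] (o : Chain 3) (ψ : Finset ℕ → ℤ) (e : E)
    (w v u : ℕ) : jump o (fun τ => ψ τ • e) w v u = jump o ψ w v u • e := by
  simp only [jump, Finset.sum_smul, smul_assoc]

theorem eq_potential_add (hT : IsSphere 3 T) (ho : IsFundamentalClass T o) {c c' : Chain 2}
    (hc : c ∈ chains T 2) (hc' : c' ∈ chains T 2) (hbd : bd c = bd c') :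
    ∃ ψ : Finset ℕ → ℤ, ∀ w v u, c ![w, v, u] = c' ![w, v, u] + jump o ψ w v u := by
  obtain ⟨ψ, hψ⟩ := exists_global_potential hT ho (sub_mem hc hc') (by rw [map_sub, hbd, sub_self])
  refine ⟨ψ, fun w v u => ?_⟩
  rw [← hψ, Finsupp.sub_apply]
  ring

/-- At an edge off `x` the difference of the potentials of its two ends does not jump, so it is the
same in all tetrahedra around the edge. Hence any choice `t` computes the telescoping sum along a
closed track. Another 2-chain bounded by `x` changes the potentials by a global function, which adds
a term symmetric in the ends of the edge and pairs to zero. -/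
theorem linkingNumber_eq (hT : IsSphere 3 T) (ho : IsFundamentalClass T o) {x a : Chain 1} {n : ℤ}
    (h : IsLinkingNumber T o x a n) (haalt : IsAlt a) {c : Chain 2} (hc : c ∈ chains T 2)
    (hbd : bd c = x)
    {φ : ℕ → Finset ℕ → ℤ} (hφ : ∀ v, {v} ∉ (supp x).faces →
      ∀ w u, c ![w, u, v] = jump o (φ v) w u v) {t : ℕ → ℕ → Finset ℕ} (ht : IsEdgeTet T o t) :
    pairing (vset o) a (fun v u => φ v (t v u)) = -n := by
  obtain ⟨c', hc', hbd', s, htr⟩ := h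
  obtain ⟨ψ, hψ⟩ := eq_potential_add hT ho hc' hc (hbd'.trans hbd.symm)
  have hpot : ∀ v, {v} ∉ (supp x).faces → ∀ w u,
      c' ![w, u, v] = jump o (fun τ => φ v τ + ψ τ) w u v := by
    intro v hv w u
    rw [jump_add, hψ, hφ v hv]
  have hcnt := htr.count (fun v τ => φ v τ + ψ τ) (fun v u => φ v (t v u) + ψ (t v u)) (vset o)
    (fun v hv => mem_vset_of_mem hT ho hv)
    (fun v w w' x hw hw' hne hx hF hF' hv hok =>
      turn_of_potential hT ho (isAlt_of_mem hc') hw hw' hne hx hF hF' hv fun p q _ =>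
        hpot v hok p q)
    (by
      intro v u τ hτ h4 hv hu hne hok
      obtain ⟨s, w, h1, rfl⟩ := exists_tuple_of_tet ho hτ h4 hv hu hne.symm
      obtain ⟨s', w', h2, h3⟩ := ht.2 v u hne.symm (face_mono hτ (by grind)
        (Finset.insert_nonempty _ _))
      have hdiff := eq_around_edge hT ho (v := v) (u := u)
        (ψ := fun τ => (φ v τ + ψ τ) - (φ u τ + ψ τ)) (fun w => by
          rw [jump_sub, ← hpot u hok.2 w v, jump_swap12 ho _ w u v, ← hpot v hok.1 w u,
            (isAlt_of_mem hc').tri12 w v u, neg_neg, sub_self]) h1 h2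
      rw [ht.1 u v, h3]
      exact hdiff.symm)
  rw [sub_self, zero_sub, pairing_add, pairing_eq_zero_of_symm (vset o) haalt
    (q := fun v u => ψ (t v u)) (fun v u => by rw [ht.1]), add_zero] at hcnt
  rw [hcnt, neg_neg]

/-- With these orientation conventions the positive side is the one where the product of the
coefficients of `o` and `f` is -1. Rotation that avoids the surface crosses no jump of `ψ`. -/
theorem onPositiveSide_eq (hT : IsSphere 3 T) (ho : IsFundamentalClass T o) (hf : IsSurface T f)
    {v u : ℕ} (hvu : v ≠ u) {ψ : Finset ℕ → ℤ} (hψ : ∀ w, f ![w, v, u] = 0 → jump o ψ w v u = 0)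
    {τ : Finset ℕ} (h : OnPositiveSide T o f {v, u} τ) {s₀ w₀ : ℕ}
    (h₀ : o ![s₀, w₀, v, u] * f ![w₀, v, u] = -1) :
    ψ τ = ψ {s₀, w₀, v, u} ∧ τ ∈ T.faces ∧ τ.card = 4 := by
  induction h with
  | base w x hx hw =>
    have hox : o (Fin.cons w x) ≠ 0 := fun h0 => by rw [h0] at hw; simp at hw
    have hfx : f x ≠ 0 := fun h0 => by rw [h0] at hw; simp at hw
    have hm := ho.1.1 _ hox
    have hc := card_verts hm.1
    rw [verts_cons] at hm hc
    refine ⟨?_, hm.2, hc⟩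
    have hxi := hf.isAlt.injective_of_ne_zero hfx
    obtain ⟨p, hp⟩ : (verts x \ {v, u}).Nonempty := by
      rw [← Finset.card_pos, Finset.card_sdiff_of_subset hx, card_verts hxi, Finset.card_pair hvu]
      norm_num
    rw [Finset.mem_sdiff] at hp
    have hvx : verts x = {p, v, u} := by
      refine (Finset.eq_of_subset_of_card_le (Finset.insert_subset hp.1 hx) ?_).symm
      rw [card_verts hxi, Finset.card_eq_three.2 ⟨p, v, u, by grind, by grind, hvu, rfl⟩]
    obtain ⟨π, hπ⟩ := exists_perm_of_verts_eq (z := x) (z' := ![p, v, u])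
      (injective_three.2 (by grind)) (by rw [hvx, verts_three])
    have h1 : o ![w, p, v, u] * f ![p, v, u] = -1 := by
      have := mul_comp_perm ho.isAlt hf.isAlt w x π
      rw [← hπ, hw] at this
      exact this
    rw [hvx]
    exact eq_of_same_side hT ho hf hψ (Or.inr rfl) h1 h₀
  | rotate t t' h ht' h4 h3 he hft ih =>
    obtain ⟨ih1, ih2, ih3⟩ := ih
    refine ⟨?_, ht', h4⟩
    obtain ⟨p, hp⟩ : ((t ∩ t') \ {v, u}).Nonempty := by
      rw [← Finset.card_pos, Finset.card_sdiff_of_subset he, h3, Finset.card_pair hvu]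
      norm_num
    rw [Finset.mem_sdiff] at hp
    have htt : t ∩ t' = {p, v, u} := by
      refine (Finset.eq_of_subset_of_card_le (Finset.insert_subset hp.1 he) ?_).symm
      rw [h3, Finset.card_eq_three.2 ⟨p, v, u, by grind, by grind, hvu, rfl⟩]
    have hform : ∀ t₁ : Finset ℕ, t₁ ∈ T.faces → t₁.card = 4 → t ∩ t' ⊆ t₁ →
        ∃ s, o ![s, p, v, u] ≠ 0 ∧ t₁ = {s, p, v, u} := by
      intro t₁ h1 h2 h5
      have hc : (t₁ \ (t ∩ t')).card = 1 := by
        rw [Finset.card_sdiff_of_subset h5, h2, h3]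
      obtain ⟨s, hs⟩ := Finset.card_eq_one.1 hc
      have hst : s ∈ t₁ \ (t ∩ t') := by rw [hs]; simp
      have heq : t₁ = {s, p, v, u} := by
        have h6 : t₁ = (t₁ \ (t ∩ t')) ∪ (t ∩ t') := (Finset.sdiff_union_of_subset h5).symm
        rw [h6, hs, htt]
        rfl
      refine ⟨s, ho.ne_zero_iff.2 ⟨?_, heq ▸ h1⟩, heq⟩
      rw [htt] at hst
      grind
    obtain ⟨s, hs, hs'⟩ := hform t ih2 ih3 Finset.inter_subset_left
    obtain ⟨s', hs1, hs1'⟩ := hform t' ht' h4 Finset.inter_subset_right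
    have hf0 : f ![p, v, u] = 0 := by
      by_contra hne
      refine hft ?_
      rw [htt]
      exact (hf.isAlt.triangle_mem_supp (by grind) (by grind) hvu).2 hne
    rw [← ih1, hs', hs1']
    exact eq_of_jump_eq_zero hT ho (hψ p hf0) hs1 hs

theorem IsPotential.swap {E : Type*} [AddCommGroup E] (ho : IsFundamentalClass T o)
    (hf : IsAlt f) {c : ℕ → ℕ → ℕ → E} {φ : ℕ → Finset ℕ → E} (h : IsPotential o f c φ)
    (hc : ∀ w v u, c w u v = -c w v u) {w v u : ℕ} (h0 : f ![w, v, u] = 0) :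
    c w v u = jump o (φ v) w v u := by
  rw [hc w u v, jump_swap12 ho _ w u v, h w u v (by rw [hf.tri12 w v u, h0, neg_zero])]

/-- The argument is that for linking numbers, except that the track stays on the positive side.
There the difference of two local potentials at a surface edge has a single value, which `P`
samples. -/
theorem pushoffLinkingNumber_eq (hT : IsSphere 3 T) (ho : IsFundamentalClass T o)
    (hf : IsSurface T f) {a b : Chain 1} {n : ℤ} (h : IsPushoffLinkingNumber T o f a b n)
    (haalt : IsAlt a) {c : Chain 2} (hc : c ∈ chains T 2) (hbd : bd c = b)
    {φ : ℕ → Finset ℕ → ℤ} (hφ : IsPotential o f (fun w u v => c ![w, u, v]) φ)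
    {P N : ℕ → ℕ → Finset ℕ} (ht : IsSideTets T o f P N) :
    pairing (vset o) a (fun v u => φ v (P v u)) = -n := by
  obtain ⟨c', hc', hbd', s, htr⟩ := h
  obtain ⟨ψ, hψ⟩ := eq_potential_add hT ho hc' hc (hbd'.trans hbd.symm)
  have hpot : IsPotential o f (fun w u v => c' ![w, u, v]) (fun v τ => φ v τ + ψ τ) := by
    intro w u v h0
    dsimp only
    rw [jump_add, hψ, ← hφ w u v h0]
  have hcnt := htr.count (fun v τ => φ v τ + ψ τ) (fun v u => φ v (P v u) + ψ (P v u)) (vset o)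
    (fun v hv => mem_vset_of_mem hT ho hv)
    (fun v w w' x hw hw' hne hx hF hF' hv hok =>
      turn_of_potential hT ho (isAlt_of_mem hc') hw hw' hne hx hF hF' hv fun p q hpq => by
        refine hpot p q v ?_
        by_contra hne0
        exact hok ⟨verts_nonempty x, _, hne0, by rw [hpq, verts_three]⟩)
    (by
      intro v u τ hτ h4 hv hu hne hok
      obtain ⟨w, s, h1, h2⟩ := ht.isSide_pos v u hne.symm hok.1
      have hdiff := (onPositiveSide_eq hT ho hf hne.symm
        (ψ := fun τ => (φ v τ + ψ τ) - (φ u τ + ψ τ)) (fun w h0 => by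
          rw [jump_sub, ← hpot w v u h0, ← hpot.swap ho hf.isAlt
            (fun w v u => (isAlt_of_mem hc').tri12 w v u) h0, sub_self]) hok.2 h1).1
      rw [ht.pos.1 u v, h2]
      exact hdiff.symm)
  rw [sub_self, zero_sub, pairing_add, pairing_eq_zero_of_symm (vset o) haalt
    (q := fun v u => ψ (P v u)) (fun v u => by rw [ht.pos.1]), add_zero] at hcnt
  rw [hcnt, neg_neg]

end Tracks

/-! ### The two push-offs of a surface give transposed linking matrices -/

section Symmetry

variable {T : Cx} {o : Chain 3} {f : Chain 2} {E : Type*} [AddCommGroup E]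

/-- Sum of a function over the triangles. -/
def triSum (S : Finset ℕ) (F : ℕ → ℕ → ℕ → E) : E := ∑ v ∈ S, ∑ u ∈ S, ∑ w ∈ S, F w v u

theorem triSum_add (S : Finset ℕ) (F G : ℕ → ℕ → ℕ → E) :
    triSum S (fun w v u => F w v u + G w v u) = triSum S F + triSum S G := by
  simp only [triSum, Finset.sum_add_distrib]

theorem triSum_sub (S : Finset ℕ) (F G : ℕ → ℕ → ℕ → E) :
    triSum S (fun w v u => F w v u - G w v u) = triSum S F - triSum S G := by
  simp only [triSum, Finset.sum_sub_distrib]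

theorem triSum_neg (S : Finset ℕ) (F : ℕ → ℕ → ℕ → E) :
    triSum S (fun w v u => -F w v u) = -triSum S F := by
  simp only [triSum, Finset.sum_neg_distrib]

theorem triSum_mul_left (S : Finset ℕ) (n : ℤ) (F : ℕ → ℕ → ℕ → ℤ) :
    triSum S (fun w v u => n * F w v u) = n * triSum S F := by
  simp only [triSum, Finset.mul_sum]

theorem triSum_swap12 (S : Finset ℕ) (F : ℕ → ℕ → ℕ → E) :
    triSum S (fun w v u => F w u v) = triSum S F := by
  simp only [triSum]
  exact Finset.sum_comm

theorem triSum_eq_zero01 [Module.IsTorsionFree ℤ E] (S : Finset ℕ) {F : ℕ → ℕ → ℕ → E}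
    (h : ∀ w v u, F v w u = -F w v u) :
    triSum S F = 0 := by
  simp only [triSum]
  rw [Finset.sum_comm]
  exact Finset.sum_eq_zero fun u _ => sum_sum_antisymm S (fun v w => F w v u) fun x y => h y x u

theorem triSum_eq_zero02 [Module.IsTorsionFree ℤ E] (S : Finset ℕ) {F : ℕ → ℕ → ℕ → E}
    (h : ∀ w v u, F u v w = -F w v u) :
    triSum S F = 0 :=
  Finset.sum_eq_zero fun v _ => sum_sum_antisymm S (fun u w => F w v u) fun x y => h y v x

/-- The value of a function of tetrahedra on the side with sign `δ` of a triangle. -/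
def side (o : Chain 3) (f : Chain 2) (δ : ℤ) (g : Finset ℕ → E) (w v u : ℕ) : E :=
  ∑ s ∈ vset o, if o ![s, w, v, u] * f ![w, v, u] = δ then g {s, w, v, u} else 0

theorem side_swap01 (ho : IsAlt o) (hf : IsAlt f) (δ : ℤ) (g : Finset ℕ → E) (w v u : ℕ) :
    side o f δ g v w u = side o f δ g w v u := by
  simp only [side, ho.tet12 _ w v u, hf.tri01 w v u, neg_mul_neg, Finset.insert_comm v w]

theorem side_swap12 (ho : IsAlt o) (hf : IsAlt f) (δ : ℤ) (g : Finset ℕ → E) (w v u : ℕ) :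
    side o f δ g w u v = side o f δ g w v u := by
  simp only [side, ho.tet23 _ w v u, hf.tri12 w v u, neg_mul_neg, Finset.pair_comm v u]

theorem side_swap02 (ho : IsAlt o) (hf : IsAlt f) (δ : ℤ) (g : Finset ℕ → E) (w v u : ℕ) :
    side o f δ g u v w = side o f δ g w v u := by
  rw [side_swap01 ho hf, side_swap12 ho hf, side_swap01 ho hf]

theorem smul_jump_eq_side (ho : IsFundamentalClass T o) (hf : IsSurface T f) (g : Finset ℕ → E)
    (w v u : ℕ) : f ![w, v, u] • jump o g w v u = side o f 1 g w v u - side o f (-1) g w v u := by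
  simp only [jump, side, Finset.smul_sum, ← Finset.sum_sub_distrib]
  refine Finset.sum_congr rfl fun s _ => ?_
  by_cases h0 : o ![s, w, v, u] = 0
  · simp [h0]
  · rcases ho.eq_or h0 with h1 | h1 <;> rcases hf.eq_or ![w, v, u] with h2 | h2 | h2 <;>
      simp [h1, h2]

theorem side_eq (hT : IsSphere 3 T) (ho : IsFundamentalClass T o)
    {δ : ℤ} (hδ : δ = 1 ∨ δ = -1) (g : Finset ℕ → E) {s w v u : ℕ}
    (h : o ![s, w, v, u] * f ![w, v, u] = δ) : side o f δ g w v u = g {s, w, v, u} := by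
  have hs : o ![s, w, v, u] ≠ 0 := fun h0 => by rw [h0, zero_mul] at h; omega
  rw [side, Finset.sum_eq_single s, if_pos h]
  · intro r _ hr
    rw [if_neg]
    exact fun h' => hr (side_unique hT ho hδ h' h)
  · exact fun h' => absurd (mem_vset hs 0) h'

theorem side_mul (hT : IsSphere 3 T) (ho : IsFundamentalClass T o) (hf : IsSurface T f)
    {δ : ℤ} (hδ : δ = 1 ∨ δ = -1) (g g' : Finset ℕ → ℤ) {w v u : ℕ} :
    side o f δ (fun τ => g τ * g' τ) w v u = side o f δ g w v u * side o f δ g' w v u := by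
  by_cases h0 : f ![w, v, u] = 0
  · simp only [side, h0, mul_zero]
    have hδ0 : (0 : ℤ) ≠ δ := by rcases hδ with rfl | rfl <;> decide
    simp [hδ0]
  · obtain ⟨s, hs⟩ := exists_side_of_sign hT ho hf hδ h0
    simp only [side_eq hT ho hδ _ hs]

/-- The sum of the values of a function on the tetrahedra at a triangle. -/
def bothSides (o : Chain 3) (g : Finset ℕ → ℤ) (w v u : ℕ) : ℤ :=
  ∑ s ∈ vset o, o ![s, w, v, u] ^ 2 * g {s, w, v, u}

theorem bothSides_swap01 (ho : IsAlt o) (g : Finset ℕ → ℤ) (w v u : ℕ) :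
    bothSides o g v w u = bothSides o g w v u := by
  simp only [bothSides, ho.tet12 _ w v u, neg_sq, Finset.insert_comm v w]

theorem bothSides_swap02 (ho : IsAlt o) (g : Finset ℕ → ℤ) (w v u : ℕ) :
    bothSides o g u v w = bothSides o g w v u := by
  have h : ∀ w v u, bothSides o g w u v = bothSides o g w v u := fun w v u => by
    simp only [bothSides, ho.tet23 _ w v u, neg_sq, Finset.pair_comm v u]
  rw [bothSides_swap01 ho, h, bothSides_swap01 ho]

theorem bothSides_eq (hT : IsSphere 3 T) (ho : IsFundamentalClass T o) (g : Finset ℕ → ℤ)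
    {s s' w v u : ℕ} (hs : o ![s, w, v, u] ≠ 0) (hs' : o ![s', w, v, u] ≠ 0) (hne : s ≠ s') :
    bothSides o g w v u = g {s, w, v, u} + g {s', w, v, u} := by
  obtain ⟨r, -, -, hall⟩ := exists_opposite hT ho hs
  obtain rfl : s' = r := (hall s' hs').resolve_left hne.symm
  have hsq : ∀ r, o ![r, w, v, u] ≠ 0 → o ![r, w, v, u] ^ 2 = 1 := fun r hr => by
    rcases ho.eq_or hr with h1 | h1 <;> rw [h1] <;> rfl
  rw [bothSides, ← Finset.sum_subset (s₁ := {s, s'}), Finset.sum_pair hne, hsq s hs, hsq s' hs',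
    one_mul, one_mul]
  · intro r hr
    rw [Finset.mem_insert, Finset.mem_singleton] at hr
    rcases hr with rfl | rfl
    exacts [mem_vset hs 0, mem_vset hs' 0]
  · intro r _ hr
    have : o ![r, w, v, u] = 0 := by
      by_contra h0
      rcases hall r h0 with rfl | rfl <;> simp at hr
    rw [this]; ring

/-- The discrete Leibniz rule, jump of a product = jump × mean + mean × jump; the factor 2 keeps the
means integral. -/
theorem two_mul_jump_mul (hT : IsSphere 3 T) (ho : IsFundamentalClass T o) (g g' : Finset ℕ → ℤ)
    (w v u : ℕ) : 2 * jump o (fun τ => g τ * g' τ) w v u =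
      jump o g w v u * bothSides o g' w v u + bothSides o g w v u * jump o g' w v u := by
  by_cases h : ∃ s, o ![s, w, v, u] ≠ 0
  · obtain ⟨s, hs⟩ := h
    obtain ⟨s', hne, hs', hall⟩ := exists_opposite hT ho hs
    have hs0 : o ![s', w, v, u] ≠ 0 := by rw [hs']; simpa using hs
    have hb := fun g => bothSides_eq hT ho g hs hs0 hne.symm
    rw [hb, hb, jump_eq hT ho _ hs hs0 hne.symm, jump_eq hT ho _ hs hs0 hne.symm,
      jump_eq hT ho _ hs hs0 hne.symm]
    simp only [smul_eq_mul]
    ring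
  · push Not at h
    simp [jump, bothSides, h]

/-- Subtracting the jumps of the potential of `u`, whose sum around the edge is zero, cancels every
triangle off the surface. -/
theorem bd_eq_sum_side (hT : IsSphere 3 T) (ho : IsFundamentalClass T o) (hf : IsSurface T f)
    {c : Chain 2} (hc : c ∈ chains T 2) {φ : ℕ → Finset ℕ → ℤ}
    (hφ : IsPotential o f (fun w u v => c ![w, u, v]) φ) (v u : ℕ) :
    bd c ![v, u] = ∑ w ∈ vset o, f ![w, v, u] * (f ![w, v, u] * c ![w, v, u] +
      side o f (-1) (φ u) w v u - side o f 1 (φ u) w v u) := by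
  rw [bd_apply c ![v, u] (vset o) (fun w hw => mem_vset_of_mem hT ho (vertex_mem_face
    (hc.1 _ hw).2 (mem_verts.2 ⟨0, rfl⟩)))]
  rw [← sub_zero (∑ w ∈ vset o, _), ← sum_jump ho (φ u) v u, ← Finset.sum_sub_distrib]
  refine Finset.sum_congr rfl fun w _ => ?_
  change c ![w, v, u] - _ = _
  have hm := smul_jump_eq_side ho hf (φ u) w v u
  rw [smul_eq_mul] at hm
  by_cases h0 : f ![w, v, u] = 0
  · rw [show c ![w, v, u] = _ from hφ w v u h0, h0]; ring
  · have h1 : f ![w, v, u] * f ![w, v, u] = 1 := by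
      rcases hf.eq_or ![w, v, u] with h | h | h <;> simp_all
    linear_combination (c ![w, v, u] - jump o (φ u) w v u) * (- h1) - f ![w, v, u] * hm

/-- The pairing is antisymmetrised in the ends of each edge, so that the tetrahedron chosen there
may be replaced by the one at each surface triangle. Expanding ∂c over surface triangles then gives
four sums, three of which vanish by antisymmetry. -/
theorem two_mul_pairing_side (hT : IsSphere 3 T) (ho : IsFundamentalClass T o) (hf : IsSurface T f)
    {c d : Chain 2} (hc : c ∈ chains T 2) (hd : d ∈ chains T 2)
    {φ χ : ℕ → Finset ℕ → ℤ} (hφ : IsPotential o f (fun w u v => c ![w, u, v]) φ)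
    (hχ : IsPotential o f (fun w u v => d ![w, u, v]) χ) {δ : ℤ} (hδ : δ = 1 ∨ δ = -1)
    {t : ℕ → ℕ → Finset ℕ} (ht : IsSide o f δ t) (hts : ∀ v u, t v u = t u v) :
    2 * pairing (vset o) (bd c) (fun v u => χ v (t v u)) = triSum (vset o) fun w v u =>
      f ![w, v, u] * (side o f (-1) (φ u) w v u - side o f 1 (φ u) w v u) *
        side o f δ (χ v) w v u := by
  have hoa := ho.isAlt
  have hfa := hf.isAlt
  have hca := isAlt_of_mem hc
  have hsymm : pairing (vset o) (bd c) (fun v u => χ v (t v u) + χ u (t v u)) = 0 :=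
    pairing_eq_zero_of_symm _ hca.bd fun v u => by rw [hts v u, add_comm]
  have h1 : 2 * pairing (vset o) (bd c) (fun v u => χ v (t v u)) =
      pairing (vset o) (bd c) (fun v u => χ v (t v u) - χ u (t v u)) := by
    rw [pairing_add] at hsymm
    rw [pairing_sub]
    linarith
  have h2 : pairing (vset o) (bd c) (fun v u => χ v (t v u) - χ u (t v u)) =
      triSum (vset o) fun w v u => f ![w, v, u] * (f ![w, v, u] * c ![w, v, u] +
      side o f (-1) (φ u) w v u - side o f 1 (φ u) w v u) *
        (side o f δ (χ v) w v u - side o f δ (χ u) w v u) := by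
    refine Finset.sum_congr rfl fun v _ => Finset.sum_congr rfl fun u _ => ?_
    rw [bd_eq_sum_side hT ho hf hc hφ, smul_eq_mul, Finset.sum_mul]
    refine Finset.sum_congr rfl fun w _ => ?_
    by_cases h0 : f ![w, v, u] = 0
    · simp [h0]
    congr 1
    obtain ⟨s, hs⟩ := exists_side_of_sign hT ho hf hδ h0
    rw [side_eq hT ho hδ _ hs, side_eq hT ho hδ _ hs]
    have hvu : v ≠ u := (injective_three.1 (hfa.injective_of_ne_zero h0)).2.2
    obtain ⟨w', s', h3, h4⟩ := ht v u hvu ⟨Finset.insert_nonempty _ _, _, h0, by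
      rw [verts_three]; grind⟩
    dsimp only
    rw [h4]
    exact eq_of_same_side hT ho hf (ψ := fun τ => χ v τ - χ u τ) (fun w h0 => by
      rw [jump_sub, ← hχ w v u h0, ← hχ.swap ho hfa
        (fun w v u => (isAlt_of_mem hd).tri12 w v u) h0, sub_self]) hδ h3 hs
  have h3 : triSum (vset o) (fun w v u => f ![w, v, u] * (f ![w, v, u] * c ![w, v, u]) *
      side o f δ (χ v) w v u) = 0 := triSum_eq_zero02 _ fun w v u => by
    rw [hfa.tri02 w v u, hca.tri02 w v u, side_swap02 hoa hfa]; ring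
  have h4 : triSum (vset o) (fun w v u => f ![w, v, u] * (f ![w, v, u] * c ![w, v, u]) *
      side o f δ (χ u) w v u) = 0 := triSum_eq_zero01 _ fun w v u => by
    rw [hfa.tri01 w v u, hca.tri01 w v u, side_swap01 hoa hfa]; ring
  have h5 : triSum (vset o) (fun w v u => f ![w, v, u] *
      (side o f (-1) (φ u) w v u - side o f 1 (φ u) w v u) *
      side o f δ (χ u) w v u) = 0 := triSum_eq_zero01 _ fun w v u => by
    simp only [hfa.tri01 w v u, side_swap01 hoa hfa _ _ w v u]; ring
  rw [h1, h2]
  have h6 := triSum_sub (vset o) (fun w v u => f ![w, v, u] * (f ![w, v, u] * c ![w, v, u]) *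
      side o f δ (χ v) w v u) (fun w v u => f ![w, v, u] * (f ![w, v, u] * c ![w, v, u]) *
      side o f δ (χ u) w v u)
  have h7 := triSum_sub (vset o) (fun w v u => f ![w, v, u] *
      (side o f (-1) (φ u) w v u - side o f 1 (φ u) w v u) * side o f δ (χ v) w v u)
      (fun w v u => f ![w, v, u] *
      (side o f (-1) (φ u) w v u - side o f 1 (φ u) w v u) * side o f δ (χ u) w v u)
  rw [h3, h4] at h6
  rw [h5, sub_zero] at h7
  refine Eq.trans ?_ (zero_add _)
  nth_rewrite 1 [← sub_zero (0 : ℤ)]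
  rw [← h6, ← h7, ← triSum_add]
  congr 1
  funext w v u
  ring

/-- This is lk(a⁻, b) = lk(b⁺, a). By the previous formula, twice the difference of the two pairings
is, up to sign, the sum over surface triangles of the jumps of the product of the potential of c at
`u` and that of d at `v`. The sum of these jumps over all triangles is zero, so it remains to treat
the triangles off the surface. -/
theorem pairing_neg_eq_pairing_pos (hT : IsSphere 3 T) (ho : IsFundamentalClass T o)
    (hf : IsSurface T f) {c d : Chain 2} (hc : c ∈ chains T 2) (hd : d ∈ chains T 2)
    {φ χ : ℕ → Finset ℕ → ℤ} (hφ : IsPotential o f (fun w u v => c ![w, u, v]) φ)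
    (hχ : IsPotential o f (fun w u v => d ![w, u, v]) χ)
    {P N : ℕ → ℕ → Finset ℕ} (ht : IsSideTets T o f P N) :
    pairing (vset o) (bd c) (fun v u => χ v (N v u)) =
      pairing (vset o) (bd d) (fun v u => φ v (P v u)) := by
  have hoa := ho.isAlt
  have hfa := hf.isAlt
  have hca := isAlt_of_mem hc
  have hda := isAlt_of_mem hd
  have h1 := two_mul_pairing_side hT ho hf hc hd hφ hχ (Or.inl rfl) ht.isSide_neg ht.neg.1
  have h2 := two_mul_pairing_side hT ho hf hd hc hχ hφ (Or.inr rfl) ht.isSide_pos ht.pos.1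
  rw [← triSum_swap12] at h2
  have h3 : triSum (vset o) (fun w v u => jump o (fun τ => φ u τ * χ v τ) w v u) = 0 := by
    refine Finset.sum_eq_zero fun v _ => Finset.sum_eq_zero fun u _ => sum_jump ho _ v u
  -- The factor 1 - f² selects the triangles off the surface. There the Leibniz rule gives c times a
  -- mean depending on `v` only, odd under w ↔ u, and d times a mean depending on `u` only, odd
  -- under w ↔ v.
  have h4 : triSum (vset o) (fun w v u => (1 - f ![w, v, u] ^ 2) *
      (2 * jump o (fun τ => φ u τ * χ v τ) w v u)) = 0 := by
    have h5 : triSum (vset o) (fun w v u => (1 - f ![w, v, u] ^ 2) *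
        (c ![w, v, u] * bothSides o (χ v) w v u)) = 0 := triSum_eq_zero02 _ fun w v u => by
      rw [hfa.tri02 w v u, hca.tri02 w v u, bothSides_swap02 hoa]; ring
    have h6 : triSum (vset o) (fun w v u => (1 - f ![w, v, u] ^ 2) *
        (bothSides o (φ u) w v u * d ![w, v, u])) = 0 := triSum_eq_zero01 _ fun w v u => by
      rw [hfa.tri01 w v u, hda.tri01 w v u, bothSides_swap01 hoa]; ring
    rw [← add_zero (0 : ℤ)]
    nth_rewrite 1 [← h5]
    rw [← h6, ← triSum_add]
    congr 1
    funext w v u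
    by_cases h0 : f ![w, v, u] = 0
    · rw [two_mul_jump_mul hT ho, ← hφ w v u h0, ← hχ.swap ho hfa
        (fun w v u => hda.tri12 w v u) h0]
      ring
    · have : f ![w, v, u] ^ 2 = 1 := by
        rcases hf.eq_or ![w, v, u] with h | h | h <;> simp_all
      rw [this]; ring
  have h5 : triSum (vset o) (fun w v u => f ![w, v, u] *
      (side o f 1 (fun τ => φ u τ * χ v τ) w v u -
        side o f (-1) (fun τ => φ u τ * χ v τ) w v u)) = 0 := by
    have h6 : 2 * triSum (vset o) (fun w v u => f ![w, v, u] *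
      (side o f 1 (fun τ => φ u τ * χ v τ) w v u -
        side o f (-1) (fun τ => φ u τ * χ v τ) w v u)) =
        2 * triSum (vset o) (fun w v u => jump o (fun τ => φ u τ * χ v τ) w v u) -
        triSum (vset o) (fun w v u => (1 - f ![w, v, u] ^ 2) *
          (2 * jump o (fun τ => φ u τ * χ v τ) w v u)) := by
      rw [← triSum_mul_left, ← triSum_mul_left, ← triSum_sub]
      congr 1
      funext w v u
      rw [← smul_jump_eq_side ho hf, smul_eq_mul]
      ring
    linarith
  have h6 : 2 * pairing (vset o) (bd c) (fun v u => χ v (N v u)) -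
      2 * pairing (vset o) (bd d) (fun v u => φ v (P v u)) = -0 := by
    rw [h1, h2, ← h5, ← triSum_sub, ← triSum_neg]
    congr 1
    funext w v u
    rw [side_mul hT ho hf (Or.inl rfl), side_mul hT ho hf (Or.inr rfl), hfa.tri12 w v u]
    simp only [side_swap12 hoa hfa _ _ w v u]
    ring
  linarith

end Symmetry

/-! ### Homology bases -/

theorem IsHomologyBasis.exists_decomposition {F : Cx} {n : ℕ} {α : Fin n → Chain 1}
    (h : IsHomologyBasis F α) {a : Chain 1} (ha : a ∈ cycles F) :
    ∃ (k : Fin n → ℤ) (D : Chain 2), D ∈ chains F 2 ∧ a = ∑ i, k i • α i + bd D := by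
  obtain ⟨hα, -, hspan⟩ := h
  have hm : (Submodule.Quotient.mk ⟨a, ha⟩ : H1 F) ∈ Submodule.span ℤ
      (Set.range fun i => (Submodule.Quotient.mk ⟨α i, hα i⟩ : H1 F)) := hspan ▸ Submodule.mem_top
  obtain ⟨k, hk⟩ := (Submodule.mem_span_range_iff_exists_fun ℤ).1 hm
  have h0 : (Submodule.Quotient.mk (⟨a, ha⟩ - ∑ i, k i • ⟨α i, hα i⟩) : H1 F) = 0 := by
    rw [Submodule.Quotient.mk_sub, ← hk, sub_eq_zero]
    change _ = (Submodule.mkQ _) _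
    rw [map_sum]
    simp only [map_smul]
    rfl
  rw [Submodule.Quotient.mk_eq_zero] at h0
  obtain ⟨D, hD, hbd⟩ := h0
  refine ⟨k, D, hD, ?_⟩
  rw [hbd]
  simp

theorem IsHomologyBasis.eq_zero_of_bd {F : Cx} {n : ℕ} {α : Fin n → Chain 1}
    (h : IsHomologyBasis F α) {k : Fin n → ℤ} {D : Chain 2} (hD : D ∈ chains F 2)
    (hk : ∑ i, k i • α i = bd D) : k = 0 := by
  obtain ⟨hα, hli, -⟩ := h
  have h0 : (Submodule.Quotient.mk (∑ i, k i • ⟨α i, hα i⟩) : H1 F) = 0 := by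
    rw [Submodule.Quotient.mk_eq_zero]
    refine ⟨D, hD, ?_⟩
    rw [← hk]
    simp
  funext i
  refine Fintype.linearIndependent_iff.1 hli k ?_ i
  rw [← h0]
  change _ = (Submodule.mkQ _) _
  rw [map_sum]
  simp only [map_smul]
  rfl

/-! ### Chains with coefficients -/

theorem isAlt_of_swaps {k : ℕ} {c : Chain k}
    (h : ∀ (i : Fin k) z, c (z ∘ Equiv.swap i.castSucc i.succ) = -c z) : IsAlt c := by
  intro π
  have hπ : π ∈ Submonoid.closure
      (Set.range fun i : Fin k => Equiv.swap i.castSucc i.succ) := by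
    rw [Equiv.Perm.mclosure_swap_castSucc_succ]
    exact Submonoid.mem_top π
  induction hπ using Submonoid.closure_induction with
  | mem π hπ =>
    obtain ⟨i, rfl⟩ := hπ
    intro z
    dsimp only
    rw [h, Equiv.Perm.sign_swap (Fin.castSucc_lt_succ).ne]
    simp
  | one => intro z; simp
  | mul π σ _ _ h1 h2 =>
    intro z
    rw [Equiv.Perm.coe_mul, ← Function.comp_assoc, h2, h1, Equiv.Perm.sign_mul]
    push_cast
    ring

section Coefficients

variable {E : Type*} [AddCommGroup E]

/-- Simplicial 2-chains of `F` with coefficients. -/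
structure IsTriChain (F : Cx) (Z : ℕ → ℕ → ℕ → E) : Prop where
  swap01 : ∀ w v u, Z v w u = -Z w v u
  swap12 : ∀ w v u, Z w u v = -Z w v u
  mem : ∀ w v u, Z w v u ≠ 0 → {w, v, u} ∈ F.faces

/-- Simplicial 1-chains of `F` with coefficients. -/
structure IsEdgeChain (F : Cx) (B : ℕ → ℕ → E) : Prop where
  swap : ∀ v u, B u v = -B v u
  mem : ∀ v u, B v u ≠ 0 → {v, u} ∈ F.faces

theorem IsTriChain.swap02 {F : Cx} {Z : ℕ → ℕ → ℕ → E} (h : IsTriChain F Z) (w v u : ℕ) :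
    Z u v w = -Z w v u := by
  rw [h.swap01 v u w, h.swap12 v w u, h.swap01 w v u, neg_neg]

theorem IsTriChain.add {F : Cx} {Z Z' : ℕ → ℕ → ℕ → E} (h : IsTriChain F Z)
    (h' : IsTriChain F Z') : IsTriChain F fun w v u => Z w v u + Z' w v u where
  swap01 w v u := by rw [h.swap01, h'.swap01, neg_add]
  swap12 w v u := by rw [h.swap12, h'.swap12, neg_add]
  mem w v u hne := by
    by_cases h0 : Z w v u = 0
    · exact h'.mem w v u fun h1 => hne (by rw [h0, h1, add_zero])
    · exact h.mem w v u h0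

theorem IsTriChain.sub {F : Cx} {Z Z' : ℕ → ℕ → ℕ → E} (h : IsTriChain F Z)
    (h' : IsTriChain F Z') : IsTriChain F fun w v u => Z w v u - Z' w v u where
  swap01 w v u := by rw [h.swap01, h'.swap01, neg_sub_neg, neg_sub]
  swap12 w v u := by rw [h.swap12, h'.swap12, neg_sub_neg, neg_sub]
  mem w v u hne := by
    by_cases h0 : Z w v u = 0
    · exact h'.mem w v u fun h1 => hne (by rw [h0, h1, sub_zero])
    · exact h.mem w v u h0

theorem IsTriChain.map {E' : Type*} [AddCommGroup E'] (ℓ : E →+ E') {F : Cx}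
    {Z : ℕ → ℕ → ℕ → E} (h : IsTriChain F Z) : IsTriChain F fun w v u => ℓ (Z w v u) where
  swap01 w v u := by rw [h.swap01, map_neg]
  swap12 w v u := by rw [h.swap12, map_neg]
  mem w v u hne := h.mem w v u fun h0 => hne (by rw [h0, map_zero])

theorem IsTriChain.mono {F F' : Cx} (hF : F.faces ⊆ F'.faces) {Z : ℕ → ℕ → ℕ → E}
    (h : IsTriChain F Z) : IsTriChain F' Z :=
  ⟨h.swap01, h.swap12, fun w v u hne => hF (h.mem w v u hne)⟩

theorem IsTriChain.sum {ι : Type*} (s : Finset ι) {F : Cx} {Z : ι → ℕ → ℕ → ℕ → E}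
    (h : ∀ i, IsTriChain F (Z i)) : IsTriChain F fun w v u => ∑ i ∈ s, Z i w v u where
  swap01 w v u := by
    rw [← Finset.sum_neg_distrib]
    exact Finset.sum_congr rfl fun i _ => (h i).swap01 w v u
  swap12 w v u := by
    rw [← Finset.sum_neg_distrib]
    exact Finset.sum_congr rfl fun i _ => (h i).swap12 w v u
  mem w v u hne := by
    obtain ⟨i, -, hi⟩ := Finset.exists_ne_zero_of_sum_ne_zero hne
    exact (h i).mem w v u hi

theorem isTriChain_smul {F : Cx} {c : Chain 2} (hc : c ∈ chains F 2) (e : E) :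
    IsTriChain F fun w v u => c ![w, v, u] • e where
  swap01 w v u := by rw [(isAlt_of_mem hc).tri01 w v u, neg_smul]
  swap12 w v u := by rw [(isAlt_of_mem hc).tri12 w v u, neg_smul]
  mem w v u hne := by
    have := (hc.1 ![w, v, u] fun h0 => hne (by rw [h0, zero_smul])).2
    rwa [verts_three] at this

theorem isTriChain_jump {T : Cx} {o : Chain 3} (ho : IsFundamentalClass T o) (Ψ : Finset ℕ → E) :
    IsTriChain T (jump o Ψ) where
  swap01 w v u := jump_swap01 ho Ψ w v u
  swap12 w v u := jump_swap12 ho Ψ w v u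
  mem w v u hne := by
    by_contra h
    exact hne (jump_eq_zero_of_notMem ho Ψ h)

theorem IsTriChain.exists_chain {F : Cx} {S : Finset ℕ} (hS : ∀ v, {v} ∈ F.faces → v ∈ S)
    {Z : ℕ → ℕ → ℕ → ℤ} (h : IsTriChain F Z) :
    ∃ c ∈ chains F 2, ∀ w v u, c ![w, v, u] = Z w v u := by
  have hz : ∀ z : Fin 3 → ℕ, verts z = {z 0, z 1, z 2} := fun z => by
    rw [← verts_three]
    congr 1
    ext l
    fin_cases l <;> rfl
  let c : Chain 2 := Finsupp.onFinset (Fintype.piFinset fun _ : Fin 3 => S)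
    (fun z => Z (z 0) (z 1) (z 2)) (by
      intro z hne
      rw [Fintype.mem_piFinset]
      intro l
      refine hS _ (vertex_mem_face (h.mem _ _ _ hne) ?_)
      fin_cases l <;> simp)
  have hc : ∀ z, c z = Z (z 0) (z 1) (z 2) := fun z => rfl
  refine ⟨c, mem_chains_of_isAlt (isAlt_of_swaps fun i z => ?_) fun z _ hne => ?_, fun w v u => rfl⟩
  · rw [hc, hc]
    fin_cases i
    · exact h.swap01 _ _ _
    · exact h.swap12 _ _ _
  · rw [hz]
    exact h.mem _ _ _ hne

theorem IsEdgeChain.exists_chain {F : Cx} {S : Finset ℕ} (hS : ∀ v, {v} ∈ F.faces → v ∈ S)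
    {B : ℕ → ℕ → ℤ} (h : IsEdgeChain F B) :
    ∃ c ∈ chains F 1, ∀ v u, c ![v, u] = B v u := by
  have hz : ∀ z : Fin 2 → ℕ, verts z = {z 0, z 1} := fun z => by
    rw [← verts_two]
    congr 1
    ext l
    fin_cases l <;> rfl
  let c : Chain 1 := Finsupp.onFinset (Fintype.piFinset fun _ : Fin 2 => S)
    (fun z => B (z 0) (z 1)) (by
      intro z hne
      rw [Fintype.mem_piFinset]
      intro l
      refine hS _ (vertex_mem_face (h.mem _ _ hne) ?_)
      fin_cases l <;> simp)
  have hc : ∀ z, c z = B (z 0) (z 1) := fun z => rfl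
  refine ⟨c, mem_chains_of_isAlt (isAlt_of_swaps fun i z => ?_) fun z _ hne => ?_, fun v u => rfl⟩
  · rw [hc, hc]
    fin_cases i
    exact h.swap _ _
  · rw [hz]
    exact h.mem _ _ hne

theorem bd_apply_two {F : Cx} {S : Finset ℕ} (hS : ∀ v, {v} ∈ F.faces → v ∈ S) {c : Chain 2}
    (hc : c ∈ chains F 2) (v u : ℕ) : bd c ![v, u] = ∑ w ∈ S, c ![w, v, u] :=
  bd_apply c ![v, u] S fun _ hw => hS _ (vertex_mem_face (hc.1 _ hw).2 (mem_verts.2 ⟨0, rfl⟩))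

theorem chain_one_ext {c d : Chain 1} (h : ∀ v u, c ![v, u] = d ![v, u]) : c = d := by
  ext z
  have : z = ![z 0, z 1] := by ext l; fin_cases l <;> rfl
  rw [this, h]

/-- Coordinates on the subgroup generated by finitely many elements. -/
theorem exists_coordinates [Module.IsTorsionFree ℤ E] {A : Set E} (hA : A.Finite) :
    ∃ (ι : Type) (_ : Fintype ι) (e : ι → E) (ℓ : ι → Submodule.span ℤ A →ₗ[ℤ] ℤ),
      ∀ y : Submodule.span ℤ A, (y : E) = ∑ k, ℓ k y • e k := by
  have := Module.Finite.span_of_finite ℤ hA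
  obtain ⟨n, b⟩ := Module.basisOfFiniteTypeTorsionFree' (R := ℤ) (M := Submodule.span ℤ A)
  refine ⟨Fin n, inferInstance, fun k => (b k : E), fun k => b.coord k, fun y => ?_⟩
  conv_lhs => rw [← b.sum_repr y]
  push_cast
  rfl

theorem IsTriChain.finite_range {F : Cx} {S : Finset ℕ} (hS : ∀ v, {v} ∈ F.faces → v ∈ S)
    {Z : ℕ → ℕ → ℕ → E} (h : IsTriChain F Z) :
    (Set.range fun p : ℕ × ℕ × ℕ => Z p.1 p.2.1 p.2.2).Finite := by
  refine ((S ×ˢ S ×ˢ S).finite_toSet.image (fun p => Z p.1 p.2.1 p.2.2)).union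
    (Set.finite_singleton (0 : E)) |>.subset ?_
  rintro _ ⟨⟨w, v, u⟩, rfl⟩
  by_cases h0 : Z w v u = 0
  · exact Or.inr h0
  · have hm := h.mem w v u h0
    refine Or.inl ⟨(w, v, u), ?_, rfl⟩
    have hs : ∀ r ∈ ({w, v, u} : Finset ℕ), r ∈ S := fun r hr => hS r (vertex_mem_face hm hr)
    simp only [Finset.coe_product, Set.mem_prod, Finset.mem_coe]
    exact ⟨hs w (by simp), hs v (by simp), hs u (by simp)⟩

theorem IsEdgeChain.finite_range {F : Cx} {S : Finset ℕ} (hS : ∀ v, {v} ∈ F.faces → v ∈ S)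
    {B : ℕ → ℕ → E} (h : IsEdgeChain F B) : (Set.range fun p : ℕ × ℕ => B p.1 p.2).Finite := by
  refine ((S ×ˢ S).finite_toSet.image (fun p => B p.1 p.2)).union
    (Set.finite_singleton (0 : E)) |>.subset ?_
  rintro _ ⟨⟨v, u⟩, rfl⟩
  by_cases h0 : B v u = 0
  · exact Or.inr h0
  · have hm := h.mem v u h0
    refine Or.inl ⟨(v, u), ?_, rfl⟩
    have hs : ∀ r ∈ ({v, u} : Finset ℕ), r ∈ S := fun r hr => hS r (vertex_mem_face hm hr)
    simp only [Finset.coe_product, Set.mem_prod, Finset.mem_coe]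
    exact ⟨hs v (by simp), hs u (by simp)⟩

/-- The components of a 2-chain with coefficients. -/
theorem IsTriChain.exists_component {F : Cx} {S : Finset ℕ} (hS : ∀ v, {v} ∈ F.faces → v ∈ S)
    {H : Submodule ℤ E} {Z : ℕ → ℕ → ℕ → E} (h : IsTriChain F Z) (hZ : ∀ w v u, Z w v u ∈ H)
    (ℓ : H →ₗ[ℤ] ℤ) : ∃ c ∈ chains F 2, ∀ w v u, c ![w, v, u] = ℓ ⟨Z w v u, hZ w v u⟩ := by
  have h' : IsTriChain F fun w v u => (⟨Z w v u, hZ w v u⟩ : H) :=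
    ⟨fun w v u => Subtype.ext (h.swap01 w v u), fun w v u => Subtype.ext (h.swap12 w v u),
      fun w v u hne => h.mem w v u fun h0 => hne (Subtype.ext h0)⟩
  exact (h'.map ℓ.toAddMonoidHom).exists_chain hS

/-- The finitely many coefficients generate a free abelian group, so the integral statement applies
to each coordinate. -/
theorem IsTriChain.exists_potential [Module.IsTorsionFree ℤ E] {T : Cx} {o : Chain 3}
    (hT : IsSphere 3 T) (ho : IsFundamentalClass T o) {Z : ℕ → ℕ → ℕ → E} (h : IsTriChain T Z)
    (hZ : ∀ v u, ∑ w ∈ vset o, Z w v u = 0) :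
    ∃ Ψ : Finset ℕ → E, ∀ w v u, Z w v u = jump o Ψ w v u := by
  have hS : ∀ v, {v} ∈ T.faces → v ∈ vset o := fun v hv => mem_vset_of_mem hT ho hv
  obtain ⟨ι, _, e, ℓ, hℓ⟩ := exists_coordinates (h.finite_range hS)
  have hm : ∀ w v u, Z w v u ∈ Submodule.span ℤ
      (Set.range fun p : ℕ × ℕ × ℕ => Z p.1 p.2.1 p.2.2) := fun w v u =>
    Submodule.subset_span ⟨(w, v, u), rfl⟩
  have hex : ∀ k, ∃ ψ : Finset ℕ → ℤ, ∀ w v u, ℓ k ⟨Z w v u, hm w v u⟩ = jump o ψ w v u := by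
    intro k
    obtain ⟨c, hc, hcv⟩ := h.exists_component hS hm (ℓ k)
    obtain ⟨ψ, hψ⟩ := exists_global_potential hT ho hc (chain_one_ext fun v u => by
      rw [bd_apply_two hS hc, Finset.sum_congr rfl fun w _ => hcv w v u, ← map_sum,
        Finsupp.zero_apply]
      convert map_zero (ℓ k)
      refine Subtype.ext ?_
      push_cast
      exact hZ v u)
    exact ⟨ψ, fun w v u => by rw [← hcv, hψ]⟩
  choose ψ hψ using hex
  refine ⟨fun τ => ∑ k, ψ k τ • e k, fun w v u => ?_⟩
  refine (hℓ ⟨Z w v u, hm w v u⟩).trans ?_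
  simp only [hψ, jump, Finset.smul_sum, Finset.sum_smul, smul_assoc]
  exact Finset.sum_comm

theorem IsHomologyBasis.exists_decomposition_coeff [Module.IsTorsionFree ℤ E] {F : Cx}
    {S : Finset ℕ} (hS : ∀ v, {v} ∈ F.faces → v ∈ S) {n : ℕ} {α : Fin n → Chain 1}
    (hα : IsHomologyBasis F α) {B : ℕ → ℕ → E} (h : IsEdgeChain F B)
    (hB : ∀ u, ∑ v ∈ S, B v u = 0) : ∃ (b : Fin n → E) (D : ℕ → ℕ → ℕ → E), IsTriChain F D ∧
      ∀ v u, B v u = ∑ i, α i ![v, u] • b i + ∑ w ∈ S, D w v u := by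
  obtain ⟨ι, _, e, ℓ, hℓ⟩ := exists_coordinates (h.finite_range hS)
  have hm : ∀ v u, B v u ∈ Submodule.span ℤ (Set.range fun p : ℕ × ℕ => B p.1 p.2) :=
    fun v u => Submodule.subset_span ⟨(v, u), rfl⟩
  have h' : ∀ k, IsEdgeChain F fun v u => ℓ k ⟨B v u, hm v u⟩ := fun k =>
    ⟨fun v u => by rw [← map_neg]; exact congrArg _ (Subtype.ext (h.swap v u)),
      fun v u hne => h.mem v u fun h0 => hne (by
        rw [← map_zero (ℓ k)]; exact congrArg _ (Subtype.ext h0))⟩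
  have hex : ∀ k, ∃ (m : Fin n → ℤ) (D : Chain 2), D ∈ chains F 2 ∧ ∀ v u,
      ℓ k ⟨B v u, hm v u⟩ = ∑ i, m i * α i ![v, u] + ∑ w ∈ S, D ![w, v, u] := by
    intro k
    obtain ⟨a, ha, hav⟩ := (h' k).exists_chain hS
    have hcyc : a ∈ cycles F := by
      refine ⟨ha, ?_⟩
      change bd a = 0
      ext z
      rw [bd_apply a z S fun _ hw => hS _ (vertex_mem_face (ha.1 _ hw).2 (mem_verts.2 ⟨0, rfl⟩))]
      have : ∀ w, (Fin.cons w z : Fin 2 → ℕ) = ![w, z 0] := fun w => by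
        ext l; fin_cases l <;> rfl
      simp only [this, hav]
      rw [← map_sum, Finsupp.zero_apply]
      convert map_zero (ℓ k)
      refine Subtype.ext ?_
      push_cast
      exact hB (z 0)
    obtain ⟨m, D, hD, hdec⟩ := hα.exists_decomposition hcyc
    refine ⟨m, D, hD, fun v u => ?_⟩
    rw [← hav, hdec, Finsupp.add_apply, bd_apply_two hS hD, Finsupp.finsetSum_apply]
    rfl
  choose m D hD hdec using hex
  refine ⟨fun i => ∑ k, m k i • e k, fun w v u => ∑ k, D k ![w, v, u] • e k,
    IsTriChain.sum _ fun k => isTriChain_smul (hD k) (e k), fun v u => ?_⟩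
  refine (hℓ ⟨B v u, hm v u⟩).trans ?_
  rw [Finset.sum_comm (s := S)]
  simp only [hdec, Finset.smul_sum, add_smul, Finset.sum_smul, Finset.sum_add_distrib, smul_smul]
  congr 1
  rw [Finset.sum_comm]
  simp only [mul_comm]

theorem IsHomologyBasis.eq_zero_of_bd_coeff [Module.IsTorsionFree ℤ E] {F : Cx}
    {S : Finset ℕ} (hS : ∀ v, {v} ∈ F.faces → v ∈ S) {n : ℕ} {α : Fin n → Chain 1}
    (hα : IsHomologyBasis F α) {b : Fin n → E} {D : ℕ → ℕ → ℕ → E} (h : IsTriChain F D)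
    (hD : ∀ v u, ∑ i, α i ![v, u] • b i = ∑ w ∈ S, D w v u) : b = 0 := by
  obtain ⟨ι, _, e, ℓ, hℓ⟩ := exists_coordinates
    ((h.finite_range hS).union (Set.finite_range b))
  have hm : ∀ w v u, D w v u ∈ Submodule.span ℤ
      ((Set.range fun p : ℕ × ℕ × ℕ => D p.1 p.2.1 p.2.2) ∪ Set.range b) := fun w v u =>
    Submodule.subset_span (Or.inl ⟨(w, v, u), rfl⟩)
  have hb : ∀ i, b i ∈ Submodule.span ℤ
      ((Set.range fun p : ℕ × ℕ × ℕ => D p.1 p.2.1 p.2.2) ∪ Set.range b) := fun i =>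
    Submodule.subset_span (Or.inr ⟨i, rfl⟩)
  have hzero : ∀ k i, ℓ k ⟨b i, hb i⟩ = 0 := by
    intro k
    obtain ⟨c, hc, hcv⟩ := h.exists_component hS hm (ℓ k)
    refine congrFun (hα.eq_zero_of_bd (k := fun i => ℓ k ⟨b i, hb i⟩) hc
      (chain_one_ext fun v u => ?_))
    rw [bd_apply_two hS hc, Finset.sum_congr rfl fun w _ => hcv w v u, ← map_sum,
      Finsupp.finsetSum_apply]
    have : ∀ i, ((ℓ k ⟨b i, hb i⟩) • α i) ![v, u] = ℓ k (α i ![v, u] • ⟨b i, hb i⟩) := fun i => by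
      rw [map_smul, Finsupp.smul_apply, smul_eq_mul, smul_eq_mul, mul_comm]
    rw [Finset.sum_congr rfl fun i _ => this i, ← map_sum]
    congr 1
    refine Subtype.ext ?_
    push_cast
    exact hD v u
  funext i
  refine (hℓ ⟨b i, hb i⟩).trans ?_
  simp [hzero]

end Coefficients

/-! ### Antisymmetry of triangle sums and primitives of cochains. -/

section Aux

variable {E : Type*} [AddCommGroup E]

theorem eq_zero_of_add_self [Module.IsTorsionFree ℤ E] {y : E} (h : y + y = 0) : y = 0 := by
  rw [← two_zsmul] at h
  exact (smul_eq_zero_iff_right (two_ne_zero (α := ℤ))).1 h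

theorem IsTriChain.distinct [Module.IsTorsionFree ℤ E] {F : Cx} {Z : ℕ → ℕ → ℕ → E}
    (h : IsTriChain F Z) {w v u : ℕ} (hne : Z w v u ≠ 0) : w ≠ v ∧ w ≠ u ∧ v ≠ u := by
  have h1 := h.swap01 w v u
  have h2 := h.swap12 w v u
  have h3 := h.swap02 w v u
  refine ⟨?_, ?_, ?_⟩ <;> rintro rfl <;> refine hne (eq_zero_of_add_self ?_)
  · nth_rewrite 1 [h1]; simp
  · nth_rewrite 1 [h3]; simp
  · nth_rewrite 1 [h2]; simp

/-- Symmetrising in the last two vertices doubles the sum; the two remaining terms are each odd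
under another exchange of vertices. -/
theorem triSum_eq_zero_of_split [Module.IsTorsionFree ℤ E] (S : Finset ℕ)
    {F A B : ℕ → ℕ → ℕ → E} (hF : ∀ w v u, F w v u + F w u v = A w v u - B w v u)
    (hA : ∀ w v u, A u v w = -A w v u) (hB : ∀ w v u, B v w u = -B w v u) : triSum S F = 0 := by
  refine eq_zero_of_add_self ?_
  nth_rewrite 2 [← triSum_swap12]
  rw [← triSum_add]
  simp only [hF]
  rw [triSum_sub, triSum_eq_zero02 S hA, triSum_eq_zero01 S hB, sub_zero]

/-- A cochain which vanishes on the cycles of a connected complex is a coboundary. -/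
theorem Conn.exists_primitive {F : Cx} (hF : Conn F) {S : Finset ℕ}
    (hS : ∀ v, {v} ∈ F.faces → v ∈ S) {q : ℕ → ℕ → E}
    (hq : ∀ a ∈ cycles F, pairing S a q = 0) :
    ∃ κ : ℕ → E, ∀ v u, {v, u} ∈ F.faces → q v u - q u v = κ v - κ u := by
  by_cases hne : ∃ v₀, {v₀} ∈ F.faces
  · obtain ⟨v₀, hv₀⟩ := hne
    have hp : ∀ v, ∃ p : Chain 1, {v} ∈ F.faces → p ∈ chains F 1 ∧
        bd p = Finsupp.single ![v] 1 - Finsupp.single ![v₀] 1 := by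
      intro v
      by_cases hv : {v} ∈ F.faces
      · obtain ⟨p, h1, h2⟩ := hF.exists_path hv₀ hv
        exact ⟨p, fun _ => ⟨h1, h2⟩⟩
      · exact ⟨0, fun h => absurd h hv⟩
    choose p hp using hp
    refine ⟨fun v => -pairing S (p v) q, fun v u h => ?_⟩
    have hv := vertex_mem_face h (v := v) (by simp)
    have hu := vertex_mem_face h (v := u) (by simp)
    have hz := hq (edge v u + p v + (-1 : ℤ) • p u) ⟨add_mem (add_mem (edge_mem h) (hp v hv).1)
      (Submodule.smul_mem _ _ (hp u hu).1), by
        change bd _ = 0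
        rw [map_add, map_add, map_smul, bd_edge, (hp v hv).2, (hp u hu).2]
        module⟩
    have hneg : pairing S ((-1 : ℤ) • p u) q = -pairing S (p u) q := by
      simp [pairing]
    rw [pairing_add_left, pairing_add_left, pairing_edge (hS v hv) (hS u hu), hneg] at hz
    dsimp only
    rw [← sub_eq_zero, ← hz]
    abel
  · refine ⟨0, fun v u h => absurd ⟨v, vertex_mem_face h (by simp)⟩ hne⟩

theorem pairing_smul_left (S : Finset ℕ) (n : ℤ) (a : Chain 1) (q : ℕ → ℕ → E) :
    pairing S (n • a) q = n • pairing S a q := by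
  simp only [pairing, Finsupp.smul_apply, smul_assoc, Finset.smul_sum]

theorem pairing_sum_left {ι : Type*} (s : Finset ι) (S : Finset ℕ) (a : ι → Chain 1)
    (q : ℕ → ℕ → E) : pairing S (∑ i ∈ s, a i) q = ∑ i ∈ s, pairing S (a i) q := by
  classical
  induction s using Finset.induction_on with
  | empty => simp [pairing]
  | insert i s hi ih => rw [Finset.sum_insert hi, Finset.sum_insert hi, pairing_add_left, ih]

theorem pairing_sum {ι : Type*} (s : Finset ι) (S : Finset ℕ) (a : Chain 1)
    (q : ι → ℕ → ℕ → E) :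
    pairing S a (fun v u => ∑ i ∈ s, q i v u) = ∑ i ∈ s, pairing S a (q i) := by
  classical
  induction s using Finset.induction_on with
  | empty => simp [pairing]
  | insert i s hi ih => simp only [Finset.sum_insert hi]; rw [pairing_add, ih]

theorem sum_smul_sum_eq_pairing (S : Finset ℕ) (q : ℕ → ℕ → ℤ) {n : ℕ} (α : Fin n → Chain 1)
    (d : Fin n → E) : ∑ v ∈ S, ∑ u ∈ S, q v u • ∑ i, α i ![v, u] • d i =
      ∑ i, pairing S (α i) q • d i := by
  simp only [pairing, Finset.smul_sum, Finset.sum_smul, smul_smul, smul_eq_mul]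
  rw [Finset.sum_congr rfl fun v _ => Finset.sum_comm, Finset.sum_comm]
  simp only [mul_comm]

theorem jump_sum {ι : Type*} (s : Finset ι) (o : Chain 3) (ψ : ι → Finset ℕ → E) (w v u : ℕ) :
    jump o (fun τ => ∑ i ∈ s, ψ i τ) w v u = ∑ i ∈ s, jump o (ψ i) w v u := by
  classical
  induction s using Finset.induction_on with
  | empty => simp [jump]
  | insert i s hi ih => simp only [Finset.sum_insert hi]; rw [jump_add, ih]

end Aux

/-! ### Linking data -/

section Systems

variable {T : Cx} {o : Chain 3} {f : Chain 2}

/-- 2-chains bounded by a homology basis of the surface, together with their local potentials. -/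
structure IsSeifertSystem (T : Cx) (o : Chain 3) (f : Chain 2) {n : ℕ} (α : Fin n → Chain 1)
    (M : Matrix (Fin n) (Fin n) ℤ) (c : Fin n → Chain 2) (φ : Fin n → ℕ → Finset ℕ → ℤ)
    (P N : ℕ → ℕ → Finset ℕ) : Prop where
  basis : IsHomologyBasis (supp f) α
  mem : ∀ i, c i ∈ chains T 2
  bd_eq : ∀ i, bd (c i) = α i
  pot : ∀ i, IsPotential o f (fun w u v => c i ![w, u, v]) (φ i)
  tets : IsSideTets T o f P N
  pos : ∀ i j, pairing (vset o) (α i) (fun v u => φ j v (P v u)) = -M i j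
  neg : ∀ i j, pairing (vset o) (α i) (fun v u => φ j v (N v u)) = -M j i

/-- A 2-chain bounded by `x`, together with its local potentials away from `x`. -/
structure IsLinkSystem (T : Cx) (o : Chain 3) (x : Chain 1) (c : Chain 2)
    (φ : ℕ → Finset ℕ → ℤ) : Prop where
  mem : c ∈ chains T 2
  bd_eq : bd c = x
  pot : ∀ v, {v} ∉ (supp x).faces → ∀ w u, c ![w, u, v] = jump o (φ v) w u v

theorem IsSphere.exists_bd {T : Cx} (hT : IsSphere 3 T) {a : Chain 1} (ha : a ∈ chains T 1)
    (h : bd a = 0) : ∃ c ∈ chains T 2, bd c = a :=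
  hT.homologyVanishes (k := 0) (by norm_num) a ha h

/-- The basis cycles bound in the sphere. The positive sides give `M` by its definition, and the
negative sides give its transpose by `pairing_neg_eq_pairing_pos`. -/
theorem exists_seifertSystem (hT : IsSphere 3 T) (ho : IsFundamentalClass T o)
    (hf : IsSurface T f) {n : ℕ} {α : Fin n → Chain 1} (hα : IsHomologyBasis (supp f) α)
    {M : Matrix (Fin n) (Fin n) ℤ} (hM : IsSeifertMatrix T o f α M) :
    ∃ c φ P N, IsSeifertSystem T o f α M c φ P N := by
  obtain ⟨hcyc, -⟩ := id hα
  have h1 : ∀ i, ∃ c ∈ chains T 2, bd c = α i := fun i =>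
    hT.exists_bd (chains_mono hf.supp_subset (hcyc i).1) (hcyc i).2
  choose c hc hbd using h1
  have h2 : ∀ i, ∃ φ : ℕ → Finset ℕ → ℤ, IsPotential o f (fun w u v => c i ![w, u, v]) φ :=
    fun i => exists_potential hT ho hf (hc i) fun v u hne => by
      rw [hbd] at hne
      exact (edge_of_ne_zero (hcyc i).1 hne).2
  choose φ hφ using h2
  obtain ⟨P, N, hPN⟩ := exists_sideTets hT ho hf
  have hpos : ∀ i j, pairing (vset o) (α i) (fun v u => φ j v (P v u)) = -M i j := fun i j =>
    pushoffLinkingNumber_eq hT ho hf (hM i j) (isAlt_of_mem (hcyc i).1) (hc j) (hbd j) (hφ j) hPN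
  refine ⟨c, φ, P, N, hα, hc, hbd, hφ, hPN, hpos, fun i j => ?_⟩
  rw [← hbd i, pairing_neg_eq_pairing_pos hT ho hf (hc i) (hc j) (hφ i) (hφ j) hPN, hbd, hpos]

theorem exists_linkSystem (hT : IsSphere 3 T) (ho : IsFundamentalClass T o) {x : Chain 1}
    (hx : x ∈ chains T 1) (hbd : bd x = 0) : ∃ c φ, IsLinkSystem T o x c φ := by
  obtain ⟨c, hc, rfl⟩ := hT.exists_bd hx hbd
  obtain ⟨φ, hφ⟩ := exists_potential_off hT ho hc
  exact ⟨c, φ, hc, rfl, hφ⟩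

open Classical in
/-- The characteristic function of the vertices of `x`. -/
def ind (x : Chain 1) (v : ℕ) : ℤ := if {v} ∈ (supp x).faces then 1 else 0

theorem ind_eq_zero {x : Chain 1} {v : ℕ} (h : {v} ∉ (supp x).faces) : ind x v = 0 := if_neg h

theorem ind_eq_one {x : Chain 1} {v : ℕ} (h : {v} ∈ (supp x).faces) : ind x v = 1 := if_pos h

theorem notMem_of_disjoint {x : Chain 1} (hd : Disjoint (supp f) (supp x)) {v : ℕ}
    (hv : {v} ∈ (supp f).faces) : {v} ∉ (supp x).faces := by
  intro hx
  have h : {v} ∈ (supp f ⊓ supp x).faces := ⟨hv, hx⟩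
  rw [disjoint_iff.1 hd] at h
  exact h

theorem mem_supp_face {c : Chain 2} {w v u r : ℕ} (h : c ![w, v, u] ≠ 0)
    (hr : r ∈ ({w, v, u} : Finset ℕ)) : {r} ∈ (supp c).faces :=
  mem_supp_of_ne_zero h (by rwa [verts_three])

end Systems

/-! ### Twisted systems of potentials -/

section Twisted

variable {T : Cx} {o : Chain 3} {f : Chain 2} {E : Type*} [AddCommGroup E]

/-- Local potentials, indexed by the vertices, of a 2-chain with coefficients twisted by the
intersection number with `f` and with boundary `ε • x`. -/
def IsTwisted (τ : E ≃ₗ[ℤ] E) (o : Chain 3) (f : Chain 2) (x : Chain 1) (c : Chain 2) (ε : E)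
    (φ : ℕ → Finset ℕ → E) : Prop :=
  ∀ s s' w v u, o ![s, w, v, u] ≠ 0 → o ![s', w, v, u] ≠ 0 → s ≠ s' →
    (τ ^ (o ![s, w, v, u] * f ![w, v, u])) (φ v {s', w, v, u}) - φ v {s, w, v, u} -
        (o ![s, w, v, u] * (ind x v * c ![w, v, u])) • ε =
      (τ ^ (o ![s, w, v, u] * f ![w, v, u])) (φ u {s', w, v, u}) - φ u {s, w, v, u} -
        (o ![s, w, v, u] * (ind x u * c ![w, v, u])) • ε

theorem twist_eq (hT : IsSphere 3 T) (ho : IsFundamentalClass T o) {s s' w v u : ℕ}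
    (hs : o ![s, w, v, u] ≠ 0) (hs' : o ![s', w, v, u] ≠ 0) (hne : s ≠ s') (g : Finset ℕ → E)
    (k : ℤ) (ε : E) : g {s', w, v, u} - g {s, w, v, u} - (o ![s, w, v, u] * k) • ε =
      -(o ![s, w, v, u] • (jump o g w v u + k • ε)) := by
  rw [jump_eq hT ho g hs hs' hne]
  rcases ho.eq_or hs with h | h <;> rw [h] <;> simp only [one_smul, neg_smul, one_mul, neg_mul]
  · abel
  · abel

/-- Off the surface the twist is trivial, so the condition says that the potentials at different
vertices of a triangle give it the same coefficient. At vertices of `x`, where the chain has no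
potential, `ind` reinstates the part coming from `c`. -/
theorem IsTwisted.jump_eq (hT : IsSphere 3 T) (ho : IsFundamentalClass T o) {τ : E ≃ₗ[ℤ] E}
    {x : Chain 1} {c : Chain 2} (hc : c ∈ chains T 2) {ε : E} {φ : ℕ → Finset ℕ → E}
    (h : IsTwisted τ o f x c ε φ) {w v u : ℕ} (h0 : f ![w, v, u] = 0) :
    jump o (φ v) w v u + (ind x v * c ![w, v, u]) • ε =
      jump o (φ u) w v u + (ind x u * c ![w, v, u]) • ε := by
  by_cases hex : ∃ s, o ![s, w, v, u] ≠ 0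
  · obtain ⟨s, hs⟩ := hex
    obtain ⟨s', hne, hs', -⟩ := exists_opposite hT ho hs
    have hs0 : o ![s', w, v, u] ≠ 0 := by rw [hs']; simpa using hs
    have := h s s' w v u hs hs0 hne.symm
    rw [h0, mul_zero, zpow_zero, LinearEquiv.coe_one, id, id, twist_eq hT ho hs hs0 hne.symm,
      twist_eq hT ho hs hs0 hne.symm, neg_inj] at this
    rcases ho.eq_or hs with h | h <;> rw [h] at this
    · simpa using this
    · rwa [neg_smul, neg_smul, one_smul, one_smul, neg_inj] at this
  · push Not at hex
    have hc0 : c ![w, v, u] = 0 := by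
      by_contra hne
      have hm := hc.1 _ hne
      rw [verts_three, injective_three] at hm
      obtain ⟨s, -, -, hs, -⟩ := exists_two_cofaces hT ho hm.1.1 hm.1.2.1 hm.1.2.2 hm.2
      exact hs (hex s)
    simp [jump, hex, hc0]

theorem isTwisted_of (hT : IsSphere 3 T) (ho : IsFundamentalClass T o) (hf : IsSurface T f)
    {τ : E ≃ₗ[ℤ] E} {x : Chain 1} (hd : Disjoint (supp f) (supp x)) {c : Chain 2} {ε : E}
    {φ : ℕ → Finset ℕ → E}
    (h0 : ∀ w v u, f ![w, v, u] = 0 → jump o (φ v) w v u + (ind x v * c ![w, v, u]) • ε =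
      jump o (φ u) w v u + (ind x u * c ![w, v, u]) • ε)
    (h1 : ∀ s s' w v u, o ![s, w, v, u] * f ![w, v, u] = -1 →
      o ![s', w, v, u] * f ![w, v, u] = 1 →
      τ (φ v {s, w, v, u}) - φ v {s', w, v, u} = τ (φ u {s, w, v, u}) - φ u {s', w, v, u}) :
    IsTwisted τ o f x c ε φ := by
  intro s s' w v u hs hs' hne
  by_cases hf0 : f ![w, v, u] = 0
  · rw [hf0, mul_zero, zpow_zero, LinearEquiv.coe_one, id, id, twist_eq hT ho hs hs' hne,
      twist_eq hT ho hs hs' hne, h0 w v u hf0]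
  · rw [ind_eq_zero (notMem_of_disjoint hd (mem_supp_face hf0 (r := v) (by simp))),
      ind_eq_zero (notMem_of_disjoint hd (mem_supp_face hf0 (r := u) (by simp)))]
    simp only [zero_mul, mul_zero, zero_smul, sub_zero]
    obtain ⟨r, hr, hrs, hall⟩ := exists_opposite hT ho hs
    obtain rfl : s' = r := (hall s' hs').resolve_left hne.symm
    have hval : o ![s, w, v, u] * f ![w, v, u] = 1 ∨ o ![s, w, v, u] * f ![w, v, u] = -1 := by
      rcases ho.eq_or hs with h | h <;> rcases hf.eq_or ![w, v, u] with h' | h' | h' <;> simp_all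
    have hopp : o ![s', w, v, u] * f ![w, v, u] = -(o ![s, w, v, u] * f ![w, v, u]) := by
      rw [hrs]; ring
    rcases hval with hval | hval
    · rw [hval, zpow_one]
      exact h1 s' s w v u (by rw [hopp, hval]) hval
    · rw [hval, zpow_neg_one]
      have := h1 s s' w v u hval (by rw [hopp, hval]; rfl)
      -- Crossing in the other direction involves the inverse of τ; applying τ gives the hypothesis
      -- up to sign.
      apply τ.injective
      rw [map_sub, map_sub, ← LinearEquiv.mul_apply, ← LinearEquiv.mul_apply, mul_inv_cancel,
        LinearEquiv.coe_one, id, id, ← neg_inj, neg_sub, neg_sub, this]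

theorem IsTwisted.side_eq {τ : E ≃ₗ[ℤ] E} {x : Chain 1} (hd : Disjoint (supp f) (supp x))
    {c : Chain 2} {ε : E} {φ : ℕ → Finset ℕ → E} (h : IsTwisted τ o f x c ε φ) {s s' w v u : ℕ}
    (hs : o ![s, w, v, u] * f ![w, v, u] = -1) (hs' : o ![s', w, v, u] * f ![w, v, u] = 1) :
    τ (φ v {s, w, v, u}) - φ v {s', w, v, u} = τ (φ u {s, w, v, u}) - φ u {s', w, v, u} := by
  have hf0 : f ![w, v, u] ≠ 0 := fun h0 => by rw [h0] at hs; simp at hs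
  have h1 := h s' s w v u (fun h0 => by rw [h0] at hs'; simp at hs')
    (fun h0 => by rw [h0] at hs; simp at hs) (by rintro rfl; rw [hs] at hs'; simp at hs')
  rw [ind_eq_zero (notMem_of_disjoint hd (mem_supp_face hf0 (r := v) (by simp))),
    ind_eq_zero (notMem_of_disjoint hd (mem_supp_face hf0 (r := u) (by simp))), hs'] at h1
  simpa using h1

/-- Changing the surface by a boundary amounts to a change of gauge. -/
theorem IsTwisted.gauge (hT : IsSphere 3 T) (ho : IsFundamentalClass T o) {τ : E ≃ₗ[ℤ] E}
    {x : Chain 1} {c : Chain 2} {ε : E} {φ : ℕ → Finset ℕ → E} (h : IsTwisted τ o f x c ε φ)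
    {g : Chain 2} {e : Finset ℕ → ℤ} (hg : ∀ w v u, g ![w, v, u] = f ![w, v, u] + jump o e w v u)
    (he : ∀ z, o z ≠ 0 → ∀ u ∈ verts z, {u} ∈ (supp x).faces → e (verts z) = 0) :
    IsTwisted τ o g x c ε (fun v σ => (τ ^ e σ) (φ v σ)) := by
  intro s s' w v u hs hs' hne
  -- The exponent of τ at a crossing changes by the difference of `e` on the two tetrahedra, exactly
  -- what rescaling by τ^e compensates.
  have hm : o ![s, w, v, u] * g ![w, v, u] = e {s, w, v, u} +
      o ![s, w, v, u] * f ![w, v, u] - e {s', w, v, u} := by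
    rw [hg, PLKnot.jump_eq hT ho e hs hs' hne, smul_eq_mul]
    rcases ho.eq_or hs with h | h <;> rw [h] <;> ring
  -- The term with ε is present only at vertices of `x`, where `e` vanishes.
  have hex : ∀ r ∈ ({w, v, u} : Finset ℕ), (o ![s, w, v, u] * (ind x r * c ![w, v, u])) • ε =
      (τ ^ e {s, w, v, u}) ((o ![s, w, v, u] * (ind x r * c ![w, v, u])) • ε) := by
    intro r hr
    by_cases hrx : {r} ∈ (supp x).faces
    · have := he _ hs r (by rw [verts_four]; grind) hrx
      rw [verts_four] at this
      rw [this, zpow_zero]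
      rfl
    · rw [ind_eq_zero hrx]; simp
  have hτ : ∀ y, (τ ^ (o ![s, w, v, u] * g ![w, v, u])) ((τ ^ e {s', w, v, u}) y) =
      (τ ^ e {s, w, v, u}) ((τ ^ (o ![s, w, v, u] * f ![w, v, u])) y) := by
    intro y
    rw [← LinearEquiv.mul_apply, ← LinearEquiv.mul_apply, ← zpow_add, ← zpow_add, hm,
      sub_add_cancel]
  rw [hτ, hτ, hex v (by simp), hex u (by simp), ← map_sub, ← map_sub, ← map_sub, ← map_sub,
    h s s' w v u hs hs' hne]

end Twisted

/-! ### Twisted potentials and solutions of the Seifert equations. -/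

section Twisted

variable {T : Cx} {o : Chain 3} {f : Chain 2} {E : Type*} [AddCommGroup E]

/-- The local potentials of the 2-chain `ε • c + ∑ i, d i • cᵢ`. -/
def combinedPotential (x : Chain 1) (φ : ℕ → Finset ℕ → ℤ) {n : ℕ} (χ : Fin n → ℕ → Finset ℕ → ℤ)
    (ε : E) (d : Fin n → E) (v : ℕ) (σ : Finset ℕ) : E :=
  ((1 - ind x v) * φ v σ) • ε + ∑ i, χ i v σ • d i

theorem jump_combinedPotential {x : Chain 1} {c : Chain 2} {φ : ℕ → Finset ℕ → ℤ}
    (hx : IsLinkSystem T o x c φ) {n : ℕ} {α : Fin n → Chain 1} {M : Matrix (Fin n) (Fin n) ℤ}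
    {C : Fin n → Chain 2} {χ : Fin n → ℕ → Finset ℕ → ℤ} {P N : ℕ → ℕ → Finset ℕ}
    (hs : IsSeifertSystem T o f α M C χ P N) (ε : E) (d : Fin n → E) {w v u : ℕ}
    (h0 : f ![w, v, u] = 0) : jump o (combinedPotential x φ χ ε d u) w v u =
      ((1 - ind x u) * c ![w, v, u]) • ε + ∑ i, C i ![w, v, u] • d i := by
  have h1 : jump o (combinedPotential x φ χ ε d u) w v u =
      jump o (fun σ => (1 - ind x u) * φ u σ) w v u • ε +
        ∑ i, jump o (χ i u) w v u • d i := by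
    rw [← jump_smul, Finset.sum_congr rfl fun i _ => (jump_smul o (χ i u) (d i) w v u).symm,
      ← jump_sum, ← jump_add]
    rfl
  rw [h1]
  refine congrArg₂ (· + ·) (congrArg (· • ε) ?_) (Finset.sum_congr rfl fun i _ => ?_)
  · by_cases hu : {u} ∈ (supp x).faces
    · rw [ind_eq_one hu]; simp [jump]
    · rw [ind_eq_zero hu, hx.pot u hu w v]; simp
  · rw [← hs.pot i w v u h0]

theorem jump_combinedPotential_swap (ho : IsFundamentalClass T o) (hf : IsSurface T f)
    {x : Chain 1} {c : Chain 2} {φ : ℕ → Finset ℕ → ℤ}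
    (hx : IsLinkSystem T o x c φ) {n : ℕ} {α : Fin n → Chain 1} {M : Matrix (Fin n) (Fin n) ℤ}
    {C : Fin n → Chain 2} {χ : Fin n → ℕ → Finset ℕ → ℤ} {P N : ℕ → ℕ → Finset ℕ}
    (hs : IsSeifertSystem T o f α M C χ P N) (ε : E) (d : Fin n → E) {w v u : ℕ}
    (h0 : f ![w, v, u] = 0) : jump o (combinedPotential x φ χ ε d v) w v u =
      ((1 - ind x v) * c ![w, v, u]) • ε + ∑ i, C i ![w, v, u] • d i := by
  rw [jump_swap12 ho _ w u v, jump_combinedPotential hx hs ε d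
    (by rw [hf.isAlt.tri12 w v u, h0, neg_zero]), (isAlt_of_mem hx.mem).tri12 w v u,
    Finset.sum_congr rfl fun i _ => by rw [(isAlt_of_mem (hs.mem i)).tri12 w v u]]
  simp only [mul_neg, neg_smul, Finset.sum_neg_distrib]
  abel

theorem pairing_combinedPotential {x : Chain 1} (hd : Disjoint (supp f) (supp x))
    (φ : ℕ → Finset ℕ → ℤ) {n : ℕ} (χ : Fin n → ℕ → Finset ℕ → ℤ) (ε : E) (d : Fin n → E)
    {a : Chain 1} (ha : a ∈ chains (supp f) 1) (t : ℕ → ℕ → Finset ℕ) {k : ℤ} {m : Fin n → ℤ}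
    (hk : pairing (vset o) a (fun v u => φ v (t v u)) = -k)
    (hm : ∀ i, pairing (vset o) a (fun v u => χ i v (t v u)) = -m i) :
    pairing (vset o) a (fun v u => combinedPotential x φ χ ε d v (t v u)) =
      -(k • ε + ∑ i, m i • d i) := by
  unfold combinedPotential
  rw [pairing_add, pairing_sum]
  simp only [pairing_smul, hm]
  rw [pairing_congr (q' := fun v u => φ v (t v u)), hk]
  · simp only [neg_smul, Finset.sum_neg_distrib]
    abel
  · intro v u hne
    rw [ind_eq_zero (notMem_of_disjoint hd (vertex_mem_face (edge_of_ne_zero ha hne).2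
      (by simp)))]
    ring

variable [Module.IsTorsionFree ℤ E]

/-- Start from the untwisted chain εc + ∑ (τ - 1)(b_i) C_i cut along the surface. Its potentials
fail to match across the surface by a cochain on the edges of the surface; the equations for `b` say
that this cochain vanishes on cycles, and then it can be removed by shifting the potentials by
constants. -/
theorem exists_twisted (hT : IsSphere 3 T) (ho : IsFundamentalClass T o) (hf : IsSurface T f)
    {τ : E ≃ₗ[ℤ] E} {ρ : E →ₗ[ℤ] E} (hρ : ∀ y, τ (ρ y) - ρ y = y)
    {x : Chain 1} (hd : Disjoint (supp f) (supp x)) {c : Chain 2} {φ : ℕ → Finset ℕ → ℤ}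
    (hx : IsLinkSystem T o x c φ) {n : ℕ} {α : Fin n → Chain 1} {M : Matrix (Fin n) (Fin n) ℤ}
    {C : Fin n → Chain 2} {χ : Fin n → ℕ → Finset ℕ → ℤ} {P N : ℕ → ℕ → Finset ℕ}
    (hs : IsSeifertSystem T o f α M C χ P N) {V : Fin n → ℤ}
    (hV : ∀ i t, IsEdgeTet T o t → pairing (vset o) (α i) (fun v u => φ v (t v u)) = -V i)
    {ε : E} {b : Fin n → E} (hb : ∀ i, ∑ j, (M i j • τ (b j) - M j i • b j) = -(V i • ε)) :
    ∃ θ : ℕ → Finset ℕ → E, IsTwisted τ o f x c ε θ ∧ ∀ w v u, f ![w, v, u] = 0 →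
      jump o (θ u) w v u + (ind x u * c ![w, v, u]) • ε =
        c ![w, v, u] • ε + ∑ i, C i ![w, v, u] • (τ (b i) - b i) := by
  set d : Fin n → E := fun i => τ (b i) - b i with hd_def
  set θ := combinedPotential x φ χ ε d with hθ
  obtain ⟨hcyc, -⟩ := id hs.basis
  have hS : ∀ v, {v} ∈ (supp f).faces → v ∈ vset o := fun v hv =>
    mem_vset_of_mem hT ho (hf.supp_subset hv)
  have hjump : ∀ w v u, f ![w, v, u] = 0 →
      jump o (θ u) w v u = ((1 - ind x u) * c ![w, v, u]) • ε + ∑ i, C i ![w, v, u] • d i :=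
    fun w v u h0 => jump_combinedPotential hx hs ε d h0
  have hjump' : ∀ w v u, f ![w, v, u] = 0 →
      jump o (θ v) w v u = ((1 - ind x v) * c ![w, v, u]) • ε + ∑ i, C i ![w, v, u] • d i :=
    fun w v u h0 => jump_combinedPotential_swap ho hf hx hs ε d h0
  have hind : ∀ {v u}, {v, u} ∈ (supp f).faces → ind x v = 0 ∧ ind x u = 0 := fun h =>
    ⟨ind_eq_zero (notMem_of_disjoint hd (vertex_mem_face h (by simp))),
      ind_eq_zero (notMem_of_disjoint hd (vertex_mem_face h (by simp)))⟩
  have hdiff : ∀ {v u}, {v, u} ∈ (supp f).faces → ∀ w, f ![w, v, u] = 0 →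
      jump o (fun σ => θ v σ - θ u σ) w v u = 0 := by
    intro v u hvu w h0
    rw [jump_sub, hjump w v u h0, hjump' w v u h0, (hind hvu).1, (hind hvu).2, sub_self]
  -- The twisted jump of the potential of `v` across the surface, sampled at the edge vu. Matching
  -- requires q v u = q u v, and `hq` shows that the mismatch at a triangle depends only on the
  -- edge.
  let q : ℕ → ℕ → E := fun v u => τ (θ v (P v u)) - θ v (N v u)
  have hq : ∀ s s' w v u, o ![s, w, v, u] * f ![w, v, u] = -1 →
      o ![s', w, v, u] * f ![w, v, u] = 1 → (τ (θ v {s, w, v, u}) - θ v {s', w, v, u}) -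
        (τ (θ u {s, w, v, u}) - θ u {s', w, v, u}) = q v u - q u v := by
    intro s s' w v u h1 h2
    have hf0 : f ![w, v, u] ≠ 0 := fun h0 => by rw [h0] at h1; simp at h1
    have hne := (injective_three.1 (hf.isAlt.injective_of_ne_zero hf0)).2.2
    have hvu : {v, u} ∈ (supp f).faces :=
      ⟨Finset.insert_nonempty _ _, _, hf0, by rw [verts_three]; grind⟩
    obtain ⟨w', r, r', h3, h4, h5, h6⟩ := hs.tets.exists_triangle v u hne hvu
    have e1 := eq_of_same_side hT ho hf (hdiff hvu) (Or.inr rfl) h1 h3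
    have e2 := eq_of_same_side hT ho hf (hdiff hvu) (Or.inl rfl) h2 h4
    have e3 := congrArg τ e1
    rw [map_sub, map_sub] at e3
    simp only [q, hs.tets.pos.1 u v, hs.tets.neg.1 u v, h5, h6]
    calc _ = (τ (θ v {s, w, v, u}) - τ (θ u {s, w, v, u})) -
        (θ v {s', w, v, u} - θ u {s', w, v, u}) := by abel
      _ = _ := by rw [e2, e3]; abel
  -- By the linking matrices on the two sides, this pairing is -(τ - 1) applied to the i-th equation
  -- for `b`.
  have hcycle : ∀ i, pairing (vset o) (α i) q = 0 := by
    intro i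
    have hP := pairing_combinedPotential (o := o) hd φ χ ε d (hcyc i).1 P (hV i P hs.tets.pos)
      (hs.pos i)
    have hN := pairing_combinedPotential (o := o) hd φ χ ε d (hcyc i).1 N (hV i N hs.tets.neg)
      (hs.neg i)
    have h1 : pairing (vset o) (α i) q =
        τ (pairing (vset o) (α i) (fun v u => θ v (P v u))) -
        pairing (vset o) (α i) (fun v u => θ v (N v u)) := by
      rw [pairing_sub]
      congr 1
      exact pairing_map (τ : E →ₗ[ℤ] E).toAddMonoidHom _ _ _
    rw [h1, hP, hN]
    have h2 := hb i
    have h3 := congrArg τ h2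
    rw [Finset.sum_sub_distrib] at h2
    simp only [map_sub, map_sum, map_smul, map_neg, Finset.sum_sub_distrib] at h3
    simp only [hd_def, map_neg, map_add, map_sum, map_smul, map_sub, smul_sub,
      Finset.sum_sub_distrib]
    rw [eq_neg_iff_add_eq_zero] at h2 h3
    rw [← neg_eq_zero, ← sub_zero (0 : E)]
    nth_rewrite 1 [← h3]
    rw [← h2]
    abel
  have hbound : ∀ D ∈ chains (supp f) 2, pairing (vset o) (bd D) q = 0 := by
    intro D hD
    have hDa := isAlt_of_mem hD
    have h1 : pairing (vset o) (bd D) q = triSum (vset o) fun w v u => D ![w, v, u] • q v u := by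
      refine Finset.sum_congr rfl fun v _ => Finset.sum_congr rfl fun u _ => ?_
      rw [bd_apply_two hS hD, Finset.sum_smul]
    rw [h1]
    refine triSum_eq_zero_of_split _
      (A := fun w v u => D ![w, v, u] • (τ (side o f (-1) (θ v) w v u) - side o f 1 (θ v) w v u))
      (B := fun w v u => D ![w, v, u] • (τ (side o f (-1) (θ u) w v u) - side o f 1 (θ u) w v u))
      ?_ ?_ ?_
    · intro w v u
      rw [hDa.tri12 w v u, neg_smul, ← sub_eq_add_neg, ← smul_sub, ← smul_sub]
      by_cases hD0 : D ![w, v, u] = 0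
      · rw [hD0, zero_smul, zero_smul]
      have hm := hD.1 _ hD0
      rw [injective_three, verts_three] at hm
      have hf0 : f ![w, v, u] ≠ 0 :=
        (hf.isAlt.triangle_mem_supp hm.1.1 hm.1.2.1 hm.1.2.2).1 hm.2
      obtain ⟨s, s', -, h2, h3⟩ := exists_side hT ho hf hf0
      rw [side_eq hT ho (Or.inr rfl) _ h2, side_eq hT ho (Or.inr rfl) _ h2,
        side_eq hT ho (Or.inl rfl) _ h3, side_eq hT ho (Or.inl rfl) _ h3, hq s s' w v u h2 h3]
    · intro w v u
      simp only [hDa.tri02 w v u, side_swap02 ho.isAlt hf.isAlt _ _ w v u, neg_smul]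
    · intro w v u
      simp only [hDa.tri01 w v u, side_swap01 ho.isAlt hf.isAlt _ _ w v u, neg_smul]
  -- Subtracting the constant ρ(κ v) from the potential of `v` changes its twisted jump by (τ -
  -- 1)ρ(κ v) = κ v and leaves its jumps off the surface unchanged.
  obtain ⟨κ, hκ⟩ := hf.conn.exists_primitive hS (q := q) (by
    intro a ha
    obtain ⟨k, D, hD, rfl⟩ := hs.basis.exists_decomposition ha
    rw [pairing_add_left, hbound D hD, add_zero, pairing_sum_left]
    refine Finset.sum_eq_zero fun i _ => ?_
    rw [pairing_smul_left, hcycle, smul_zero])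
  have hjκ : ∀ w v u r, jump o (fun σ => θ r σ - ρ (κ r)) w v u = jump o (θ r) w v u := by
    intro w v u r
    rw [jump_sub, jump_eq_zero hT ho (ψ := fun _ => ρ (κ r)) fun _ _ _ _ => rfl, sub_zero]
  have hsum : ∀ (k : ℤ) (r : ℕ) (y : E), ((1 - ind x r) * k) • ε + y + (ind x r * k) • ε =
      k • ε + y := by
    intro k r y
    rw [add_right_comm, ← add_smul]
    congr 2
    ring
  refine ⟨fun v σ => θ v σ - ρ (κ v), isTwisted_of hT ho hf hd ?_ ?_, ?_⟩
  · intro w v u h0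
    rw [hjκ, hjκ, hjump w v u h0, hjump' w v u h0, hsum, hsum]
  · intro s s' w v u h1 h2
    have hf0 : f ![w, v, u] ≠ 0 := fun h0 => by rw [h0] at h1; simp at h1
    have e1 := hq s s' w v u h1 h2
    rw [hκ v u ⟨Finset.insert_nonempty _ _, _, hf0, by rw [verts_three]; grind⟩] at e1
    rw [← sub_eq_zero] at e1
    rw [map_sub, map_sub, ← sub_eq_zero, ← e1]
    nth_rewrite 3 [← hρ (κ v)]
    nth_rewrite 3 [← hρ (κ u)]
    abel
  · intro w v u h0
    rw [hjκ, hjump w v u h0, hsum]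

/-- The converse of `exists_twisted`. The jumps off the surface form a chain whose boundary is εx
plus a cycle of the surface. Dividing that cycle by τ - 1 and expanding it in the homology basis
yields `b`, and matching across the surface yields the equations. -/
theorem IsTwisted.exists_solution (hT : IsSphere 3 T) (ho : IsFundamentalClass T o)
    (hf : IsSurface T f) {τ : E ≃ₗ[ℤ] E} {ρ : E →ₗ[ℤ] E} (hρ : ∀ y, τ (ρ y) - ρ y = y)
    (hτ : ∀ y, τ y = y → y = 0)
    {x : Chain 1} (hxa : IsAlt x) (hxc : bd x = 0) (hd : Disjoint (supp f) (supp x)) {c : Chain 2}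
    {φ : ℕ → Finset ℕ → ℤ} (hx : IsLinkSystem T o x c φ) {n : ℕ} {α : Fin n → Chain 1}
    {M : Matrix (Fin n) (Fin n) ℤ} {C : Fin n → Chain 2} {χ : Fin n → ℕ → Finset ℕ → ℤ}
    {P N : ℕ → ℕ → Finset ℕ} (hs : IsSeifertSystem T o f α M C χ P N) {V : Fin n → ℤ}
    (hV : ∀ i t, IsEdgeTet T o t → pairing (vset o) (α i) (fun v u => φ v (t v u)) = -V i)
    {ε : E} {θ : ℕ → Finset ℕ → E} (hθ : IsTwisted τ o f x c ε θ) :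
    ∃ (b : Fin n → E) (Ψ : Finset ℕ → E),
      (∀ i, ∑ j, (M i j • τ (b j) - M j i • b j) = -(V i • ε)) ∧
      ∀ w v u, f ![w, v, u] = 0 → jump o (θ u) w v u + (ind x u * c ![w, v, u]) • ε =
        c ![w, v, u] • ε + ∑ i, C i ![w, v, u] • (τ (b i) - b i) + jump o Ψ w v u := by
  classical
  obtain ⟨hcyc, -⟩ := id hs.basis
  have hS : ∀ v, {v} ∈ T.faces → v ∈ vset o := fun v hv => mem_vset_of_mem hT ho hv
  have hSf : ∀ v, {v} ∈ (supp f).faces → v ∈ vset o := fun v hv => hS v (hf.supp_subset hv)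
  have hca := isAlt_of_mem hx.mem
  -- the jumps away from the surface
  let Z : ℕ → ℕ → ℕ → E := fun w v u =>
    if f ![w, v, u] = 0 then jump o (θ u) w v u + (ind x u * c ![w, v, u]) • ε else 0
  have hZ0 : ∀ {w v u}, f ![w, v, u] = 0 →
      Z w v u = jump o (θ u) w v u + (ind x u * c ![w, v, u]) • ε := fun h => if_pos h
  have hZ1 : ∀ {w v u}, f ![w, v, u] ≠ 0 → Z w v u = 0 := fun h => if_neg h
  have hZ : IsTriChain T Z := by
    refine ⟨fun w v u => ?_, fun w v u => ?_, fun w v u hne => ?_⟩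
    · by_cases h0 : f ![w, v, u] = 0
      · rw [hZ0 h0, hZ0 (by rw [hf.isAlt.tri01 w v u, h0, neg_zero]), jump_swap01 ho _ w v u,
          hca.tri01 w v u, mul_neg, neg_smul, neg_add]
      · rw [hZ1 h0, hZ1 (by rw [hf.isAlt.tri01 w v u]; simpa using h0), neg_zero]
    · by_cases h0 : f ![w, v, u] = 0
      · rw [hZ0 h0, hZ0 (by rw [hf.isAlt.tri12 w v u, h0, neg_zero]), jump_swap12 ho _ w v u,
          hca.tri12 w v u, mul_neg, neg_smul, ← neg_add, hθ.jump_eq hT ho hx.mem h0]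
      · rw [hZ1 h0, hZ1 (by rw [hf.isAlt.tri12 w v u]; simpa using h0), neg_zero]
    · by_contra hF
      have hc0 : c ![w, v, u] = 0 := by
        by_contra h1
        have := (hx.mem.1 _ h1).2
        rw [verts_three] at this
        exact hF this
      refine hne ?_
      by_cases h0 : f ![w, v, u] = 0
      · rw [hZ0 h0, jump_eq_zero_of_notMem ho _ hF, hc0]; simp
      · exact hZ1 h0
  -- its boundary, divided by `τ - 1`
  let B : ℕ → ℕ → E := fun v u => ρ (∑ w ∈ vset o, Z w v u - x ![v, u] • ε)
  have hB : IsEdgeChain (supp f) B := by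
    refine ⟨fun v u => ?_, fun v u hne => ?_⟩
    · simp only [B]
      rw [← map_neg, hxa.swap01 v u, Finset.sum_congr rfl fun w _ => hZ.swap12 w v u]
      congr 1
      rw [Finset.sum_neg_distrib, neg_smul]
      abel
    · by_contra hF
      refine hne ?_
      have h0 : ∀ w, f ![w, v, u] = 0 := by
        intro w
        by_contra h1
        exact hF ⟨Finset.insert_nonempty _ _, _, h1, by rw [verts_three]; grind⟩
      simp only [B]
      rw [Finset.sum_congr rfl fun w _ => hZ0 (h0 w), Finset.sum_add_distrib, sum_jump ho,
        zero_add, ← Finset.sum_smul, ← Finset.mul_sum, ← bd_apply_two hS hx.mem, hx.bd_eq]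
      convert map_zero ρ
      by_cases hx0 : x ![v, u] = 0
      · simp [hx0]
      · rw [ind_eq_one (mem_supp_of_ne_zero hx0 (by rw [verts_two]; simp)), one_mul, sub_self]
  have hBc : ∀ u, ∑ v ∈ vset o, B v u = 0 := by
    intro u
    simp only [B]
    rw [← map_sum, Finset.sum_sub_distrib, ← Finset.sum_smul]
    have h1 : ∑ v ∈ vset o, x ![v, u] = 0 := by
      have := bd_apply x ![u] (vset o) fun w hw => by
        rw [← hx.bd_eq] at hw
        exact hS _ (vertex_mem_face ((bd_mem hx.mem).1 _ hw).2 (mem_verts.2 ⟨0, rfl⟩))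
      rw [hxc] at this
      exact this.symm
    rw [h1, zero_smul, sub_zero, sum_sum_antisymm _ (fun v w => Z w v u)
      (fun v w => hZ.swap01 v w u ▸ by simp), map_zero]
  obtain ⟨b, D, hD, hdec⟩ := hs.basis.exists_decomposition_coeff hSf hB hBc
  have hDT := hD.mono hf.supp_subset
  have hτB : ∀ v u, τ (B v u) - B v u = ∑ w ∈ vset o, Z w v u - x ![v, u] • ε := fun v u => hρ _
  have hR : IsTriChain T fun w v u => Z w v u - (c ![w, v, u] • ε +
      ∑ i, C i ![w, v, u] • (τ (b i) - b i) + (τ (D w v u) - D w v u)) :=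
    hZ.sub (((isTriChain_smul hx.mem ε).add
      (IsTriChain.sum _ fun i => isTriChain_smul (hs.mem i) _)).add
      ((hDT.map (τ : E →ₗ[ℤ] E).toAddMonoidHom).sub hDT))
  -- What remains after removing the model chain and a 2-chain of the surface is closed, hence the
  -- jump of a global function.
  obtain ⟨Ψ, hΨ⟩ := hR.exists_potential hT ho (by
    intro v u
    have h1 := hτB v u
    rw [hdec v u] at h1
    simp only [map_add, map_sum, map_smul] at h1
    rw [Finset.sum_sub_distrib, Finset.sum_add_distrib, Finset.sum_add_distrib, ← Finset.sum_smul,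
      ← bd_apply_two hS hx.mem, hx.bd_eq, Finset.sum_comm, Finset.sum_sub_distrib]
    simp only [← Finset.sum_smul, ← bd_apply_two hS (hs.mem _), hs.bd_eq, smul_sub,
      Finset.sum_sub_distrib]
    rw [← sub_eq_zero] at h1
    rw [← neg_eq_zero, ← h1]
    abel)
  have hmain : ∀ w v u, f ![w, v, u] = 0 → jump o (θ u) w v u + (ind x u * c ![w, v, u]) • ε =
        c ![w, v, u] • ε + ∑ i, C i ![w, v, u] • (τ (b i) - b i) + jump o Ψ w v u := by
    intro w v u h0
    have hD0 : D w v u = 0 := by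
      by_contra hne
      have hdist := hD.distinct hne
      exact (hf.isAlt.triangle_mem_supp hdist.1 hdist.2.1 hdist.2.2).1 (hD.mem w v u hne) h0
    rw [← hZ0 h0, ← hΨ, hD0, map_zero]
    abel
  refine ⟨b, Ψ, fun i => ?_, hmain⟩
  set d : Fin n → E := fun i => τ (b i) - b i with hd_def
  -- The given potentials and the model ones, corrected by Ψ, have equal jumps off the surface, so
  -- they pair equally with each basis cycle on either side.
  let k : ℕ → Finset ℕ → E := fun v σ => θ v σ - combinedPotential x φ χ ε d v σ - Ψ σ
  have hk : ∀ w u v, f ![w, u, v] = 0 → jump o (k v) w u v = 0 := by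
    intro w u v h0
    simp only [k]
    rw [jump_sub, jump_sub, jump_combinedPotential hx hs ε d h0,
      eq_sub_of_add_eq (hmain w u v h0), sub_mul, sub_smul, one_mul]
    abel
  have hkP := pairing_side_eq_zero hT ho hf (Or.inr rfl) hs.tets.isSide_pos hk (hcyc i)
  have hkN := pairing_side_eq_zero hT ho hf (Or.inl rfl) hs.tets.isSide_neg hk (hcyc i)
  have hia := isAlt_of_mem (hcyc i).1
  have hΨP := pairing_eq_zero_of_symm (vset o) hia (q := fun v u => Ψ (P v u))
    fun v u => by rw [hs.tets.pos.1]
  have hΨN := pairing_eq_zero_of_symm (vset o) hia (q := fun v u => Ψ (N v u))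
    fun v u => by rw [hs.tets.neg.1]
  -- The twisted jump across the surface is the same for both ends of an edge, and a symmetric
  -- function pairs to zero.
  have hθ0 : τ (pairing (vset o) (α i) (fun v u => θ v (P v u))) -
      pairing (vset o) (α i) (fun v u => θ v (N v u)) = 0 := by
    have h1 : τ (pairing (vset o) (α i) (fun v u => θ v (P v u))) =
        pairing (vset o) (α i) (fun v u => τ (θ v (P v u))) :=
      (pairing_map (τ : E →ₗ[ℤ] E).toAddMonoidHom _ _ _).symm
    rw [h1, ← pairing_sub]
    have hsym : ∀ v u, α i ![v, u] ≠ 0 →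
        τ (θ v (P v u)) - θ v (N v u) = τ (θ u (P v u)) - θ u (N v u) := by
      intro v u hne
      obtain ⟨h2, h3⟩ := edge_of_ne_zero (hcyc i).1 hne
      obtain ⟨w, s, s', h4, h5, h6, h7⟩ := hs.tets.exists_triangle v u h2 h3
      rw [h6, h7]
      exact hθ.side_eq hd h4 h5
    refine sum_sum_antisymm _ _ fun v u => ?_
    rw [hia.swap01 v u, neg_smul]
    by_cases h0 : α i ![v, u] = 0
    · simp [h0]
    · dsimp only
      rw [hsym v u h0, hs.tets.pos.1 u v, hs.tets.neg.1 u v]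
  have hcP := pairing_combinedPotential (o := o) hd φ χ ε d (hcyc i).1 P (hV i P hs.tets.pos)
    (hs.pos i)
  have hcN := pairing_combinedPotential (o := o) hd φ χ ε d (hcyc i).1 N (hV i N hs.tets.neg)
    (hs.neg i)
  simp only [k] at hkP hkN
  rw [pairing_sub, pairing_sub, hΨP, hcP, sub_zero, sub_neg_eq_add] at hkP
  rw [pairing_sub, pairing_sub, hΨN, hcN, sub_zero, sub_neg_eq_add] at hkN
  rw [eq_neg_of_add_eq_zero_left hkP, eq_neg_of_add_eq_zero_left hkN] at hθ0
  rw [eq_neg_iff_add_eq_zero]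
  -- What has been obtained is τ - 1 applied to the desired equation.
  refine hτ _ (sub_eq_zero.1 ?_)
  rw [← neg_eq_zero, ← hθ0]
  simp only [hd_def, map_neg, map_add, map_sum, map_smul, map_sub, smul_sub,
      Finset.sum_sub_distrib]
  abel

end Twisted

/-! ### Change of the surface. -/

section Transfer

variable {T : Cx} {o : Chain 3} {f g : Chain 2} {E : Type*} [AddCommGroup E]
  [Module.IsTorsionFree ℤ E]

/-- A 2-chain away from `y` has a boundary that does not link `y`. -/
theorem sum_smul_bd_eq_zero (hT : IsSphere 3 T) (ho : IsFundamentalClass T o) {y : Chain 1}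
    {c : Chain 2} {φ : ℕ → Finset ℕ → ℤ} (hy : IsLinkSystem T o y c φ) {D : ℕ → ℕ → ℕ → E}
    (hD : IsTriChain T D) (hDy : ∀ w v u, {u} ∈ (supp y).faces → D w v u = 0)
    {t : ℕ → ℕ → Finset ℕ} (ht : IsEdgeTet T o t) :
    ∑ v ∈ vset o, ∑ u ∈ vset o, φ v (t v u) • ∑ w ∈ vset o, D w v u = 0 := by
  have hca := isAlt_of_mem hy.mem
  refine eq_zero_of_add_self ?_
  -- At an edge off `y`, the difference of the potentials of its ends is the same in all tetrahedra
  -- around it. Twice its value in the chosen tetrahedron is therefore the sum over the two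
  -- tetrahedra at the triangle, and antisymmetry applies.
  have h1 : triSum (vset o) (fun w v u => (2 * φ v (t v u)) • D w v u) = 0 := by
    refine triSum_eq_zero_of_split _
      (A := fun w v u => bothSides o (φ v) w v u • D w v u)
      (B := fun w v u => bothSides o (φ u) w v u • D w v u) ?_ ?_ ?_
    · intro w v u
      rw [hD.swap12 w v u, smul_neg, ← sub_eq_add_neg, ← sub_smul, ← sub_smul]
      by_cases h0 : D w v u = 0
      · rw [h0, smul_zero, smul_zero]
      have hdist := hD.distinct h0
      have hu : {u} ∉ (supp y).faces := fun h => h0 (hDy w v u h)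
      have hv : {v} ∉ (supp y).faces := fun h => h0 (by
        rw [hD.swap12 w u v, hDy w u v h, neg_zero])
      obtain ⟨s, s', hne, hs, hs', -⟩ := exists_two_cofaces hT ho hdist.1 hdist.2.1 hdist.2.2
        (hD.mem w v u h0)
      obtain ⟨s₀, w₀, h2, h3⟩ := ht.2 v u hdist.2.2 (face_mono (hD.mem w v u h0) (by grind)
        (Finset.insert_nonempty _ _))
      have hjump : ∀ w, jump o (fun σ => φ v σ - φ u σ) w v u = 0 := fun w => by
        rw [jump_sub, ← hy.pot u hu w v, jump_swap12 ho _ w u v, ← hy.pot v hv w u,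
          hca.tri12 w v u, neg_neg, sub_self]
      have e1 := eq_around_edge hT ho hjump hs h2
      have e2 := eq_around_edge hT ho hjump hs' h2
      rw [bothSides_eq hT ho _ hs hs' hne, bothSides_eq hT ho _ hs hs' hne, ht.1 u v, h3]
      congr 1
      linarith
    · intro w v u
      rw [hD.swap02 w v u, bothSides_swap02 ho.isAlt _ w v u, smul_neg]
    · intro w v u
      rw [hD.swap01 w v u, bothSides_swap01 ho.isAlt _ w v u, smul_neg]
  rw [← h1, triSum, ← two_zsmul, Finset.smul_sum]
  refine Finset.sum_congr rfl fun v _ => ?_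
  rw [Finset.smul_sum]
  refine Finset.sum_congr rfl fun u _ => ?_
  rw [Finset.smul_sum, Finset.smul_sum]
  exact Finset.sum_congr rfl fun w _ => by rw [smul_smul]

/-- A solution for `f` gives twisted potentials; the gauge change moves them to `g`, where a
solution b' is read off. The sums agree because the two model chains and the global correction
cancel near `y`. -/
theorem exists_solution_of_gauge (hT : IsSphere 3 T) (ho : IsFundamentalClass T o)
    (hf : IsSurface T f) (hg : IsSurface T g) {τ : E ≃ₗ[ℤ] E} {ρ : E →ₗ[ℤ] E}
    (hρ : ∀ y, τ (ρ y) - ρ y = y) (hτ : ∀ y, τ y = y → y = 0)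
    {x y : Chain 1} (hxa : IsAlt x) (hxc : bd x = 0)
    (hfx : Disjoint (supp f) (supp x)) (hgx : Disjoint (supp g) (supp x))
    (hfy : Disjoint (supp f) (supp y)) (hgy : Disjoint (supp g) (supp y))
    {cx cy : Chain 2} {φx φy : ℕ → Finset ℕ → ℤ} (hx : IsLinkSystem T o x cx φx)
    (hy : IsLinkSystem T o y cy φy)
    {n : ℕ} {α : Fin n → Chain 1} {M : Matrix (Fin n) (Fin n) ℤ}
    {C : Fin n → Chain 2} {χ : Fin n → ℕ → Finset ℕ → ℤ} {P N : ℕ → ℕ → Finset ℕ}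
    (hs : IsSeifertSystem T o f α M C χ P N) {V W : Fin n → ℤ}
    (hV : ∀ i t, IsEdgeTet T o t → pairing (vset o) (α i) (fun v u => φx v (t v u)) = -V i)
    (hW : ∀ i t, IsEdgeTet T o t → pairing (vset o) (α i) (fun v u => φy v (t v u)) = -W i)
    {n' : ℕ} {α' : Fin n' → Chain 1} {M' : Matrix (Fin n') (Fin n') ℤ}
    {C' : Fin n' → Chain 2} {χ' : Fin n' → ℕ → Finset ℕ → ℤ} {P' N' : ℕ → ℕ → Finset ℕ}
    (hs' : IsSeifertSystem T o g α' M' C' χ' P' N') {V' W' : Fin n' → ℤ}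
    (hV' : ∀ i t, IsEdgeTet T o t → pairing (vset o) (α' i) (fun v u => φx v (t v u)) = -V' i)
    (hW' : ∀ i t, IsEdgeTet T o t → pairing (vset o) (α' i) (fun v u => φy v (t v u)) = -W' i)
    {e : Finset ℕ → ℤ} (hfg : ∀ w v u, g ![w, v, u] = f ![w, v, u] + jump o e w v u)
    (hex : ∀ z, o z ≠ 0 → ∀ u ∈ verts z, {u} ∈ (supp x).faces → e (verts z) = 0)
    (hey : ∀ z, o z ≠ 0 → ∀ u ∈ verts z, {u} ∈ (supp y).faces → e (verts z) = 0)
    {ε : E} {b : Fin n → E} (hb : ∀ i, ∑ j, (M i j • τ (b j) - M j i • b j) = -(V i • ε)) :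
    ∃ b' : Fin n' → E, (∀ i, ∑ j, (M' i j • τ (b' j) - M' j i • b' j) = -(V' i • ε)) ∧
      ∑ i, W i • b i = ∑ i, W' i • b' i := by
  have hS : ∀ v, {v} ∈ T.faces → v ∈ vset o := fun v hv => mem_vset_of_mem hT ho hv
  obtain ⟨θ, hθ, hθj⟩ := exists_twisted hT ho hf hρ hfx hx hs hV hb
  have hθ' := hθ.gauge hT ho hfg hex
  obtain ⟨b', Ψ, hb', hj'⟩ := hθ'.exists_solution hT ho hg hρ hτ hxa hxc hgx hx hs' hV'
  refine ⟨b', hb', ?_⟩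
  -- At triangles with a vertex on `y` both surfaces are absent and `e` vanishes, so both model
  -- chains describe the same jumps and this difference is zero. Its boundary is ∑ (τ - 1)(b_i) a_i
  -- - ∑ (τ - 1)(b'_i) a'_i.
  let D : ℕ → ℕ → ℕ → E := fun w v u => ∑ i, C i ![w, v, u] • (τ (b i) - b i) -
    (∑ i, C' i ![w, v, u] • (τ (b' i) - b' i) + jump o Ψ w v u)
  have hD : IsTriChain T D :=
    (IsTriChain.sum _ fun i => isTriChain_smul (hs.mem i) _).sub
      ((IsTriChain.sum _ fun i => isTriChain_smul (hs'.mem i) _).add (isTriChain_jump ho Ψ))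
  have hDy : ∀ w v u, {u} ∈ (supp y).faces → D w v u = 0 := by
    intro w v u hu
    have hf0 : f ![w, v, u] = 0 := by
      by_contra h0
      exact notMem_of_disjoint hfy (mem_supp_face h0 (by simp)) hu
    have hg0 : g ![w, v, u] = 0 := by
      by_contra h0
      exact notMem_of_disjoint hgy (mem_supp_face h0 (by simp)) hu
    have h1 := hθj w v u hf0
    have h2 := hj' w v u hg0
    have h3 : jump o (fun σ => (τ ^ e σ) (θ u σ)) w v u = jump o (θ u) w v u := by
      refine Finset.sum_congr rfl fun s _ => ?_
      by_cases h0 : o ![s, w, v, u] = 0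
      · rw [h0, zero_smul, zero_smul]
      · have := hey _ h0 u (by rw [verts_four]; simp) hu
        rw [verts_four] at this
        dsimp only
        rw [this, zpow_zero]
        rfl
    rw [h3, h1] at h2
    simp only [D]
    rw [add_assoc, add_right_inj] at h2
    rw [h2, sub_self]
  have hsum : ∀ v u, ∑ w ∈ vset o, D w v u = ∑ i, α i ![v, u] • (τ (b i) - b i) -
      ∑ i, α' i ![v, u] • (τ (b' i) - b' i) := by
    intro v u
    simp only [D]
    rw [Finset.sum_sub_distrib, Finset.sum_add_distrib, sum_jump ho, add_zero, Finset.sum_comm,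
      Finset.sum_comm (s := vset o)]
    simp only [← Finset.sum_smul, ← bd_apply_two hS (hs.mem _), hs.bd_eq,
      ← bd_apply_two hS (hs'.mem _), hs'.bd_eq]
  have hP := hs.tets.pos
  have hzero := sum_smul_bd_eq_zero hT ho hy hD hDy hP
  simp only [hsum, smul_sub (M := ℤ) (A := E) (_ : ℤ) (∑ i, _ • _), Finset.sum_sub_distrib] at hzero
  rw [sum_smul_sum_eq_pairing _ (fun v u => φy v (P v u)) α,
    sum_smul_sum_eq_pairing _ (fun v u => φy v (P v u)) α'] at hzero
  simp only [hW _ P hP, hW' _ P hP] at hzero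
  rw [← sub_eq_zero]
  -- Linking with `y` gives the equality of the two sums only after applying τ - 1.
  refine hτ _ (sub_eq_zero.1 ?_)
  rw [← neg_eq_zero, ← hzero]
  simp only [map_sub, map_sum, map_smul, neg_smul, smul_sub, Finset.sum_sub_distrib,
    Finset.sum_neg_distrib]
  abel

theorem supp_zero_notMem (v : ℕ) : {v} ∉ (supp (0 : Chain 1)).faces := by
  rintro ⟨-, z, hz, -⟩
  exact hz rfl

theorem disjoint_supp_zero (F : Cx) : Disjoint F (supp (0 : Chain 1)) := by
  have : supp (0 : Chain 1) = ⊥ := by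
    refine le_bot_iff.1 ?_
    rintro σ ⟨-, z, hz, -⟩
    exact absurd rfl hz
  rw [this]
  exact disjoint_bot_right

/-- A homogeneous solution for `g` gives twisted potentials, transported to `f`, where the
associated solution is zero by hypothesis. These potentials therefore come from one global twisted
function, up to constants at the vertices; transported back, that function shows that the cycle ∑ (τ
- 1)(b'_i) a'_i bounds in the surface `g`. -/
theorem injective_of_gauge (hT : IsSphere 3 T) (ho : IsFundamentalClass T o)
    (hf : IsSurface T f) (hg : IsSurface T g) {τ : E ≃ₗ[ℤ] E} {ρ : E →ₗ[ℤ] E}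
    (hρ : ∀ y, τ (ρ y) - ρ y = y) (hτ : ∀ y, τ y = y → y = 0)
    {n : ℕ} {α : Fin n → Chain 1} {M : Matrix (Fin n) (Fin n) ℤ}
    {C : Fin n → Chain 2} {χ : Fin n → ℕ → Finset ℕ → ℤ} {P N : ℕ → ℕ → Finset ℕ}
    (hs : IsSeifertSystem T o f α M C χ P N)
    {n' : ℕ} {α' : Fin n' → Chain 1} {M' : Matrix (Fin n') (Fin n') ℤ}
    {C' : Fin n' → Chain 2} {χ' : Fin n' → ℕ → Finset ℕ → ℤ} {P' N' : ℕ → ℕ → Finset ℕ}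
    (hs' : IsSeifertSystem T o g α' M' C' χ' P' N')
    {e : Finset ℕ → ℤ} (hfg : ∀ w v u, g ![w, v, u] = f ![w, v, u] + jump o e w v u)
    (hinj : ∀ b : Fin n → E, (∀ i, ∑ j, (M i j • τ (b j) - M j i • b j) = 0) → b = 0)
    {b' : Fin n' → E} (hb' : ∀ i, ∑ j, (M' i j • τ (b' j) - M' j i • b' j) = 0) : b' = 0 := by
  have hS : ∀ v, {v} ∈ T.faces → v ∈ vset o := fun v hv => mem_vset_of_mem hT ho hv
  -- The homogeneous equations correspond to the empty boundary, x = 0 and ε = 0.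
  have hx : IsLinkSystem T o 0 0 0 := ⟨zero_mem _, map_zero _, fun v _ w u => by simp [jump]⟩
  obtain ⟨θ', hθ', hj'⟩ := exists_twisted hT ho hg hρ (disjoint_supp_zero _) hx hs'
    (V := 0) (ε := 0) (fun i t _ => by simp [pairing]) (b := b') (fun i => by simp [hb' i])
  simp only [smul_zero, add_zero, zero_add] at hj'
  have hθ := hθ'.gauge hT ho (g := f) (e := fun σ => -e σ) (fun w v u => by
    rw [hfg]
    simp [jump, Finset.sum_neg_distrib]) (fun z _ u _ h => absurd h (supp_zero_notMem u))
  obtain ⟨b, Ψ, hb, hj⟩ := hθ.exists_solution hT ho hf hρ hτ (fun π z => by simp) (map_zero _)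
    (disjoint_supp_zero _) hx hs (V := 0) (fun i t _ => by simp [pairing])
  have hb0 := hinj b fun i => by rw [hb]; simp
  subst hb0
  set θ : ℕ → Finset ℕ → E := fun v σ => (τ ^ (-e σ)) (θ' v σ) with hθ_def
  simp only [smul_zero, add_zero, zero_add, Pi.zero_apply, map_zero, sub_self,
    Finset.sum_const_zero] at hj
  have hk : ∀ w u v, f ![w, u, v] = 0 → jump o (fun σ => θ v σ - Ψ σ) w u v = 0 := by
    intro w u v h0
    rw [jump_sub, hj w u v h0, sub_self]
  obtain ⟨κp, hκp⟩ := exists_side_value hT ho hf (k := fun v σ => θ v σ - Ψ σ) (Or.inr rfl) hk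
  obtain ⟨κn, hκn⟩ := exists_side_value hT ho hf (k := fun v σ => θ v σ - Ψ σ) (Or.inl rfl) hk
  have hperm : ∀ s w v u, o ![s, w, u, v] * f ![w, u, v] = o ![s, w, v, u] * f ![w, v, u] :=
    fun s w v u => by rw [ho.isAlt.tet23 s w v u, hf.isAlt.tri12 w v u, neg_mul_neg]
  have hstep : ∀ v u, {v, u} ∈ (supp f).faces → τ (κp v) - κn v = τ (κp u) - κn u := by
    intro v u hvu
    by_cases hne : v = u
    · rw [hne]
    obtain ⟨w, hw⟩ := hf.isAlt.exists_of_edge_mem_supp hne hvu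
    obtain ⟨s, s', -, h1, h2⟩ := exists_side hT ho hf hw
    have h3 := hθ.side_eq (disjoint_supp_zero _) h1 h2
    have e1 := hκp s w v u h1
    have e2 := hκn s' w v u h2
    have e3 := hκp s w u v (by rw [hperm, h1])
    have e4 := hκn s' w u v (by rw [hperm, h2])
    rw [Finset.pair_comm u v] at e3 e4
    rw [← e1, ← e2, ← e3, ← e4, map_sub, map_sub, ← sub_eq_zero]
    rw [← sub_eq_zero] at h3
    rw [← h3]
    abel
  -- The deviation from Ψ has constants κp, κn on the two sides at each vertex. Matching makes τ κp
  -- - κn constant along edges, hence on the connected surface.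
  obtain ⟨κ, hκ⟩ : ∃ κ : E, ∀ v, {v} ∈ (supp f).faces → τ (κp v) - κn v = κ := by
    by_cases hne : ∃ v₀, {v₀} ∈ (supp f).faces
    · obtain ⟨v₀, hv₀⟩ := hne
      exact ⟨τ (κp v₀) - κn v₀, fun v hv => hf.conn (fun v => τ (κp v) - κn v = τ (κp v₀) - κn v₀)
        (fun v u hvu h => by rw [← hstep v u hvu, h]) v₀ v hv₀ hv rfl⟩
    · push Not at hne
      exact ⟨0, fun v hv => absurd hv (hne v)⟩
  -- The shift by ρ(κ) turns τ κp - κn = κ into the twisted matching condition τ(κp - ρκ) = κn - ρκ.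
  let Φ : Finset ℕ → E := fun σ => Ψ σ + ρ κ
  have hconst : ∀ s s' w v u, o ![s, w, v, u] ≠ 0 → o ![s', w, v, u] ≠ 0 → s ≠ s' →
      (τ ^ (o ![s, w, v, u] * f ![w, v, u])) (θ u {s', w, v, u} - Φ {s', w, v, u}) =
        θ u {s, w, v, u} - Φ {s, w, v, u} := by
    intro s s' w v u h1 h2 hne
    simp only [Φ]
    by_cases h0 : f ![w, v, u] = 0
    · have := eq_of_jump_eq_zero hT ho (hk w v u h0) h2 h1
      rw [h0, mul_zero, zpow_zero, LinearEquiv.coe_one, id, ← sub_sub, ← sub_sub]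
      exact congrArg (· - ρ κ) this
    · have hκu := hκ u (mem_supp_face h0 (by simp))
      obtain ⟨p, p', hpp, h3, h4⟩ := exists_side hT ho hf h0
      have hp : o ![p, w, v, u] ≠ 0 := fun h0 => by rw [h0] at h3; simp at h3
      have hp' : o ![p', w, v, u] ≠ 0 := fun h0 => by rw [h0] at h4; simp at h4
      have e1 := hκp p w v u h3
      have e2 := hκn p' w v u h4
      have hρκ := hρ κ
      have key : τ (θ u {p, w, v, u} - (Ψ {p, w, v, u} + ρ κ)) =
          θ u {p', w, v, u} - (Ψ {p', w, v, u} + ρ κ) := by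
        rw [← sub_sub, ← sub_sub, e1, e2, map_sub, ← sub_eq_zero]
        rw [← sub_eq_zero] at hκu hρκ
        rw [← sub_zero (0 : E)]
        nth_rewrite 1 [← hκu]
        rw [← hρκ]
        abel
      obtain ⟨r, hr, hrs, hall⟩ := exists_opposite hT ho hp
      obtain rfl : p' = r := (hall p' hp').resolve_left hpp.symm
      rcases hall s h1 with rfl | rfl
      · obtain rfl : s' = p' := (hall s' h2).resolve_left hne.symm
        rw [h3, zpow_neg_one, ← key, ← LinearEquiv.mul_apply, inv_mul_cancel]
        rfl
      · obtain rfl : s' = p := (hall s' h2).resolve_right hne.symm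
        rw [h4, zpow_one, key]
  let Φ' : Finset ℕ → E := fun σ => (τ ^ e σ) (Φ σ)
  have hθ'' : ∀ v σ, θ' v σ = (τ ^ e σ) (θ v σ) := fun v σ => by
    rw [hθ_def, ← LinearEquiv.mul_apply, ← zpow_add, add_neg_cancel, zpow_zero]
    rfl
  -- Off `g` the jumps of the twisted potentials equal those of Φ', so this chain lives on the
  -- surface `g`; its boundary is ∑ (τ - 1)(b'_i) a'_i, and the basis is linearly independent.
  let D : ℕ → ℕ → ℕ → E := fun w v u => ∑ i, C' i ![w, v, u] • (τ (b' i) - b' i) - jump o Φ' w v u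
  have hD0 : ∀ w v u, g ![w, v, u] = 0 → D w v u = 0 := by
    intro w v u h0
    simp only [D]
    rw [← hj' w v u h0, ← jump_sub]
    refine jump_eq_zero hT ho fun s s' h1 h2 => ?_
    by_cases hne : s = s'
    · rw [hne]
    have h3 := hfg w v u
    rw [PLKnot.jump_eq hT ho e h1 h2 hne, smul_eq_mul, h0] at h3
    have h4 : e {s', w, v, u} = e {s, w, v, u} + o ![s, w, v, u] * f ![w, v, u] := by
      rcases ho.eq_or h1 with h | h <;> rw [h] at h3 ⊢ <;> linarith
    simp only [Φ', hθ'']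
    rw [← map_sub, ← map_sub, h4, zpow_add, LinearEquiv.mul_apply, hconst s s' w v u h1 h2 hne]
  have hDT : IsTriChain T D :=
    (IsTriChain.sum _ fun i => isTriChain_smul (hs'.mem i) _).sub (isTriChain_jump ho Φ')
  have hD : IsTriChain (supp g) D := ⟨hDT.swap01, hDT.swap12, fun w v u hne =>
    ⟨Finset.insert_nonempty _ _, _, fun h0 => hne (hD0 w v u h0), by rw [verts_three]⟩⟩
  have hz := hs'.basis.eq_zero_of_bd_coeff (S := vset o) (fun v hv => hS v (hg.supp_subset hv))
    (b := fun i => τ (b' i) - b' i) hD (fun v u => by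
      simp only [D]
      rw [Finset.sum_sub_distrib, sum_jump ho, sub_zero, Finset.sum_comm]
      simp only [← Finset.sum_smul, ← bd_apply_two hS (hs'.mem _), hs'.bd_eq])
  funext i
  exact hτ _ (sub_eq_zero.1 (congrFun hz i))

end Transfer

/-! ### Transfer of solutions of the twisted Seifert equations -/

/-- `b` solves `(τ M - Mᵀ) b = -V ε`. -/
def IsSolution {E : Type*} [AddCommGroup E] (τ : E ≃ₗ[ℤ] E) {n : ℕ}
    (M : Matrix (Fin n) (Fin n) ℤ) (V : Fin n → ℤ) (ε : E) (b : Fin n → E) : Prop :=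
  ∀ i, ∑ j, (M i j • τ (b j) - M j i • b j) = -(V i • ε)

/-- The solutions of the twisted equations for `M` can be transferred to `M'`. -/
structure Transfers {n n' : ℕ} (M : Matrix (Fin n) (Fin n) ℤ) (V W : Fin n → ℤ)
    (M' : Matrix (Fin n') (Fin n') ℤ) (V' W' : Fin n' → ℤ) : Prop where
  solution : ∀ {E : Type} [AddCommGroup E] [Module.IsTorsionFree ℤ E] (τ : E ≃ₗ[ℤ] E),
    Function.Bijective (fun y => τ y - y) → ∀ (ε : E) (b : Fin n → E), IsSolution τ M V ε b →
      ∃ b' : Fin n' → E, IsSolution τ M' V' ε b' ∧ ∑ i, W i • b i = ∑ i, W' i • b' i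
  injective : ∀ {E : Type} [AddCommGroup E] [Module.IsTorsionFree ℤ E] (τ : E ≃ₗ[ℤ] E),
    Function.Bijective (fun y => τ y - y) → (∀ b : Fin n → E, IsSolution τ M 0 0 b → b = 0) →
      ∀ b' : Fin n' → E, IsSolution τ M' 0 0 b' → b' = 0

theorem exists_section {E : Type*} [AddCommGroup E] {τ : E ≃ₗ[ℤ] E}
    (h : Function.Bijective fun y => τ y - y) :
    (∃ ρ : E →ₗ[ℤ] E, ∀ y, τ (ρ y) - ρ y = y) ∧ ∀ y, τ y = y → y = 0 := by
  refine ⟨?_, fun y hy => h.1 ?_⟩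
  · let ℓ := LinearEquiv.ofBijective ((τ : E →ₗ[ℤ] E) - LinearMap.id) h
    exact ⟨ℓ.symm, fun y => ℓ.apply_symm_apply y⟩
  · simp [hy]

theorem SEquivalent.transfers {T : Cx} (hT : IsSphere 3 T) {o : Chain 3}
    (ho : IsFundamentalClass T o) {K x y : Chain 1} (hK : IsKnot T K) (hx : IsKnot T x)
    (hy : IsKnot T y) {F F' : Chain 2} (hF : IsSeifertSurface T K F)
    (hF' : IsSeifertSurface T K F') (hFx : Disjoint (supp F) (supp x))
    (hFy : Disjoint (supp F) (supp y)) (hFx' : Disjoint (supp F') (supp x))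
    (hFy' : Disjoint (supp F') (supp y)) (hS : SEquivalent T o K x y F F') {n n' : ℕ}
    {α : Fin n → Chain 1} {α' : Fin n' → Chain 1} (hα : IsHomologyBasis (supp F) α)
    (hα' : IsHomologyBasis (supp F') α') {M : Matrix (Fin n) (Fin n) ℤ}
    {M' : Matrix (Fin n') (Fin n') ℤ} (hM : IsSeifertMatrix T o F α M)
    (hM' : IsSeifertMatrix T o F' α' M') {V W : Fin n → ℤ} {V' W' : Fin n' → ℤ}
    (hV : IsLinkingVector T o y α V) (hW : IsLinkingVector T o x α W)
    (hV' : IsLinkingVector T o y α' V') (hW' : IsLinkingVector T o x α' W') :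
    Transfers M V W M' V' W' := by
  have hf := hF.isSurface hK.2.2.1
  have hg := hF'.isSurface hK.2.2.1
  obtain ⟨D, hD, hFF, hDx, hDy⟩ := hS.exists_chain hT.card_le ho.1 hx.1 hy.1
  obtain ⟨e, he⟩ := exists_function_of_chain ho hD
  have hfg : ∀ w v u, F' ![w, v, u] = F ![w, v, u] + jump o e w v u := fun w v u => by
    rw [hFF, Finsupp.add_apply, bd_eq_jump he]
  have hav : ∀ {x}, Avoids D x →
      ∀ z, o z ≠ 0 → ∀ u ∈ verts z, {u} ∈ (supp x).faces → e (verts z) = 0 := by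
    intro x hDx z hz u hu hux
    have := hDx z u hu hux
    rw [he] at this
    exact (mul_eq_zero.1 this).resolve_left hz
  obtain ⟨C, χ, P, N, hs⟩ := exists_seifertSystem hT ho hf hα hM
  obtain ⟨C', χ', P', N', hs'⟩ := exists_seifertSystem hT ho hg hα' hM'
  obtain ⟨cx, φx, hlx⟩ := exists_linkSystem hT ho hx.1 hx.2.1
  obtain ⟨cy, φy, hly⟩ := exists_linkSystem hT ho hy.1 hy.2.1
  have hlink : ∀ {x : Chain 1} {c : Chain 2} {φ : ℕ → Finset ℕ → ℤ}, IsLinkSystem T o x c φ →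
      ∀ {f : Chain 2} {n : ℕ} {α : Fin n → Chain 1} {V : Fin n → ℤ}, IsHomologyBasis (supp f) α →
      IsLinkingVector T o x α V → ∀ i t, IsEdgeTet T o t →
      pairing (vset o) (α i) (fun v u => φ v (t v u)) = -V i := by
    intro x c φ hl f n α V hα hV i t ht
    obtain ⟨hcyc, -⟩ := hα
    exact linkingNumber_eq hT ho (hV i) (isAlt_of_mem (hcyc i).1) hl.mem hl.bd_eq hl.pot ht
  refine ⟨fun τ hτ ε b hb => ?_, fun τ hτ hinj b' hb' => ?_⟩
  · obtain ⟨⟨ρ, hρ⟩, hτ'⟩ := exists_section hτ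
    exact exists_solution_of_gauge hT ho hf hg hρ hτ' (isAlt_of_mem hy.1) hy.2.1 hFy hFy' hFx hFx'
      hly hlx hs (hlink hly hα hV) (hlink hlx hα hW) hs' (hlink hly hα' hV') (hlink hlx hα' hW')
      hfg (hav hDy) (hav hDx) hb
  · obtain ⟨⟨ρ, hρ⟩, hτ'⟩ := exists_section hτ
    refine injective_of_gauge hT ho hf hg hρ hτ' hs hs' hfg (fun b hb => hinj b fun i => ?_)
      fun i => ?_
    · rw [hb i]; simp
    · rw [hb' i]; simp

/-! ### The invariants -/

section Field

variable {K : Type} [Field K]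

/-- The matrix `t M - Mᵀ`. -/
def pencil {n : ℕ} (M : Matrix (Fin n) (Fin n) ℤ) (t : K) : Matrix (Fin n) (Fin n) K :=
  t • M.map (Int.cast : ℤ → K) - (M.map (Int.cast : ℤ → K))ᵀ

/-- Multiplication by `t`. -/
def mulEquiv (t : K) (ht : t ≠ 0) : K ≃ₗ[ℤ] K :=
  (LinearEquiv.smulOfNeZero K K t ht).toAddEquiv.toIntLinearEquiv

theorem mulEquiv_apply (t : K) (ht : t ≠ 0) (y : K) : mulEquiv t ht y = t * y := rfl

theorem isSolution_mulEquiv_iff {t : K} (ht : t ≠ 0) {n : ℕ} {M : Matrix (Fin n) (Fin n) ℤ}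
    {V : Fin n → ℤ} {ε : K} {b : Fin n → K} :
    IsSolution (mulEquiv t ht) M V ε b ↔
      pencil M t *ᵥ b = -(ε • fun i => (V i : K)) := by
  rw [funext_iff]
  refine forall_congr' fun i => ?_
  have h1 : (pencil M t *ᵥ b) i =
      ∑ j, (M i j • mulEquiv t ht (b j) - M j i • b j) := by
    rw [Matrix.mulVec, dotProduct]
    refine Finset.sum_congr rfl fun j _ => ?_
    simp only [pencil, Matrix.sub_apply, Matrix.smul_apply, Matrix.map_apply,
      Matrix.transpose_apply, smul_eq_mul, zsmul_eq_mul, mulEquiv_apply]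
    ring
  rw [h1]
  simp only [Pi.neg_apply, Pi.smul_apply, smul_eq_mul, zsmul_eq_mul, mul_comm]

theorem bijective_mulEquiv_sub {t : K} (ht : t ≠ 0) (h1 : t ≠ 1) :
    Function.Bijective (fun y => mulEquiv t ht y - y) := by
  have h2 : t - 1 ≠ 0 := sub_ne_zero.2 h1
  have h3 : (fun y => mulEquiv t ht y - y) = fun y => (t - 1) * y := by
    funext y
    rw [mulEquiv_apply]
    ring
  rw [h3]
  exact (Equiv.mulLeft₀ (t - 1) h2).bijective

theorem isUnit_iff_mulVec {ι : Type*} [Fintype ι] [DecidableEq ι] {A : Matrix ι ι K} :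
    IsUnit A ↔ ∀ b, A *ᵥ b = 0 → b = 0 := by
  rw [← Matrix.mulVec_injective_iff_isUnit]
  exact injective_iff_map_eq_zero A.mulVecLin

variable [CharZero K] {n n' : ℕ} {M : Matrix (Fin n) (Fin n) ℤ} {V W : Fin n → ℤ}
  {M' : Matrix (Fin n') (Fin n') ℤ} {V' W' : Fin n' → ℤ}

theorem Transfers.isUnit_pencil (h : Transfers M V W M' V' W') {t : K} (ht : t ≠ 0) (h1 : t ≠ 1)
    (hu : IsUnit (pencil M t)) : IsUnit (pencil M' t) := by
  rw [isUnit_iff_mulVec] at hu ⊢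
  intro b' hb'
  refine h.injective _ (bijective_mulEquiv_sub ht h1) (fun b hb => hu b ?_) b' ?_
  · rw [isSolution_mulEquiv_iff] at hb
    rw [hb]; simp
  · rw [isSolution_mulEquiv_iff, hb']; simp

theorem Transfers.pencil_inv_eq (h : Transfers M V W M' V' W') {t : K} (ht : t ≠ 0) (h1 : t ≠ 1)
    (hu : IsUnit (pencil M t)) :
    (fun i => (W i : K)) ⬝ᵥ ((pencil M t)⁻¹ *ᵥ fun i => (V i : K)) =
      (fun i => (W' i : K)) ⬝ᵥ ((pencil M' t)⁻¹ *ᵥ fun i => (V' i : K)) := by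
  have hu' := h.isUnit_pencil ht h1 hu
  rw [Matrix.isUnit_iff_isUnit_det] at hu hu'
  -- With ε = -1 the right-hand side -εV is V, so the solution is the inverse pencil applied to V.
  obtain ⟨b', hb', heq⟩ := h.solution (mulEquiv t ht)
    (bijective_mulEquiv_sub ht h1) (-1) ((pencil M t)⁻¹ *ᵥ fun i => (V i : K)) (by
      rw [isSolution_mulEquiv_iff, Matrix.mulVec_mulVec, Matrix.mul_nonsing_inv _ hu]
      simp)
  rw [isSolution_mulEquiv_iff] at hb'
  have hb'' : b' = (pencil M' t)⁻¹ *ᵥ fun i => (V' i : K) := by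
    have := congrArg (fun z => (pencil M' t)⁻¹ *ᵥ z) hb'
    simpa [Matrix.mulVec_mulVec, Matrix.nonsing_inv_mul _ hu'] using this
  rw [← hb'']
  simpa [dotProduct] using heq

end Field

variable {n n' : ℕ} {M : Matrix (Fin n) (Fin n) ℤ} {V W : Fin n → ℤ}
  {M' : Matrix (Fin n') (Fin n') ℤ} {V' W' : Fin n' → ℤ}

/-- The two pencils are singular simultaneously, which needs transfers in both directions; in the
singular case both inverses are zero by convention. -/
theorem Transfers.lambdaT_eq (h : Transfers M V W M' V' W') (h' : Transfers M' V' W' M V W) :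
    lambdaT M W V = lambdaT M' W' V' := by
  have hX0 : (RatFunc.X : RatFunc ℚ) ≠ 0 := RatFunc.X_ne_zero
  have hX1 : (RatFunc.X : RatFunc ℚ) ≠ 1 := by
    intro hX
    have := congrArg (RatFunc.eval (RingHom.id ℚ) 0) hX
    simp at this
  by_cases hu : IsUnit (pencil M (RatFunc.X : RatFunc ℚ))
  · exact h.pencil_inv_eq hX0 hX1 hu
  · have hu' : ¬ IsUnit (pencil M' (RatFunc.X : RatFunc ℚ)) := fun hu' =>
      hu (h'.isUnit_pencil hX0 hX1 hu')
    rw [Matrix.isUnit_iff_isUnit_det] at hu hu'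
    have e1 : (GT M)⁻¹ = 0 := Matrix.nonsing_inv_apply_not_isUnit _ hu
    have e2 : (GT M')⁻¹ = 0 := Matrix.nonsing_inv_apply_not_isUnit _ hu'
    rw [lambdaT, lambdaT, e1, e2]
    simp

theorem aeval_alexander (M : Matrix (Fin n) (Fin n) ℤ) (ω : ℂ) :
    Polynomial.aeval ω (alexander M) = (pencil M ω).det := by
  rw [alexander, AlgHom.map_det]
  congr 1
  ext i j
  simp [pencil]

theorem GOmega_eq_smul {ω : ℂ} (hω : starRingEnd ℂ ω * ω = 1) (M : Matrix (Fin n) (Fin n) ℤ) :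
    GOmega M ω = (ω - 1) • pencil M (starRingEnd ℂ ω) := by
  ext i j
  simp only [GOmega, pencil, Matrix.add_apply, Matrix.smul_apply, Matrix.sub_apply, smul_eq_mul,
    Matrix.transpose_apply, Matrix.map_apply]
  linear_combination (-(M i j : ℂ)) * hω

theorem pencil_conj_transpose {ω : ℂ} (hω : starRingEnd ℂ ω * ω = 1)
    (M : Matrix (Fin n) (Fin n) ℤ) :
    (pencil M (starRingEnd ℂ ω))ᵀ = (-starRingEnd ℂ ω) • pencil M ω := by
  ext i j
  simp only [pencil, Matrix.smul_apply, Matrix.sub_apply, smul_eq_mul,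
    Matrix.transpose_apply, Matrix.map_apply]
  linear_combination (M i j : ℂ) * hω

theorem Transfers.lambdaOmega_eq (h : Transfers M V W M' V' W') {ω : ℂ}
    (hω : ∃ r : ℕ, 0 < r ∧ ω ^ r = 1) (hω1 : ω ≠ 1)
    (hA : Polynomial.aeval ω (alexander M) ≠ 0) :
    IsUnit (GOmega M ω) ∧ IsUnit (GOmega M' ω) ∧
      lambdaOmega M W V ω = lambdaOmega M' W' V' ω := by
  obtain ⟨r, hr, hωr⟩ := hω
  have hnorm := Complex.norm_eq_one_of_pow_eq_one hωr hr.ne'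
  have hconj : starRingEnd ℂ ω * ω = 1 := by
    rw [mul_comm, Complex.mul_conj, Complex.normSq_eq_norm_sq, hnorm]; simp
  have hc0 : starRingEnd ℂ ω ≠ 0 := left_ne_zero_of_mul_eq_one hconj
  have hc1 : starRingEnd ℂ ω ≠ 1 := fun h1 => hω1 (by rw [h1, one_mul] at hconj; exact hconj)
  have hω0 : ω - 1 ≠ 0 := sub_ne_zero.2 hω1
  -- The hypothesis concerns the pencil at ω, whereas τ is multiplication by its conjugate;
  -- transposition exchanges the two up to a unit.
  have hu : IsUnit (pencil M (starRingEnd ℂ ω)) := by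
    rw [← Matrix.isUnit_transpose, pencil_conj_transpose hconj, Matrix.isUnit_iff_isUnit_det,
      Matrix.det_smul, ← aeval_alexander, isUnit_iff_ne_zero]
    exact mul_ne_zero (pow_ne_zero _ (neg_ne_zero.2 hc0)) hA
  have hu' := h.isUnit_pencil hc0 hc1 hu
  have hsmul : ∀ {k : ℕ} {A : Matrix (Fin k) (Fin k) ℂ}, IsUnit A → IsUnit ((ω - 1) • A) := by
    intro k A hA
    rw [Matrix.isUnit_iff_isUnit_det] at hA ⊢
    rw [Matrix.det_smul]
    exact (IsUnit.pow _ (isUnit_iff_ne_zero.2 hω0)).mul hA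
  have hinv : ∀ {k : ℕ} {A : Matrix (Fin k) (Fin k) ℂ}, IsUnit A →
      ((ω - 1) • A)⁻¹ = (ω - 1)⁻¹ • A⁻¹ := by
    intro k A hA
    rw [Matrix.isUnit_iff_isUnit_det] at hA
    refine Matrix.inv_eq_right_inv ?_
    rw [Matrix.smul_mul, Matrix.mul_smul, smul_smul, mul_inv_cancel₀ hω0, one_smul,
      Matrix.mul_nonsing_inv _ hA]
  have hlam : ∀ {k : ℕ} {M : Matrix (Fin k) (Fin k) ℤ} (V W : Fin k → ℤ),
      IsUnit (pencil M (starRingEnd ℂ ω)) → lambdaOmega M W V ω = (ω - 1)⁻¹ *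
        ((fun i => (W i : ℂ)) ⬝ᵥ ((pencil M (starRingEnd ℂ ω))⁻¹ *ᵥ fun i => (V i : ℂ))) := by
    intro k M V W hu
    rw [lambdaOmega, GOmega_eq_smul hconj, hinv hu, Matrix.smul_mulVec, dotProduct_smul,
      smul_eq_mul]
  refine ⟨?_, ?_, ?_⟩
  · rw [GOmega_eq_smul hconj]; exact hsmul hu
  · rw [GOmega_eq_smul hconj]; exact hsmul hu'
  · rw [hlam V W hu, hlam V' W' hu', h.pencil_inv_eq hc0 hc1 hu]

/-! ### The block tridiagonal matrix -/

section Tridiagonal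

/-- The matrix `1 - N`, where `N` is the lower shift. -/
def backwardDiff (q : ℕ) : Matrix (Fin q) (Fin q) ℚ :=
  fun k l => if k = l then 1 else if (k : ℕ) = l + 1 then -1 else 0

theorem det_backwardDiff (q : ℕ) : (backwardDiff q).det = 1 := by
  rw [Matrix.det_of_isLowerTriangular]
  · simp [backwardDiff]
  · intro k l hkl
    have h : k < l := hkl
    have h1 : k ≠ l := h.ne
    have h2 : (k : ℕ) ≠ l + 1 := by
      have : (k : ℕ) < l := h
      omega
    simp [backwardDiff, h1, h2]

/-- This is the second-difference matrix with zero boundary values: a vector in its kernel is an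
arithmetic progression vanishing at both ends. -/
theorem isUnit_backwardDiff_add (q : ℕ) : IsUnit (backwardDiff q + (backwardDiff q)ᵀ) := by
  rw [isUnit_iff_mulVec]
  intro b hb
  -- The vector shifted by one place, with the boundary values 0 at positions 0 and q + 1.
  let B : ℕ → ℚ := fun m => if m = 0 then 0 else if h : m - 1 < q then b ⟨m - 1, h⟩ else 0
  have hB : ∀ k : Fin q, B (k + 1) = b k := fun k => by simp [B]
  have hB0 : B 0 = 0 := rfl
  have hBq : B (q + 1) = 0 := by simp [B]
  have hrec : ∀ m, m < q → B (m + 2) = 2 * B (m + 1) - B m := by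
    intro m hm
    have h1 := congrFun hb ⟨m, hm⟩
    have hlow : ∑ l : Fin q, (if m = (l : ℕ) + 1 then b l else 0) = B m := by
      by_cases h0 : m = 0
      · subst h0
        simp [hB0]
      · rw [Finset.sum_eq_single ⟨m - 1, by omega⟩]
        · rw [if_pos (by simp; omega), ← hB]
          congr 1
          simp; omega
        · intro l _ hl
          rw [if_neg]
          intro h2
          exact hl (Fin.ext (by simp; omega))
        · simp
    have hupp : ∑ l : Fin q, (if (l : ℕ) = m + 1 then b l else 0) = B (m + 2) := by
      by_cases h0 : m + 1 < q
      · rw [Finset.sum_eq_single ⟨m + 1, h0⟩]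
        · rw [if_pos rfl, ← hB]
        · intro l _ hl
          rw [if_neg]
          intro h2
          exact hl (Fin.ext h2)
        · simp
      · have : B (m + 2) = 0 := by
          simp only [B]
          rw [if_neg (by omega), dif_neg (by omega)]
        rw [this]
        refine Finset.sum_eq_zero fun l _ => if_neg ?_
        have := l.2
        omega
    have hdiag : ∑ l : Fin q, (if m = (l : ℕ) then b l else 0) = B (m + 1) := by
      rw [Finset.sum_eq_single ⟨m, hm⟩]
      · rw [if_pos rfl, ← hB]
      · intro l _ hl
        rw [if_neg]
        intro h2
        exact hl (Fin.ext h2.symm)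
      · simp
    have hrow : ((backwardDiff q + (backwardDiff q)ᵀ) *ᵥ b) ⟨m, hm⟩ =
        2 * ∑ l : Fin q, (if m = (l : ℕ) then b l else 0) -
        ∑ l : Fin q, (if m = (l : ℕ) + 1 then b l else 0) -
        ∑ l : Fin q, (if (l : ℕ) = m + 1 then b l else 0) := by
      rw [Matrix.mulVec, dotProduct, Finset.mul_sum, ← Finset.sum_sub_distrib,
        ← Finset.sum_sub_distrib]
      refine Finset.sum_congr rfl fun l _ => ?_
      simp only [Matrix.add_apply, Matrix.transpose_apply, backwardDiff, Fin.ext_iff]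
      split_ifs <;> first | omega | ring
    rw [hrow, hlow, hupp, hdiag, Pi.zero_apply] at h1
    linarith
  have hlin : ∀ m, m ≤ q → B m = m * B 1 ∧ B (m + 1) = (m + 1 : ℕ) * B 1 := by
    intro m
    induction m with
    | zero => intro _; simp [hB0]
    | succ m ih =>
      intro hm
      obtain ⟨h1, h2⟩ := ih (by omega)
      refine ⟨h2, ?_⟩
      rw [hrec m (by omega), h1, h2]
      push_cast
      ring
  have hB1 : B 1 = 0 := by
    have h1 := (hlin q le_rfl).2
    rw [hBq] at h1
    have h2 : ((q + 1 : ℕ) : ℚ) ≠ 0 := by positivity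
    exact (mul_eq_zero.1 h1.symm).resolve_left h2
  funext k
  rw [← hB, (hlin k k.2.le).2, hB1, mul_zero, Pi.zero_apply]

/-- The automorphism `-(1 - Nᵀ)⁻¹ (1 - N)`. -/
def shiftMatrix (q : ℕ) : Matrix (Fin q) (Fin q) ℚ :=
  -(((backwardDiff q)ᵀ)⁻¹ * backwardDiff q)

theorem isUnit_backwardDiff_transpose (q : ℕ) : IsUnit ((backwardDiff q)ᵀ).det := by
  rw [Matrix.det_transpose, det_backwardDiff]
  exact isUnit_one

theorem transpose_mul_shiftMatrix (q : ℕ) :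
    (backwardDiff q)ᵀ * shiftMatrix q = -backwardDiff q := by
  rw [shiftMatrix, mul_neg, ← mul_assoc, Matrix.mul_nonsing_inv _ (isUnit_backwardDiff_transpose q),
    one_mul]

theorem bijective_mulVec_of_isUnit {q : ℕ} {A : Matrix (Fin q) (Fin q) ℚ} (h : IsUnit A) :
    Function.Bijective A.mulVec :=
  ⟨Matrix.mulVec_injective_iff_isUnit.2 h, Matrix.mulVec_surjective_iff_isUnit.2 h⟩

theorem isUnit_shiftMatrix (q : ℕ) : IsUnit (shiftMatrix q) := by
  rw [Matrix.isUnit_iff_isUnit_det]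
  have h := congrArg Matrix.det (transpose_mul_shiftMatrix q)
  rw [Matrix.det_mul, Matrix.det_transpose, det_backwardDiff, one_mul, Matrix.det_neg,
    det_backwardDiff, mul_one] at h
  rw [h]
  exact (isUnit_one.neg).pow _

/-- The automorphism of `ℚ ^ q` given by `shiftMatrix q`. -/
def shiftEquiv (q : ℕ) : (Fin q → ℚ) ≃ₗ[ℤ] (Fin q → ℚ) :=
  (AddEquiv.ofBijective (shiftMatrix q).mulVecLin.toAddMonoidHom
    (bijective_mulVec_of_isUnit (isUnit_shiftMatrix q))).toIntLinearEquiv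

theorem shiftEquiv_apply (q : ℕ) (y : Fin q → ℚ) : shiftEquiv q y = shiftMatrix q *ᵥ y := rfl

/-- With Δ for `backwardDiff q`, Δᵀ(τ - 1) = -(Δ + Δᵀ), which is invertible. -/
theorem bijective_shiftEquiv_sub (q : ℕ) :
    Function.Bijective (fun y => shiftEquiv q y - y) := by
  have h1 : (fun y => shiftEquiv q y - y) = (shiftMatrix q - 1).mulVec := by
    funext y
    rw [shiftEquiv_apply, Matrix.sub_mulVec, Matrix.one_mulVec]
  rw [h1]
  refine bijective_mulVec_of_isUnit ?_
  have h2 : (backwardDiff q)ᵀ * (shiftMatrix q - 1) = -(backwardDiff q + (backwardDiff q)ᵀ) := by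
    rw [mul_sub, transpose_mul_shiftMatrix, mul_one]
    abel
  have h3 := (isUnit_backwardDiff_add q).neg
  rw [← h2, Matrix.isUnit_iff_isUnit_det, Matrix.det_mul] at h3
  rw [Matrix.isUnit_iff_isUnit_det]
  exact isUnit_of_mul_isUnit_right h3

variable {n : ℕ} (M : Matrix (Fin n) (Fin n) ℤ)

theorem MP_apply (p : ℕ) (r s : Fin (p - 1) × Fin n) : MP M p r s =
    backwardDiff (p - 1) r.1 s.1 * M r.2 s.2 +
      (backwardDiff (p - 1))ᵀ r.1 s.1 * M s.2 r.2 := by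
  simp only [MP, Matrix.transpose_apply, backwardDiff, Fin.ext_iff]
  split_ifs <;> first | omega | ring

/-- Regrouping a block vector as vectors in ℚ^(p-1) turns Δ⊗M + Δᵀ⊗Mᵀ into -Δᵀ(τM - Mᵀ), because Δᵀτ
= -Δ. -/
theorem MP_mulVec (p : ℕ) (b : Fin (p - 1) × Fin n → ℚ) (i : Fin n) :
    (fun k => (MP M p *ᵥ b) (k, i)) = -((backwardDiff (p - 1))ᵀ *ᵥ
      ∑ j, (M i j • shiftEquiv (p - 1) (fun k => b (k, j)) - M j i • fun k => b (k, j))) := by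
  have h1 : ∀ y,
      (backwardDiff (p - 1))ᵀ *ᵥ shiftEquiv (p - 1) y = -(backwardDiff (p - 1) *ᵥ y) := by
    intro y
    rw [shiftEquiv_apply, Matrix.mulVec_mulVec, transpose_mul_shiftMatrix, Matrix.neg_mulVec]
  rw [Matrix.mulVec_sum, ← Finset.sum_neg_distrib]
  simp only [Matrix.mulVec_sub, Matrix.mulVec_smul, h1]
  funext k
  rw [Finset.sum_apply, Matrix.mulVec, dotProduct, Fintype.sum_prod_type, Finset.sum_comm]
  refine Finset.sum_congr rfl fun j _ => ?_
  simp only [Pi.neg_apply, Pi.sub_apply, Pi.smul_apply]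
  simp only [zsmul_eq_mul, Matrix.mulVec, dotProduct, MP_apply]
  rw [mul_neg, neg_sub, sub_neg_eq_add, Finset.mul_sum, Finset.mul_sum, ← Finset.sum_add_distrib]
  refine Finset.sum_congr rfl fun l _ => ?_
  ring

variable {M}

theorem isSolution_shiftEquiv_iff {p : ℕ} {V : Fin n → ℤ} {y : Fin (p - 1) → ℚ}
    {b : Fin (p - 1) × Fin n → ℚ} :
    IsSolution (shiftEquiv (p - 1)) M V (((backwardDiff (p - 1))ᵀ)⁻¹ *ᵥ y)
      (fun j k => b (k, j)) ↔ MP M p *ᵥ b = fun r => (V r.2 : ℚ) * y r.1 := by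
  have hinj := Matrix.mulVec_injective_iff_isUnit.2
    ((Matrix.isUnit_iff_isUnit_det _).2 (isUnit_backwardDiff_transpose (p - 1)))
  have h1 : ∀ i, ∑ j, (M i j • shiftEquiv (p - 1) (fun k => b (k, j)) - M j i • fun k => b (k, j)) =
      -(V i • (((backwardDiff (p - 1))ᵀ)⁻¹ *ᵥ y)) ↔
      (fun k => (MP M p *ᵥ b) (k, i)) = fun k => (V i : ℚ) * y k := by
    intro i
    rw [MP_mulVec, ← hinj.eq_iff, Matrix.mulVec_neg, Matrix.mulVec_smul, Matrix.mulVec_mulVec,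
      Matrix.mul_nonsing_inv _ (isUnit_backwardDiff_transpose _), Matrix.one_mulVec,
      neg_eq_iff_eq_neg]
    have : (fun k => (V i : ℚ) * y k) = V i • y := by funext k; simp
    rw [this]
  constructor
  · intro h
    funext r
    exact congrFun ((h1 r.2).1 (h r.2)) r.1
  · intro h i
    exact (h1 i).2 (by rw [h])

variable {n' : ℕ} {V W : Fin n → ℤ} {M' : Matrix (Fin n') (Fin n') ℤ} {V' W' : Fin n' → ℤ}

theorem Transfers.isUnit_MP (h : Transfers M V W M' V' W') {p : ℕ} (hu : IsUnit (MP M p)) :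
    IsUnit (MP M' p) := by
  rw [isUnit_iff_mulVec] at hu ⊢
  have hz : ∀ {n : ℕ} {M : Matrix (Fin n) (Fin n) ℤ} {b : Fin (p - 1) × Fin n → ℚ},
      IsSolution (shiftEquiv (p - 1)) M 0 0 (fun j k => b (k, j)) ↔ MP M p *ᵥ b = 0 := by
    intro n M b
    have := isSolution_shiftEquiv_iff (M := M) (V := 0) (y := 0) (b := b)
    simp only [Matrix.mulVec_zero, Pi.zero_apply, mul_zero] at this
    exact this
  intro b' hb'
  have h1 := h.injective (shiftEquiv (p - 1)) (bijective_shiftEquiv_sub _) (fun b hb => by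
    have h2 := hu (fun r => b r.2 r.1) (hz.1 hb)
    funext j k
    exact congrFun h2 (k, j)) (fun j k => b' (k, j)) (hz.2 hb')
  funext r
  exact congrFun (congrFun h1 r.2) r.1

theorem VP_dotProduct (W : Fin n → ℤ) {p : ℕ} (k : Fin (p - 1)) (b : Fin (p - 1) × Fin n → ℚ) :
    VP W p k ⬝ᵥ b = (∑ i, W i • fun l => b (l, i)) k := by
  rw [Finset.sum_apply, dotProduct, Fintype.sum_prod_type, Finset.sum_eq_single k]
  · simp [VP]
  · intro l _ hl
    simp [VP, hl]
  · simp

theorem Transfers.lambdaP_eq (h : Transfers M V W M' V' W') {p : ℕ} (hu : IsUnit (MP M p))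
    (k l : Fin (p - 1)) : lambdaP M W V p k l = lambdaP M' W' V' p k l := by
  have hu' := h.isUnit_MP hu
  rw [Matrix.isUnit_iff_isUnit_det] at hu hu'
  have hVP : ∀ {n : ℕ} (V : Fin n → ℤ), VP V p l =
      fun r => (V r.2 : ℚ) * (Pi.single l 1 : Fin (p - 1) → ℚ) r.1 := by
    intro n V
    funext r
    simp [VP, Pi.single_apply]
  -- This ε cancels the factor Δᵀ, so the right-hand side becomes the vector with V in block l; the
  -- k-th coordinate of ∑ W_i b_i is then the invariant.
  obtain ⟨b', hb', heq⟩ := h.solution (shiftEquiv (p - 1)) (bijective_shiftEquiv_sub _)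
    (((backwardDiff (p - 1))ᵀ)⁻¹ *ᵥ Pi.single l 1) (fun j k => ((MP M p)⁻¹ *ᵥ VP V p l) (k, j)) (by
      rw [isSolution_shiftEquiv_iff, Matrix.mulVec_mulVec, Matrix.mul_nonsing_inv _ hu,
        Matrix.one_mulVec, hVP])
  have h1 : MP M' p *ᵥ (fun r => b' r.2 r.1) = VP V' p l := by
    rw [hVP]
    exact isSolution_shiftEquiv_iff.1 hb'
  have h2 : (fun r => b' r.2 r.1) = (MP M' p)⁻¹ *ᵥ VP V' p l := by
    rw [← h1, Matrix.mulVec_mulVec, Matrix.nonsing_inv_mul _ hu', Matrix.one_mulVec]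
  rw [lambdaP, lambdaP, ← h2, VP_dotProduct, VP_dotProduct]
  exact congrFun heq k

end Tridiagonal

end PLKnot

end

theorem proposition3p1 (T : PLKnot.Cx) (hT : PLKnot.IsSphere 3 T)
    (o : PLKnot.Chain 3) (ho : PLKnot.IsFundamentalClass T o)
    (m : ℕ) (K : PLKnot.Chain 1) (L : Fin m → PLKnot.Chain 1) (hL : PLKnot.IsLink T K L)
    (hlk : ∀ i, PLKnot.IsLinkingNumber T o K (L i) 0)
    (F F' : PLKnot.Chain 2)
    (hF : PLKnot.IsSeifertSurface T K F) (hF' : PLKnot.IsSeifertSurface T K F')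
    (hFL : ∀ i, Disjoint (PLKnot.supp F) (PLKnot.supp (L i)))
    (hFL' : ∀ i, Disjoint (PLKnot.supp F') (PLKnot.supp (L i)))
    (i j : Fin m) (hS : PLKnot.SEquivalent T o K (L i) (L j) F F')
    -- arbitrary bases of the first homology groups, Seifert matrices and linking vectors
    (n n' : ℕ) (α : Fin n → PLKnot.Chain 1) (α' : Fin n' → PLKnot.Chain 1)
    (hα : PLKnot.IsHomologyBasis (PLKnot.supp F) α)
    (hα' : PLKnot.IsHomologyBasis (PLKnot.supp F') α')
    (M : Matrix (Fin n) (Fin n) ℤ) (M' : Matrix (Fin n') (Fin n') ℤ)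
    (hM : PLKnot.IsSeifertMatrix T o F α M) (hM' : PLKnot.IsSeifertMatrix T o F' α' M')
    (Vi Vj : Fin n → ℤ) (Vi' Vj' : Fin n' → ℤ)
    (hVi : PLKnot.IsLinkingVector T o (L i) α Vi) (hVj : PLKnot.IsLinkingVector T o (L j) α Vj)
    (hVi' : PLKnot.IsLinkingVector T o (L i) α' Vi')
    (hVj' : PLKnot.IsLinkingVector T o (L j) α' Vj') :
    (∀ ω : ℂ, (∃ r : ℕ, 0 < r ∧ ω ^ r = 1) → ω ≠ 1 →
      Polynomial.aeval ω (PLKnot.alexander M) ≠ 0 →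
        IsUnit (PLKnot.GOmega M ω) ∧ IsUnit (PLKnot.GOmega M' ω) ∧
        PLKnot.lambdaOmega M Vi Vj ω = PLKnot.lambdaOmega M' Vi' Vj' ω) ∧
    PLKnot.lambdaT M Vi Vj = PLKnot.lambdaT M' Vi' Vj' ∧
    (∀ p : ℕ, 2 ≤ p → IsUnit (PLKnot.MP M p) →
      IsUnit (PLKnot.MP M' p) ∧
      ∀ k l : Fin (p - 1),
        PLKnot.lambdaP M Vi Vj p k l = PLKnot.lambdaP M' Vi' Vj' p k l) := by
  -- The inverse matrix acts on the vector of the j-th component, so that component bounds the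
  -- twisted chain, and the i-th one is linked with it.
  have h := hS.transfers hT ho hL.1 (hL.2.1 i) (hL.2.1 j) hF hF' (hFL i) (hFL j) (hFL' i)
    (hFL' j) hα hα' hM hM' hVj hVi hVj' hVi'
  have h' := hS.symm.transfers hT ho hL.1 (hL.2.1 i) (hL.2.1 j) hF' hF (hFL' i) (hFL' j) (hFL i)
    (hFL j) hα' hα hM' hM hVj' hVi' hVj hVi
  exact ⟨fun ω hω hω1 hA => h.lambdaOmega_eq hω hω1 hA, h.lambdaT_eq h',
    fun p _ hu => ⟨h.isUnit_MP hu, fun k l => h.lambdaP_eq hu k l⟩⟩
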